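/- **Problem.** Let $f\ge 0$ be an integer and $\eta>1$ a real number. Items of sizes in $(0,1]$ arrive online. An item of size $x$ has one primary replica of size $x$ and $f$ standby replicas of size $x/\eta$, which on arrival must be placed irrevocably into $f+1$ different bins of capacity $1$. A packing with a designated primary replica of each item is *valid* if, for every set $F$ of at most $f$ bins, each item whose primary replica lies in a bin of $F$ can be given a new primary replica, by promoting one of its standby replicas in a bin outside $F$ from size $x/\eta$ to size $x$ (all primary replicas outside $F$ staying primary), such that no bin outside $F$ has total load more than $1$. $\mathrm{Opt}(\sigma)$ is the minimum number of bins of a valid packing of the item sequence $\sigma$. Before, between and after the arrivals, opened bins may fail and recover arbitrarily, at most $f$ bins being failed at any time. An online algorithm reacts to each arrival and each change of the set of failed bins, without knowledge of the future. It may change which replica of an item is the current primary one, but never moves a replica. At any time its packing has to be valid, each item must have its current primary replica in a non-failed bin, and no non-failed bin may be overloaded. **Harmonic-Stretch.** Let $J=\lfloor 6\eta\rfloor$. An item of size $x$ has primary class $i\le 5$ if $x\in(\frac1{i+1},\frac1i]$, $6$ if $x\in(\frac1{7-1/\eta},\frac16]$ and $7$ if $x\in (0,\frac1{7-1/\eta}]$.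 With $y=x/\eta$ it has standby class $j\le J-1$ if $y\in(\frac1{j+\eta},\frac1{j+\eta-1}]$, $J$ if $y\in(\frac1{7\eta-1},\frac1{J+\eta-1}]$ and $J+1$ if $y\in (0,\frac1{7\eta-1}]$. Items of class $(7,J+1)$ are *small*; the others are *regular* $(i,j)$-items with $i\le6$, $j\le J$. Each class has groups of bins, one of them active; initially a group of empty bins is opened for each class. A group is available if none of its bins is failed. When the active group becomes complete or one of its bins fails, any incomplete available group of the class becomes active, or, if there is none, a fresh group of empty bins. *Regular items.* A group for $(i,j)$-items consists of primary bins $B_0,\dots,B_{j-1}$ and standby bins $\beta^k_z$ ($1\le k\le f$, $0\le z<i$). The $t$-th item of the group ($0\le t<ij$) has its primary replica placed in $B_{t\bmod j}$ and its standby replicas in $\beta^k_{\lfloor t/j\rfloor}$ ($1\le k\le f$). After $ij$ items the group is complete. *Small items.* A group consists of $f$ standby bins with the same content, and of a committed primary bin, which is chosen when the first super-replica of the group is opened. Consecutive small items are merged into super-replicas (a primary one of capacity $\frac{2}{7-1/\eta}$ in the committed bin, and standby ones of capacity $\frac{2}{7\eta-1}$ in the standby bins). An item that fits joins the open super-replicas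 of the active group. Otherwise, if the standby bins of the group have empty space at least $\frac{2\eta}{7\eta-1}$, new super-replicas are opened: the committed bin is freed, and the new committed bin is any non-failed primary bin for small items that is not committed to another group, has empty space at least $\frac{2}{7-1/\eta}$ and shares no item with the standby bins of the group, or a new bin if there is none. Otherwise the group becomes complete, its committed bin is freed, and the item is handled with the next active group. (Empty space is measured without regard to promotions.) *Adjustment.* Whenever the set of failed bins changes, replicas placed as primary in non-failed bins have or regain primary status, and the regular items and super-replicas whose placed primary replica is in a failed bin are mapped injectively to non-failed bins that host a standby replica of them, which is promoted; those already mapped to a bin that is still non-failed keep it. **Theorem.** For every $f$ and every $\eta>1$, Harmonic-Stretch (with any resolution of its arbitrary choices) is an online algorithm for the $(f,\eta)$-fault-tolerant bin packing problem: it can always react as described, and it maintains a valid packing in which every item is available and no bin is overloaded, under arbitrary failures and recoveries (at most $f$ bins failed at a time) while items are still arriving. Its asymptotic competitive ratio is at most $1.75$: there is a constant $c$, depending only on $f$ and $\eta$, such that for every item sequence $\sigma$ and every sequence of failures and recoveries, Harmonic-Stretch opens at most $1.75\cdot\mathrm{Opt}(\sigma)+c$ bins. -/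

import Mathlib

open scoped BigOperators

namespace FaultTolerant

/-! ## Packings of replicated items -/

/-- A packing of the items `0, …, n - 1` into bins named by natural numbers: item `a` has size
`size a`, its primary replica lies in bin `prim a`, and its standby replicas lie in the bins of
`stby a`, one in each. (The values of the functions at indices `≥ n` play no role.) -/
structure Packing where
  n : ℕ
  size : ℕ → ℝ
  prim : ℕ → ℕ
  stby : ℕ → Finset ℕ

namespace Packing

/-- The bins that hold a replica of item `a`. -/
def holders (P : Packing) (a : ℕ) : Finset ℕ := insert (P.prim a) (P.stby a)

/-- The bins that hold at least one replica. -/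
def bins (P : Packing) : Finset ℕ := (Finset.range P.n).biUnion P.holders

/-- The sequence of the sizes of the packed items. -/
def sizes (P : Packing) : List ℝ := (List.range P.n).map P.size

/-- The load of bin `b` when, for each item `a`, the replica in bin `cur a` has the status of
primary replica (size `size a`), and all other replicas of `a` are standby (size `size a / η`). -/
noncomputable def load (P : Packing) (η : ℝ) (cur : ℕ → ℕ) (b : ℕ) : ℝ :=
  ∑ a ∈ Finset.range P.n,
    if b = cur a then P.size a else if b ∈ P.holders a then P.size a / η else 0

/-- While the bins of `F` are failed and the primary replicas are those given by `cur`: every item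
has its primary replica in a non-failed bin, and no non-failed bin is overloaded. -/
def Served (P : Packing) (η : ℝ) (F : Finset ℕ) (cur : ℕ → ℕ) : Prop :=
  (∀ a < P.n, cur a ∈ P.holders a ∧ cur a ∉ F) ∧ ∀ b ∉ F, P.load η cur b ≤ 1

/-- Valid packings. Every item has `f + 1` replicas in `f + 1` different bins, and whichever set `F`
of at most `f` bins fails, each item whose primary replica is in a failed bin can be given a new
primary replica, by promoting one of its standby replicas in a non-failed bin, while the primary
replicas in non-failed bins stay primary, so that no non-failed bin is overloaded. -/
def Valid (P : Packing) (f : ℕ) (η : ℝ) : Prop :=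
  (∀ a < P.n, P.prim a ∉ P.stby a ∧ (P.stby a).card = f) ∧
  ∀ F : Finset ℕ, F.card ≤ f →
    ∃ cur : ℕ → ℕ, (∀ a < P.n, P.prim a ∉ F → cur a = P.prim a) ∧ P.Served η F cur

end Packing

/-- `opt f η σ`: the number of bins in an optimal valid packing of the item sequence `σ`. -/
noncomputable def opt (f : ℕ) (η : ℝ) (σ : List ℝ) : ℕ :=
  sInf {k : ℕ | ∃ P : Packing, P.sizes = σ ∧ P.Valid f η ∧ P.bins.card = k}

/-! ## Online algorithms -/

/-- What is visible of an algorithm at a given time: the packing (as placed), the bin `cur a` that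
currently holds the primary replica of item `a`, the bins opened so far, and the failed bins. -/
structure Config extends Packing where
  cur : ℕ → ℕ
  opened : Finset ℕ
  failed : Finset ℕ

/-- An online algorithm whose arbitrary choices are left open: a transition system that reacts to
the arrival of an item of a given size and to a change of the set of failed bins (some bins fail,
some recover, possibly several at once). -/
structure OnlineAlgorithm where
  State : Type
  init : State → Prop
  arrive : ℝ → State → State → Prop
  changeFailed : Finset ℕ → State → State → Prop
  config : State → Config

/-- `Run f A σ s`: the algorithm can be in state `s` after the items of `σ` have arrived, where in
between, before and after the arrivals, bins opened by the algorithm failed and recovered in any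
way such that at most `f` bins are failed at any time. -/
inductive Run (f : ℕ) (A : OnlineAlgorithm) : List ℝ → A.State → Prop
  | init {s : A.State} : A.init s → Run f A [] s
  | arrive {σ : List ℝ} {s s' : A.State} {x : ℝ} : Run f A σ s → 0 < x → x ≤ 1 →
      A.arrive x s s' → Run f A (σ ++ [x]) s'
  | changeFailed {σ : List ℝ} {s s' : A.State} {F : Finset ℕ} : Run f A σ s →
      F ⊆ (A.config s).opened → F.card ≤ f → A.changeFailed F s s' → Run f A σ s'

/-- Replicas are never moved: `C'` packs the items of `C` into the same bins as `C`. -/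
def Config.Keeps (C C' : Config) : Prop :=
  C.opened ⊆ C'.opened ∧ C.n ≤ C'.n ∧
  ∀ a < C.n, C'.size a = C.size a ∧ C'.prim a = C.prim a ∧ C'.stby a = C.stby a

/-- `A` is an online algorithm for the `(f, η)`-fault-tolerant bin packing problem. -/
structure OnlineAlgorithm.Solves (A : OnlineAlgorithm) (f : ℕ) (η : ℝ) : Prop where
  /-- The algorithm can start, and it can react to every admissible event in every run. -/
  exists_init : ∃ s, A.init s
  exists_arrive : ∀ σ s, Run f A σ s → ∀ x : ℝ, 0 < x → x ≤ 1 → ∃ s', A.arrive x s s'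
  exists_changeFailed : ∀ σ s, Run f A σ s → ∀ F : Finset ℕ, F ⊆ (A.config s).opened →
    F.card ≤ f → ∃ s', A.changeFailed F s s'
  /-- Initially no bin is failed. -/
  init_failed : ∀ s, A.init s → (A.config s).failed = ∅
  /-- An arriving item is placed into non-failed bins, and nothing is moved. -/
  arrive_spec : ∀ σ s, Run f A σ s → ∀ (x : ℝ) (s' : A.State), 0 < x → x ≤ 1 →
    A.arrive x s s' → (A.config s).Keeps (A.config s') ∧
      (A.config s').failed = (A.config s).failed ∧
      Disjoint ((A.config s').holders (A.config s).n) (A.config s).failed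
  /-- Upon failures and recoveries nothing is moved. -/
  changeFailed_spec : ∀ σ s, Run f A σ s → ∀ (F : Finset ℕ) (s' : A.State),
    F ⊆ (A.config s).opened → F.card ≤ f → A.changeFailed F s s' →
      (A.config s).Keeps (A.config s') ∧ (A.config s').failed = F
  /-- At any time, exactly the items that have arrived are packed, into opened bins, the packing is
  valid, all items are available and no bin is overloaded. -/
  packs : ∀ σ s, Run f A σ s → (A.config s).sizes = σ
  bins_opened : ∀ σ s, Run f A σ s → (A.config s).bins ⊆ (A.config s).opened
  valid : ∀ σ s, Run f A σ s → (A.config s).Valid f η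
  served : ∀ σ s, Run f A σ s → (A.config s).Served η (A.config s).failed (A.config s).cur

/-- The asymptotic competitive ratio of `A` is at most `r`: up to an additive constant, which does
not depend on the items, the failures or the choices of `A`, the number of opened bins is at most
`r` times the number of bins of an optimal valid packing. -/
def OnlineAlgorithm.HasCompetitiveRatio (A : OnlineAlgorithm) (f : ℕ) (η r : ℝ) : Prop :=
  ∃ c : ℝ, ∀ σ s, Run f A σ s → ((A.config s).opened.card : ℝ) ≤ r * (opt f η σ : ℝ) + c

/-! ## The algorithm Harmonic-Stretch -/

namespace HS

/-- A primary replica of size `x` has class `i`. -/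
def PrimaryClass (η x : ℝ) (i : ℕ) : Prop :=
  (1 ≤ i ∧ i ≤ 5 ∧ 1 / ((i : ℝ) + 1) < x ∧ x ≤ 1 / (i : ℝ)) ∨
  (i = 6 ∧ 1 / (7 - 1 / η) < x ∧ x ≤ 1 / 6) ∨
  (i = 7 ∧ 0 < x ∧ x ≤ 1 / (7 - 1 / η))

/-- A standby replica of size `y` has class `j`. -/
def StandbyClass (η y : ℝ) (j : ℕ) : Prop :=
  (1 ≤ j ∧ j + 1 ≤ ⌊6 * η⌋₊ ∧ 1 / ((j : ℝ) + η) < y ∧ y ≤ 1 / ((j : ℝ) + η - 1)) ∨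
  (j = ⌊6 * η⌋₊ ∧ 1 / (7 * η - 1) < y ∧ y ≤ 1 / ((j : ℝ) + η - 1)) ∨
  (j = ⌊6 * η⌋₊ + 1 ∧ 0 < y ∧ y ≤ 1 / (7 * η - 1))

/-- The class of small items. -/
noncomputable def small (η : ℝ) : ℕ × ℕ := (7, ⌊6 * η⌋₊ + 1)

/-- All classes for which groups are maintained: the small items, and the regular `(i, j)`-items
with `1 ≤ i ≤ 6` and `1 ≤ j ≤ ⌊6η⌋`. -/
noncomputable def classes (η : ℝ) : List (ℕ × ℕ) :=
  small η :: ((List.range 6).product (List.range ⌊6 * η⌋₊)).map fun p => (p.1 + 1, p.2 + 1)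

/-- A group of bins for the items of class `cls`. For a regular class `(i, j)`, the bins are
`base, …, base + j + f * i - 1` and `count` items have been placed. For small items, the mirroring
standby bins are `base, …, base + f - 1`, and `sr = some (b, u)` says that `b` is the primary bin
committed to the group, in which the open super-replica of the group, named `u`, is located. -/
structure Group where
  cls : ℕ × ℕ
  base : ℕ
  count : ℕ
  sr : Option (ℕ × ℕ)
  complete : Bool

/-- The state: the packing, the current primary replicas, the failed bins, the number of opened bins
(which are `0, …, numBins - 1`), the groups `0, …, numGroups - 1`, the active group of each class,
the primary bins for small items, and for each item `a` its unit `unit a`: regular items are units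
of their own, and small items form a unit if they are merged into the same super-replica. -/
structure State extends Packing where
  cur : ℕ → ℕ
  failed : Finset ℕ
  numBins : ℕ
  grp : ℕ → Group
  numGroups : ℕ
  active : ℕ × ℕ → ℕ
  smallPrim : Finset ℕ
  unit : ℕ → ℕ

/-- The visible part of a state. -/
def State.config (s : State) : Config where
  toPacking := s.toPacking
  cur := s.cur
  opened := Finset.range s.numBins
  failed := s.failed

/-- Nothing is opened yet. -/
def emptyState : State where
  n := 0
  size := fun _ => 0
  prim := fun _ => 0
  stby := fun _ => ∅
  cur := fun _ => 0
  failed := ∅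
  numBins := 0
  grp := fun _ => ⟨(0, 0), 0, 0, none, true⟩
  numGroups := 0
  active := fun _ => 0
  smallPrim := ∅
  unit := fun _ => 0

/-! ### Groups -/

/-- The bins of a group. -/
noncomputable def groupBins (f : ℕ) (η : ℝ) (g : Group) : Finset ℕ :=
  if g.cls = small η then
    Finset.Ico g.base (g.base + f) ∪ (g.sr.map Prod.fst).toFinset
  else Finset.Ico g.base (g.base + (g.cls.2 + f * g.cls.1))

/-- Group `k` is available: none of its bins is failed. -/
def Available (f : ℕ) (η : ℝ) (s : State) (k : ℕ) : Prop :=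
  Disjoint (groupBins f η (s.grp k)) s.failed

/-- Group `k` is an incomplete, available group for the class `c`. -/
def Candidate (f : ℕ) (η : ℝ) (c : ℕ × ℕ) (s : State) (k : ℕ) : Prop :=
  k < s.numGroups ∧ (s.grp k).cls = c ∧ (s.grp k).complete = false ∧ Available f η s k

/-- Open a fresh group of empty bins for class `c` and make it the active one. (A fresh group for
small items gets its committed primary bin when its first super-replica is placed.) -/
noncomputable def openFresh (f : ℕ) (η : ℝ) (s : State) (c : ℕ × ℕ) : State :=
  { s with
    grp := Function.update s.grp s.numGroups ⟨c, s.numBins, 0, none, false⟩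
    numGroups := s.numGroups + 1
    active := Function.update s.active c s.numGroups
    numBins := s.numBins + if c = small η then f else c.2 + f * c.1 }

/-- Select a new active group for class `c`: any incomplete, available group for `c`, or a fresh
group if there is none. -/
def SelectActive (f : ℕ) (η : ℝ) (c : ℕ × ℕ) (s s' : State) : Prop :=
  (∃ k, Candidate f η c s k ∧ s' = { s with active := Function.update s.active c k }) ∨
  ((¬ ∃ k, Candidate f η c s k) ∧ s' = openFresh f η s c)

/-- For every class of the list whose active group has a failed bin, select a new active group. -/
def Refresh (f : ℕ) (η : ℝ) : List (ℕ × ℕ) → State → State → Prop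
  | [], s, s' => s' = s
  | c :: cs, s, s' => ∃ s₁ : State,
      ((Available f η s (s.active c) ∧ s₁ = s) ∨
        (¬ Available f η s (s.active c) ∧ SelectActive f η c s s₁)) ∧
      Refresh f η cs s₁ s'

/-- In the beginning, a group of empty bins is opened for every class. -/
def Init (f : ℕ) (η : ℝ) (s : State) : Prop :=
  s = (classes η).foldl (openFresh f η) emptyState

/-! ### Packing strategy -/

/-- Place a new item of size `x` with primary replica in bin `b`, standby replicas in the bins of
`S`, and unit `u`. -/
def place (x : ℝ) (b : ℕ) (S : Finset ℕ) (u : ℕ) (s : State) : State :=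
  { s with
    n := s.n + 1
    size := Function.update s.size s.n x
    prim := Function.update s.prim s.n b
    stby := Function.update s.stby s.n S
    cur := Function.update s.cur s.n b
    unit := Function.update s.unit s.n u }

/-- Replace the record of group `k`. -/
def setGroup (k : ℕ) (g : Group) (s : State) : State :=
  { s with grp := Function.update s.grp k g }

/-- Place a regular `(i, j)`-item of size `x` into the active group, as item number `t` of the
group: the primary replica into the primary bin `B_w` with `w = t mod j`, and the standby replicas
into the `z`-th standby bin of each of the `f` sets of `i` standby bins, with `z = ⌊t / j⌋`. The
group becomes complete when it has `i * j` items. -/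
def PlaceRegular (f : ℕ) (η : ℝ) (i j : ℕ) (x : ℝ) (s s' : State) : Prop :=
  let k := s.active (i, j)
  let g := s.grp k
  let t := g.count
  let s₁ := place x (g.base + t % j)
    ((Finset.range f).image fun m => g.base + j + m * i + t / j) s.n s
  (t + 1 < i * j ∧ s' = setGroup k { g with count := t + 1 } s₁) ∨
  (t + 1 = i * j ∧
    SelectActive f η (i, j) (setGroup k { g with count := t + 1, complete := true } s₁) s')

/-- The nominal level of bin `b`: the total size of its replicas, each with the status with which
it was placed. (Promotions use reserved space and do not change this level.) -/
noncomputable def level (η : ℝ) (s : State) (b : ℕ) : ℝ := s.load η s.prim b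

/-- The total size of the primary replicas in unit `u`. -/
noncomputable def unitSize (s : State) (u : ℕ) : ℝ :=
  ∑ a ∈ Finset.range s.n, if s.unit a = u then s.size a else 0

/-- An item of size `x` fits into the open super-replicas of group `g`. (The standby condition
follows from the primary one, as both sides are divided by `η`.) -/
def FitsOpen (η : ℝ) (s : State) (g : Group) (x : ℝ) : Prop :=
  ∃ b u, g.sr = some (b, u) ∧ unitSize s u + x ≤ 2 / (7 - 1 / η) ∧
    (unitSize s u + x) / η ≤ 2 / (7 * η - 1)

/-- The mirroring standby bins of group `g` have room for a new super-replica. -/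
def HasRoom (f : ℕ) (η : ℝ) (s : State) (g : Group) : Prop :=
  ∀ b ∈ Finset.Ico g.base (g.base + f), 2 * η / (7 * η - 1) ≤ 1 - level η s b

/-- The primary bin `b` can receive a new primary super-replica of group `k`: it is a non-failed
primary bin for small items, not committed to another group, with enough empty space, and shares
no item with a standby bin of group `k`. -/
def Eligible (f : ℕ) (η : ℝ) (s : State) (k : ℕ) (b : ℕ) : Prop :=
  b ∈ s.smallPrim ∧ b ∉ s.failed ∧
  (∀ k' < s.numGroups, k' ≠ k → ∀ u, (s.grp k').sr ≠ some (b, u)) ∧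
  2 / (7 - 1 / η) ≤ 1 - level η s b ∧
  ∀ β ∈ Finset.Ico (s.grp k).base ((s.grp k).base + f), ∀ a < s.n,
    ¬ (b ∈ s.holders a ∧ β ∈ s.holders a)

/-- Place a small item of size `x`. -/
inductive PlaceSmall (f : ℕ) (η x : ℝ) : State → State → Prop
  /-- The item joins the open super-replicas of the active group. -/
  | join (s : State) (b u : ℕ) :
      FitsOpen η s (s.grp (s.active (small η))) x →
      (s.grp (s.active (small η))).sr = some (b, u) →
      PlaceSmall f η x s
        (place x b (Finset.Ico (s.grp (s.active (small η))).base
          ((s.grp (s.active (small η))).base + f)) u s)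
  /-- New super-replicas are opened in the active group, the primary one in an eligible bin. -/
  | oldBin (s : State) (b : ℕ) :
      ¬ FitsOpen η s (s.grp (s.active (small η))) x →
      HasRoom f η s (s.grp (s.active (small η))) →
      Eligible f η s (s.active (small η)) b →
      PlaceSmall f η x s
        (setGroup (s.active (small η)) { s.grp (s.active (small η)) with sr := some (b, s.n) }
          (place x b (Finset.Ico (s.grp (s.active (small η))).base
            ((s.grp (s.active (small η))).base + f)) s.n s))
  /-- The same, in a new primary bin, as there is no eligible one. -/
  | newBin (s : State) :
      ¬ FitsOpen η s (s.grp (s.active (small η))) x →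
      HasRoom f η s (s.grp (s.active (small η))) →
      (¬ ∃ b, Eligible f η s (s.active (small η)) b) →
      PlaceSmall f η x s
        (setGroup (s.active (small η))
          { s.grp (s.active (small η)) with sr := some (s.numBins, s.n) }
          { place x s.numBins (Finset.Ico (s.grp (s.active (small η))).base
              ((s.grp (s.active (small η))).base + f)) s.n s with
            numBins := s.numBins + 1
            smallPrim := insert s.numBins s.smallPrim })
  /-- There is no room for new super-replicas: the active group becomes complete, its committed bin
  becomes free, and the item is placed by means of a newly selected active group. -/
  | nextGroup (s s₁ s' : State) :
      ¬ FitsOpen η s (s.grp (s.active (small η))) x →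
      ¬ HasRoom f η s (s.grp (s.active (small η))) →
      SelectActive f η (small η)
        (setGroup (s.active (small η))
          { s.grp (s.active (small η)) with sr := none, complete := true } s) s₁ →
      PlaceSmall f η x s₁ s' → PlaceSmall f η x s s'

/-- The reaction to the arrival of an item of size `x`. -/
def Arrive (f : ℕ) (η x : ℝ) (s s' : State) : Prop :=
  ∃ i j : ℕ, PrimaryClass η x i ∧ StandbyClass η (x / η) j ∧
    (((i, j) = small η ∧ PlaceSmall f η x s s') ∨
      ((i, j) ≠ small η ∧ PlaceRegular f η i j x s s'))

/-! ### Adjustment strategy -/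

/-- `cur'` gives the primary replicas after the set of failed bins has changed to `F`. Replicas
placed as primary in non-failed bins have (or regain) primary status; each unit in a failed primary
bin is mapped, injectively, to a non-failed standby bin that hosts it, and units that were mapped to
a bin that is still non-failed keep their bin. -/
def Adjusted (F : Finset ℕ) (s : State) (cur' : ℕ → ℕ) : Prop :=
  (∀ a < s.n, s.prim a ∉ F → cur' a = s.prim a) ∧
  (∀ a < s.n, s.prim a ∈ F → cur' a ∈ s.stby a ∧ cur' a ∉ F) ∧
  (∀ a < s.n, ∀ b < s.n, s.prim a ∈ F → s.prim b ∈ F →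
    (cur' a = cur' b ↔ s.unit a = s.unit b)) ∧
  (∀ a < s.n, s.prim a ∈ F → s.prim a ∈ s.failed → s.cur a ∉ F → cur' a = s.cur a)

/-- The reaction to the change of the set of failed bins to `F`: adjust the primary replicas, and
select new active groups where needed. -/
def ChangeFailed (f : ℕ) (η : ℝ) (F : Finset ℕ) (s s' : State) : Prop :=
  ∃ cur' : ℕ → ℕ, Adjusted F s cur' ∧
    Refresh f η (classes η) { s with cur := cur', failed := F } s'

end HS

/-- The online algorithm Harmonic-Stretch. -/
noncomputable def harmonicStretch (f : ℕ) (η : ℝ) : OnlineAlgorithm where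
  State := HS.State
  init := HS.Init f η
  arrive := HS.Arrive f η
  changeFailed := HS.ChangeFailed f η
  config := HS.State.config

end FaultTolerant

namespace FaultTolerant

/-! The ratio comes from a weighting argument, and feasibility from a counting argument for
promotions.

Weights. A regular (i, j)-item has primary weight 1/i and weight 1/j for each of its f standby
replicas. A small replica has weight d times its size, where d = `smallDensity η` satisfies d(1 -
cap) = 1 and cap = 2η/(7η - 1) is the capacity of a primary super-replica. The total weight depends
only on the item sequence, so it can be compared with the optimum and with the number of opened
bins.

Every bin of a valid packing has weight at most 7/4 (`binWeight_le`). Validity is used as follows: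
if all other bins holding a replica of q fail, then the standby replica of q in the given bin has to
be promoted, so the bin has room for q at full size. Take q to be the largest standby replica of the
bin, of size y = x/η. By `exists_density`, the other standby replicas have weight at most D per unit
of size, for some D ≥ 3/2 depending on the class of y. Primary replicas of size at most 1/2 have
density at most 3/2, and at most one primary replica is larger than 1/2, with weight at most 1.
Charging the remaining space at density D gives 7/4.

Up to a bounded number, every bin opened by the algorithm has weight at least 1 (`Inv.numBins_le`).
A bin of a complete regular group holds exactly i primary replicas of weight 1/i, or j standby
replicas of weight 1/j. A bin for small items of level at least 1 - cap has weight at least 1 by the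
choice of d. The exceptions are bounded. A fresh group is opened only if each incomplete group of
its class contains a failed bin; since groups are disjoint, at most f + 1 incomplete groups per
class ever exist (`Good.card_incomplete_le`). A new primary bin for small items is opened only if
each bin with room is failed, committed, or shares an item with the standby bins of the active
group, which leaves boundedly many (`Good.card_unfilled_lt`).

Feasibility. The standby sets of two units are equal or disjoint, and distinct units with the same
nonempty standby set have distinct primary bins (`Separated`). If the bins of F fail, the affected
units with standby set S have different primary bins in F \ S, and |F \ S| ≤ |S \ F| because |F| ≤ f
= |S|. So they can be mapped injectively to the surviving bins of S, even with part of the map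
prescribed (`exists_adjusted`). Each bin then receives promotions from at most one unit, and the
levels leave room for one (`Inv.level_stby_le`). This yields both the validity of the packing and
the absence of overload in a run. Everything is carried through the run by the invariant `Good`,
together with `Ready` for every class. -/

/-! ### Weights -/

/-- The reciprocal of the least level of a filled bin with small items. -/
noncomputable def smallDensity (η : ℝ) : ℝ := (7 * η - 1) / (5 * η - 1)

/-- The weight of a primary replica of size `x`. -/
noncomputable def primWeight (η x : ℝ) : ℝ :=
  if x ≤ 1 / (7 - 1 / η) then smallDensity η * x else 1 / (⌊1 / x⌋₊ : ℝ)

/-- The weight of a standby replica of size `y`. -/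
noncomputable def stbyWeight (η y : ℝ) : ℝ :=
  if y ≤ 1 / (7 * η - 1) then smallDensity η * y else 1 / (⌊1 / y - η + 1⌋₊ : ℝ)

lemma smallDensity_nonneg {η : ℝ} (hη : 1 < η) : 0 ≤ smallDensity η :=
  div_nonneg (by linarith) (by linarith)

/-- The bound is attained at η = 1. It is also the bound on the density of primary replicas of class
at least 2, so one constant covers all primary replicas of size at most 1/2. -/
lemma smallDensity_le {η : ℝ} (hη : 1 < η) : smallDensity η ≤ 3 / 2 := by
  unfold smallDensity
  rw [div_le_div_iff₀ (by linarith) (by norm_num)]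
  linarith

lemma primWeight_nonneg {η x : ℝ} (hη : 1 < η) (hx : 0 < x) : 0 ≤ primWeight η x := by
  unfold primWeight
  split_ifs
  · exact mul_nonneg (smallDensity_nonneg hη) hx.le
  · positivity

lemma stbyWeight_nonneg {η y : ℝ} (hη : 1 < η) (hy : 0 < y) : 0 ≤ stbyWeight η y := by
  unfold stbyWeight
  split_ifs
  · exact mul_nonneg (smallDensity_nonneg hη) hy.le
  · positivity

lemma primWeight_le_one {η x : ℝ} (hη : 1 < η) (hx : 0 < x) (hx1 : x ≤ 1) :
    primWeight η x ≤ 1 := by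
  unfold primWeight
  split_ifs with h
  · have h7 : (6 : ℝ) < 7 - 1 / η := by
      have : 1 / η < 1 := by rw [div_lt_one (by linarith)]; exact hη
      linarith
    have hx6 : x ≤ 1 / 6 := h.trans (one_div_le_one_div_of_le (by norm_num) h7.le)
    have := smallDensity_le hη
    nlinarith
  · have h1 : 1 ≤ ⌊1 / x⌋₊ := by
      rw [Nat.one_le_floor_iff, le_div_iff₀ hx]; linarith
    rw [div_le_one (by positivity)]
    exact_mod_cast h1

/-- A replica with ⌊1/x⌋ = i ≥ 2 is larger than 1/(i + 1), so its weight 1/i is less than (1 + 1/i)x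
≤ 3x/2. -/
lemma primWeight_le {η x : ℝ} (hη : 1 < η) (hx : 0 < x) (hx2 : x ≤ 1 / 2) :
    primWeight η x ≤ 3 / 2 * x := by
  unfold primWeight
  split_ifs with h
  · exact mul_le_mul_of_nonneg_right (smallDensity_le hη) hx.le
  · have h2 : 2 ≤ ⌊1 / x⌋₊ := by
      apply Nat.le_floor
      rw [le_div_iff₀ hx]; push_cast; linarith
    have h3 : 1 / x < ⌊1 / x⌋₊ + 1 := Nat.lt_floor_add_one _
    generalize ⌊1 / x⌋₊ = i at h2 h3
    have hi : (2 : ℝ) ≤ i := by exact_mod_cast h2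
    rw [div_lt_iff₀ hx] at h3
    rw [div_le_iff₀ (by linarith)]
    nlinarith

/-- A standby replica that is not small has a class `j` that determines its weight. -/
lemma stbyWeight_eq {η y : ℝ} (hy : 0 < y) (hy1 : η * y ≤ 1) (h : ¬ y ≤ 1 / (7 * η - 1)) :
    ∃ j : ℕ, 1 ≤ j ∧ stbyWeight η y = 1 / (j : ℝ) ∧ 1 < (j + η) * y ∧ (j + η - 1) * y ≤ 1 := by
  have h0 : η ≤ 1 / y := by rwa [le_div_iff₀ hy]
  refine ⟨⌊1 / y - η + 1⌋₊, ?_, by rw [stbyWeight, if_neg h], ?_, ?_⟩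
  · rw [Nat.one_le_floor_iff]; linarith
  · have := Nat.lt_floor_add_one (1 / y - η + 1)
    rw [← div_lt_iff₀ hy]; linarith
  · have := Nat.floor_le (a := 1 / y - η + 1) (by linarith)
    rw [← le_div_iff₀ hy]; linarith

lemma stbyWeight_small {η y : ℝ} (hη : 1 < η) (hy : 0 < y) (h : y ≤ 1 / (7 * η - 1)) :
    stbyWeight η y ≤ 3 / 2 * y := by
  rw [stbyWeight, if_pos h]
  exact mul_le_mul_of_nonneg_right (smallDensity_le hη) hy.le

/-- The weight density of the standby replicas of the classes from `j` on. -/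
lemma stbyWeight_le {η : ℝ} (hη : 1 < η) {j : ℕ} (hj : 1 ≤ j) {z : ℝ} (hz : 0 < z)
    (hz1 : η * z ≤ 1) (hjz : (j + η - 1) * z ≤ 1) :
    stbyWeight η z ≤ max (1 + η / j) (3 / 2) * z := by
  by_cases hs : z ≤ 1 / (7 * η - 1)
  · exact (stbyWeight_small hη hz hs).trans
      (mul_le_mul_of_nonneg_right (le_max_right _ _) hz.le)
  · obtain ⟨k, hk, h, h2, h3⟩ := stbyWeight_eq hz hz1 hs
    have hjk : j ≤ k := by
      by_contra hlt
      have : (k : ℝ) + 1 ≤ j := by exact_mod_cast Nat.lt_of_not_le hlt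
      nlinarith
    have hjk' : (j : ℝ) ≤ k := by exact_mod_cast hjk
    have hj' : (1 : ℝ) ≤ j := by exact_mod_cast hj
    have hk' : (1 : ℝ) ≤ k := by linarith
    -- A replica of class k has weight 1/k < (1 + η/k)z, and this density decreases in k; so the
    -- first admissible class j is the worst.
    have h4 : (1 + η / k) * z ≤ (1 + η / j) * z := by gcongr
    have h5 : 1 / (k : ℝ) ≤ (1 + η / k) * z := by
      have : (1 + η / k) * z = ((k + η) * z) / k := by field_simp
      rw [this]; gcongr
    rw [h]
    exact (h5.trans h4).trans (mul_le_mul_of_nonneg_right (le_max_left _ _) hz.le)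

/-- If `y` is the largest standby replica of a bin, then some density `D` bounds the weights
of all other standby replicas of the bin. -/
lemma exists_density {η y : ℝ} (hη : 1 < η) (hy : 0 < y) (hy1 : η * y ≤ 1) :
    ∃ D : ℝ, 3 / 2 ≤ D ∧ (∀ z, 0 < z → z ≤ y → η * y + z ≤ 1 → stbyWeight η z ≤ D * z) ∧
      stbyWeight η y + D * (1 - η * y) ≤ 7 / 4 ∧
      (η * y < 1 / 2 → 1 + stbyWeight η y + D * (1 / 2 - η * y) ≤ 7 / 4) := by
  by_cases hs : y ≤ 1 / (7 * η - 1)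
  · have h := stbyWeight_small hη hy hs
    refine ⟨3 / 2, le_rfl, fun z hz hzy _ => stbyWeight_small hη hz (hzy.trans hs), ?_, ?_⟩
    · nlinarith
    · intro; nlinarith
  obtain ⟨j, hj, h, h2, h3⟩ := stbyWeight_eq hy hy1 hs
  have hj' : (1 : ℝ) ≤ j := by exact_mod_cast hj
  rw [h]
  rcases eq_or_lt_of_le hj with hj1 | hj1
  · subst hj1
    push_cast at *
    -- Class 1: the promoted replica leaves z ≤ 1 - ηy, and with z ≤ y this gives (1 + η)z ≤ 1. So
    -- all other standby replicas have class at least 2 or are small, and the density of class 2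
    -- suffices.
    refine ⟨1 + η / 2, by linarith, ?_, ?_, ?_⟩
    · intro z hz hzy hz1
      have := stbyWeight_le hη (j := 2) (by norm_num) hz (by nlinarith) (by push_cast; nlinarith)
      push_cast at this
      rwa [max_eq_left (by linarith)] at this
    · have : 1 - η * y ≤ 1 / (1 + η) := by
        rw [le_div_iff₀ (by linarith)]; nlinarith
      have h7 : (1 + η / 2) * (1 / (1 + η)) ≤ 3 / 4 := by
        rw [mul_one_div, div_le_div_iff₀ (by linarith) (by norm_num)]; linarith
      nlinarith
    -- Vacuous: y > 1/(1 + η) gives ηy > η/(1 + η) > 1/2.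
    · intro hlt; nlinarith
  · have hj2 : (2 : ℝ) ≤ j := by exact_mod_cast hj1
    have hjpos : (0 : ℝ) < j := by linarith
    have hinv : 1 / (j : ℝ) ≤ 1 / 2 := one_div_le_one_div_of_le (by norm_num) hj2
    have he : ∀ t : ℝ, (1 + η / j) * t = ((j + η) * t) / j := fun t => by field_simp
    -- For j ≥ 2 the other replicas may again be of class j. The alternative 3/2 covers the small
    -- ones, and it lets `binWeight_le` charge primary replicas at density D as well.
    refine ⟨max (1 + η / j) (3 / 2), le_max_right _ _, ?_, ?_, ?_⟩
    · intro z hz hzy hz1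
      exact stbyWeight_le hη hj hz (by nlinarith) (by nlinarith)
    · have ht : 0 ≤ 1 - η * y := by linarith
      generalize htt : 1 - η * y = t at ht
      -- This is (j + η)y > 1 multiplied by η: it bounds the space beside the promoted replica.
      have h5 : (j + η) * t ≤ j := by rw [← htt]; nlinarith
      rw [max_mul_of_nonneg _ _ ht, ← le_sub_iff_add_le']
      apply max_le
      · have : ((j + η) * t) / j ≤ 1 := by rw [div_le_one hjpos]; exact h5
        rw [he]; linarith
      · have h6 : t ≤ j / (j + 1) := by rw [le_div_iff₀ (by linarith)]; nlinarith
        have h7 : 3 / 2 * (j / (j + 1) : ℝ) ≤ 7 / 4 - 1 / j := by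
          rw [le_sub_iff_add_le]
          have : 3 / 2 * (j / (j + 1) : ℝ) + 1 / j
              = (3 / 2 * j ^ 2 + (j + 1)) / (j * (j + 1)) := by field_simp
          rw [this, div_le_iff₀ (by positivity)]
          nlinarith
        linarith
    · intro hlt
      have ht : 0 ≤ 1 / 2 - η * y := by linarith
      generalize htt : 1 / 2 - η * y = t at ht
      -- This is the critical case: beside a primary replica larger than 1/2, the two alternatives
      -- of the maximum lead to 3/2 + 1/(2j) and 1 + 1/j + 3(j - 1)/(4(j + 1)), and both equal 7/4
      -- at j = 2.
      have h5 : (j + η) * t ≤ (j - η) / 2 := by rw [← htt]; nlinarith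
      rw [max_mul_of_nonneg _ _ ht, ← le_sub_iff_add_le']
      apply max_le
      · have : ((j + η) * t) / j ≤ ((j - 1) / 2) / j := by gcongr; linarith
        have h9 : ((j - 1) / 2 : ℝ) / j = 1 / 2 - 1 / 2 * (1 / j) := by field_simp
        rw [he]; linarith
      · have h6 : t ≤ (j - 1) / (2 * (j + 1)) := by
          rw [le_div_iff₀ (by linarith)]; nlinarith
        have h7 : 3 / 2 * ((j - 1) / (2 * (j + 1)) : ℝ) ≤ 7 / 4 - (1 + 1 / j) := by
          rw [le_sub_iff_add_le]
          have : 3 / 2 * ((j - 1) / (2 * (j + 1)) : ℝ) + (1 + 1 / j)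
              = (3 * (j - 1) * j + 4 * j * (j + 1) + 4 * (j + 1)) / (4 * (j * (j + 1))) := by
            field_simp
            ring
          rw [this, div_le_iff₀ (by positivity)]
          nlinarith
        linarith

/-- The weight of a bin with primary replicas of the items in `A` and standby replicas of the
items in `B`, if there is room to promote any one of the standby replicas. -/
lemma binWeight_le {η : ℝ} (hη : 1 < η) (A B : Finset ℕ) (x : ℕ → ℝ)
    (hA : ∀ a ∈ A, 0 < x a ∧ x a ≤ 1) (hB : ∀ a ∈ B, 0 < x a) (h1 : ∑ a ∈ A, x a ≤ 1)
    (h2 : ∀ q ∈ B, ∑ a ∈ A, x a + (∑ a ∈ B.erase q, x a / η + x q) ≤ 1) :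
    ∑ a ∈ A, primWeight η (x a) + ∑ a ∈ B, stbyWeight η (x a / η) ≤ 7 / 4 := by
  have hη0 : 0 < η := by linarith
  -- at most one primary replica is larger than `1 / 2`
  have hP : (∑ a ∈ A, primWeight η (x a) ≤ 3 / 2 * ∑ a ∈ A, x a) ∨
      ∃ t, 1 / 2 < t ∧ t ≤ ∑ a ∈ A, x a ∧
        ∑ a ∈ A, primWeight η (x a) ≤ 1 + 3 / 2 * (∑ a ∈ A, x a - t) := by
    by_cases hbig : ∃ a ∈ A, 1 / 2 < x a
    · right
      obtain ⟨a, ha, hxa⟩ := hbig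
      have hs := Finset.add_sum_erase A x ha
      have hw := Finset.add_sum_erase A (fun b => primWeight η (x b)) ha
      have hnn : 0 ≤ ∑ b ∈ A.erase a, x b :=
        Finset.sum_nonneg fun b hb => (hA b (Finset.mem_of_mem_erase hb)).1.le
      refine ⟨x a, hxa, by linarith, ?_⟩
      rw [← hw, ← hs, add_sub_cancel_left, Finset.mul_sum]
      refine add_le_add (primWeight_le_one hη (hA a ha).1 (hA a ha).2)
        (Finset.sum_le_sum fun b hb => ?_)
      have hbA := Finset.mem_of_mem_erase hb
      refine primWeight_le hη (hA b hbA).1 ?_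
      have := Finset.single_le_sum (f := x)
        (fun c hc => (hA c (Finset.mem_of_mem_erase hc)).1.le) hb
      linarith
    · left
      push Not at hbig
      rw [Finset.mul_sum]
      exact Finset.sum_le_sum fun a ha => primWeight_le hη (hA a ha).1 (hbig a ha)
  have hA0 : 0 ≤ ∑ a ∈ A, x a := Finset.sum_nonneg fun a ha => (hA a ha).1.le
  rcases B.eq_empty_or_nonempty with rfl | hne
  · simp only [Finset.sum_empty, add_zero]
    rcases hP with h | ⟨t, ht, -, h⟩ <;> linarith
  · obtain ⟨q, hq, hmax⟩ := B.exists_max_image x hne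
    have hq0 := hB q hq
    have hyq : η * (x q / η) = x q := by field_simp
    have h2q := h2 q hq
    set R := ∑ a ∈ B.erase q, x a / η
    have hR : 0 ≤ R := Finset.sum_nonneg fun a ha =>
      (div_pos (hB a (Finset.mem_of_mem_erase ha)) hη0).le
    obtain ⟨D, hD, hDz, hd1, hd2⟩ := exists_density hη (div_pos hq0 hη0)
      (by rw [hyq]; linarith)
    rw [hyq] at hDz hd1 hd2
    have hS : ∑ a ∈ B, stbyWeight η (x a / η) ≤ stbyWeight η (x q / η) + D * R := by
      rw [← Finset.add_sum_erase B _ hq, Finset.mul_sum]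
      refine add_le_add le_rfl (Finset.sum_le_sum fun a ha => ?_)
      have haB := Finset.mem_of_mem_erase ha
      have hle : x a / η ≤ R := Finset.single_le_sum (f := fun a => x a / η)
        (fun c hc => (div_pos (hB c (Finset.mem_of_mem_erase hc)) hη0).le) ha
      refine hDz _ (div_pos (hB a haB) hη0) ?_ (by linarith)
      gcongr
      exact hmax a haB
    -- Since D ≥ 3/2, the primary replicas other than a large one may be charged at density D too.
    -- The space charged is at most 1 - x q, or at most 1/2 - x q beside a large primary replica.
    rcases hP with h | ⟨t, ht, htA, h⟩
    · nlinarith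
    · have := hd2 (by linarith)
      nlinarith

/-! ### Bin sums -/

namespace Packing

/-- The sum over the replicas in bin `b`, where a primary replica of an item of size `x`
contributes `φ x`, and a standby replica `ψ x`. -/
noncomputable def binSum (P : Packing) (φ ψ : ℝ → ℝ) (b : ℕ) : ℝ :=
  ∑ a ∈ Finset.range P.n,
    if b = P.prim a then φ (P.size a) else if b ∈ P.holders a then ψ (P.size a) else 0

/-- Double counting: each item contributes once as primary and f times as standby. Applied to an
optimal packing and to the packing of the algorithm, it produces the same total. -/
lemma sum_binSum (P : Packing) (φ ψ : ℝ → ℝ) (S : Finset ℕ) (f : ℕ)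
    (hP : ∀ a < P.n, P.prim a ∉ P.stby a ∧ (P.stby a).card = f)
    (hS : ∀ a < P.n, P.holders a ⊆ S) :
    ∑ b ∈ S, P.binSum φ ψ b = ∑ a ∈ Finset.range P.n, (φ (P.size a) + f * ψ (P.size a)) := by
  unfold binSum
  rw [Finset.sum_comm]
  refine Finset.sum_congr rfl fun a ha => ?_
  rw [Finset.mem_range] at ha
  obtain ⟨h1, h2⟩ := hP a ha
  have hsub := hS a ha
  have : ∀ b, (if b = P.prim a then φ (P.size a) else
      if b ∈ P.holders a then ψ (P.size a) else 0) =
      (if b = P.prim a then φ (P.size a) else 0) + if b ∈ P.stby a then ψ (P.size a) else 0 := by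
    intro b
    by_cases hb : b = P.prim a
    · subst hb; simp [h1]
    · simp [hb, holders]
  simp_rw [this]
  rw [Finset.sum_add_distrib, Finset.sum_ite_eq' S, if_pos (hsub (by simp [holders])),
    ← Finset.sum_filter, Finset.sum_const, nsmul_eq_mul, ← h2]
  congr 4
  ext b
  simp only [Finset.mem_filter, and_iff_right_iff_imp]
  intro hb
  exact hsub (by simp [holders, hb])

lemma binSum_eq (P : Packing) (φ ψ : ℝ → ℝ) (b : ℕ) :
    P.binSum φ ψ b = ∑ a ∈ (Finset.range P.n).filter (fun a => b = P.prim a), φ (P.size a) +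
      ∑ a ∈ (Finset.range P.n).filter (fun a => b ≠ P.prim a ∧ b ∈ P.stby a), ψ (P.size a) := by
  unfold binSum
  rw [Finset.sum_filter, Finset.sum_filter, ← Finset.sum_add_distrib]
  refine Finset.sum_congr rfl fun a _ => ?_
  by_cases hb : b = P.prim a <;> simp [hb, holders]

/-- The weight of every bin of a valid packing is at most `7 / 4`. -/
lemma Valid.binSum_le {P : Packing} {f : ℕ} {η : ℝ} (hP : P.Valid f η) (hη : 1 < η)
    (hs : ∀ a < P.n, 0 < P.size a ∧ P.size a ≤ 1) (b : ℕ) :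
    P.binSum (primWeight η) (fun x => stbyWeight η (x / η)) b ≤ 7 / 4 := by
  have hη0 : 0 < η := by linarith
  rw [binSum_eq]
  refine binWeight_le hη _ _ P.size ?_ ?_ ?_ ?_
  · intro a ha
    simp only [Finset.mem_filter, Finset.mem_range] at ha
    exact hs a ha.1
  · intro a ha
    simp only [Finset.mem_filter, Finset.mem_range] at ha
    exact (hs a ha.1).1
  · obtain ⟨cur, h1, h2, h3⟩ := hP.2 ∅ (by simp)
    refine le_trans ?_ (h3 b (by simp))
    unfold load
    rw [Finset.sum_filter]
    refine Finset.sum_le_sum fun a ha => ?_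
    rw [Finset.mem_range] at ha
    rw [h1 a ha (by simp)]
    have := (hs a ha).1
    by_cases hb : b = P.prim a
    · simp [hb]
    · simp only [hb, if_false]; split_ifs <;> positivity
  · intro q hq
    simp only [Finset.mem_filter, Finset.mem_range] at hq
    obtain ⟨hqn, hqb, hqs⟩ := hq
    obtain ⟨hq1, hq2⟩ := hP.1 q hqn
    -- All f bins other than `b` that hold a replica of `q` fail, so the primary replica of `q` has
    -- to be in `b`.
    obtain ⟨cur, h1, h2, h3⟩ := hP.2 ((P.holders q).erase b) (by
      rw [Finset.card_erase_of_mem (by simp [holders, hqs]), holders, Finset.card_insert_of_notMem hq1,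
        hq2]; simp)
    have hcq : cur q = b := by
      have := h2 q hqn
      by_contra hne
      exact this.2 (Finset.mem_erase.2 ⟨hne, this.1⟩)
    refine le_trans ?_ (h3 b (by simp))
    have hqB : q ∈ (Finset.range P.n).filter (fun a => b ≠ P.prim a ∧ b ∈ P.stby a) := by
      simp [hqn, hqb, hqs]
    have : ∑ a ∈ ((Finset.range P.n).filter (fun a => b ≠ P.prim a ∧ b ∈ P.stby a)).erase q,
        P.size a / η + P.size q =
        ∑ a ∈ (Finset.range P.n).filter (fun a => b ≠ P.prim a ∧ b ∈ P.stby a),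
          if a = q then P.size a else P.size a / η := by
      rw [← Finset.add_sum_erase _ _ hqB, if_pos rfl, add_comm]
      congr 1
      refine Finset.sum_congr rfl fun a ha => ?_
      rw [if_neg (Finset.ne_of_mem_erase ha)]
    rw [this, Finset.sum_filter, Finset.sum_filter, ← Finset.sum_add_distrib]
    unfold load
    refine Finset.sum_le_sum fun a ha => ?_
    rw [Finset.mem_range] at ha
    have hpos := (hs a ha).1
    by_cases hb : b = P.prim a
    · rw [h1 a ha (by rw [← hb]; simp)]
      simp [hb]
    · by_cases haq : a = q
      · subst haq
        simp [hb, hqs, hcq]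
      · have hdiv : P.size a / η ≤ P.size a := div_le_self hpos.le hη.le
        simp only [hb, if_false, haq, zero_add, ne_eq, not_false_eq_true, true_and, holders,
          Finset.mem_insert, false_or]
        split_ifs <;> first | exact hdiv | exact le_rfl | positivity

lemma Valid.weight_le {P : Packing} {f : ℕ} {η : ℝ} (hP : P.Valid f η) (hη : 1 < η)
    (hs : ∀ a < P.n, 0 < P.size a ∧ P.size a ≤ 1) :
    ∑ a ∈ Finset.range P.n, (primWeight η (P.size a) + f * stbyWeight η (P.size a / η)) ≤
      7 / 4 * P.bins.card := by
  rw [← P.sum_binSum (primWeight η) (fun x => stbyWeight η (x / η)) P.bins f hP.1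
    (fun a ha => Finset.subset_biUnion_of_mem P.holders (Finset.mem_range.2 ha))]
  refine (Finset.sum_le_card_nsmul _ _ _ fun b _ => hP.binSum_le hη hs b).trans ?_
  rw [nsmul_eq_mul, mul_comm]

lemma sum_eq_of_sizes (P : Packing) {σ : List ℝ} (h : P.sizes = σ) (g : ℝ → ℝ) :
    ∑ a ∈ Finset.range P.n, g (P.size a) = (σ.map g).sum := by
  rw [← h, sizes, List.map_map]
  simp [Finset.sum_eq_multiset_sum, Multiset.range, Function.comp_def]

end Packing

/-- The total weight of the items is a lower bound for the optimum, up to the factor `7 / 4`. -/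
lemma weight_le_opt {P : Packing} {f : ℕ} {η : ℝ} (hP : P.Valid f η) (hη : 1 < η)
    (hs : ∀ a < P.n, 0 < P.size a ∧ P.size a ≤ 1) :
    ∑ a ∈ Finset.range P.n, (primWeight η (P.size a) + f * stbyWeight η (P.size a / η)) ≤
      7 / 4 * opt f η P.sizes := by
  -- The packing `P` shows that the set is nonempty; hence the infimum is attained and is not the
  -- default value 0.
  obtain ⟨Q, hQ, hQv, hQc⟩ := Nat.sInf_mem
    (s := {k : ℕ | ∃ Q : Packing, Q.sizes = P.sizes ∧ Q.Valid f η ∧ Q.bins.card = k})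
    ⟨_, P, rfl, hP, rfl⟩
  have hQs : ∀ a < Q.n, 0 < Q.size a ∧ Q.size a ≤ 1 := by
    intro a ha
    have : Q.size a ∈ P.sizes := by
      rw [← hQ, Packing.sizes]
      exact List.mem_map.2 ⟨a, List.mem_range.2 ha, rfl⟩
    rw [Packing.sizes, List.mem_map] at this
    obtain ⟨c, hc, hc'⟩ := this
    rw [← hc']
    exact hs c (List.mem_range.1 hc)
  have h := hQv.weight_le hη hQs
  rw [Q.sum_eq_of_sizes hQ (fun x => primWeight η x + f * stbyWeight η (x / η)),
    ← P.sum_eq_of_sizes rfl (fun x => primWeight η x + f * stbyWeight η (x / η))] at h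
  rw [opt, ← hQc]
  exact h

namespace HS

/-! ### The adjustment strategy -/

/-- As `g₀` is injective on `K`, it uses exactly |K| elements of `T`, so enough targets remain for U
\ K. In the adjustment, `K` consists of the units that have to keep their bin. -/
lemma exists_injOn_extend (U K T : Finset ℕ) (g₀ : ℕ → ℕ) (hK : K ⊆ U)
    (hT : ∀ u ∈ K, g₀ u ∈ T) (hinj : Set.InjOn g₀ K) (hcard : U.card ≤ T.card) :
    ∃ g : ℕ → ℕ, (∀ u ∈ U, g u ∈ T) ∧ Set.InjOn g U ∧ ∀ u ∈ K, g u = g₀ u := by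
  classical
  have him : K.image g₀ ⊆ T := Finset.image_subset_iff.2 hT
  have hc : (U \ K).card ≤ (T \ K.image g₀).card := by
    rw [Finset.card_sdiff_of_subset hK, Finset.card_sdiff_of_subset him,
      Finset.card_image_of_injOn hinj]
    omega
  obtain ⟨e⟩ := Function.Embedding.nonempty_of_card_le
    (α := ↥(U \ K)) (β := ↥(T \ K.image g₀)) (by simpa using hc)
  let g : ℕ → ℕ := fun u => if h : u ∈ U \ K then e ⟨u, h⟩ else g₀ u
  have hgK : ∀ u ∈ K, g u = g₀ u := fun u hu => dif_neg (by simp [hu])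
  have hg' : ∀ u (h : u ∈ U \ K), g u = e ⟨u, h⟩ := fun u h => dif_pos h
  have hmem : ∀ u ∈ U \ K, g u ∈ T \ K.image g₀ := fun u h => by
    rw [hg' u h]; exact (e ⟨u, h⟩).2
  refine ⟨g, fun u hu => ?_, fun u hu v hv huv => ?_, hgK⟩
  · by_cases h : u ∈ K
    · rw [hgK u h]; exact hT u h
    · exact (Finset.mem_sdiff.1 (hmem u (by simp [hu, h]))).1
  · by_cases h : u ∈ K <;> by_cases h' : v ∈ K
    · rw [hgK u h, hgK v h'] at huv
      exact hinj h h' huv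
    · have := (Finset.mem_sdiff.1 (hmem v (Finset.mem_sdiff.2 ⟨hv, h'⟩))).2
      rw [← huv, hgK u h] at this
      exact absurd (Finset.mem_image_of_mem _ h) this
    · have := (Finset.mem_sdiff.1 (hmem u (Finset.mem_sdiff.2 ⟨hu, h⟩))).2
      rw [huv, hgK v h'] at this
      exact absurd (Finset.mem_image_of_mem _ h') this
    · have hu' := Finset.mem_sdiff.2 ⟨hu, h⟩
      have hv' := Finset.mem_sdiff.2 ⟨hv, h'⟩
      rw [hg' u hu', hg' v hv'] at huv
      simpa using e.injective (Subtype.ext huv)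

/-- The combinatorial properties of the placement on which the adjustment strategy relies. -/
structure Separated (f : ℕ) (s : State) : Prop where
  card_stby : ∀ a < s.n, (s.stby a).card = f
  prim_notMem : ∀ a < s.n, ∀ b < s.n, s.prim a ∉ s.stby b
  stby_eq : ∀ a < s.n, ∀ b < s.n, ∀ β, β ∈ s.stby a → β ∈ s.stby b → s.stby a = s.stby b
  of_unit_eq : ∀ a < s.n, ∀ b < s.n, s.unit a = s.unit b →
    s.prim a = s.prim b ∧ s.stby a = s.stby b
  unit_eq : ∀ a < s.n, ∀ b < s.n, ∀ β, β ∈ s.stby a → β ∈ s.stby b → s.prim a = s.prim b →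
    s.unit a = s.unit b

/-- The current primary replicas are well-adjusted while the bins of `F` are failed. -/
structure WellAdjusted (F : Finset ℕ) (s : State) (cur : ℕ → ℕ) : Prop where
  cur_eq : ∀ a < s.n, s.prim a ∉ F → cur a = s.prim a
  cur_mem : ∀ a < s.n, s.prim a ∈ F → cur a ∈ s.stby a ∧ cur a ∉ F
  cur_iff : ∀ a < s.n, ∀ b < s.n, s.prim a ∈ F → s.prim b ∈ F →
    (cur a = cur b ↔ s.unit a = s.unit b)

lemma Adjusted.wellAdjusted {F : Finset ℕ} {s : State} {cur : ℕ → ℕ} (h : Adjusted F s cur) :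
    WellAdjusted F s cur :=
  ⟨h.1, h.2.1, h.2.2.1⟩

/-- Units are treated separately for each standby set S, since different standby sets are disjoint.
The affected units with standby set S inject into F \ S by their primary bins, and |F \ S| ≤ |S \ F|
because |F| ≤ |S|; so the partial map of units that keep their bin extends to an injection into S \
F. -/
lemma exists_adjusted {f : ℕ} {s : State} (hs : Separated f s)
    (hw : WellAdjusted s.failed s s.cur) {F : Finset ℕ} (hF : F.card ≤ f) :
    ∃ cur, Adjusted F s cur := by
  classical
  -- a representative of each unit
  have hrep : ∃ r : ℕ → ℕ, ∀ a < s.n, r (s.unit a) < s.n ∧ s.unit (r (s.unit a)) = s.unit a := by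
    choose! r hr using fun (u : ℕ) (h : ∃ a, a < s.n ∧ s.unit a = u) => h
    exact ⟨r, fun a ha => hr _ ⟨a, ha, rfl⟩⟩
  obtain ⟨r, hr⟩ := hrep
  have hrp : ∀ a < s.n, s.prim (r (s.unit a)) = s.prim a ∧ s.stby (r (s.unit a)) = s.stby a :=
    fun a ha => hs.of_unit_eq _ (hr a ha).1 _ ha (hr a ha).2
  have hrc : ∀ a < s.n, s.prim a ∈ s.failed → s.cur (r (s.unit a)) = s.cur a := fun a ha h =>
    (hw.cur_iff _ (hr a ha).1 _ ha ((hrp a ha).1 ▸ h) h).2 (hr a ha).2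
  -- the units in failed bins with the given standby bins
  let U : Finset ℕ → Finset ℕ := fun S =>
    ((Finset.range s.n).filter fun a => s.prim a ∈ F ∧ s.stby a = S).image s.unit
  have hU : ∀ S u, u ∈ U S ↔ ∃ a < s.n, s.prim a ∈ F ∧ s.stby a = S ∧ s.unit a = u := by
    intro S u
    simp only [U, Finset.mem_image, Finset.mem_filter, Finset.mem_range]
    constructor
    · rintro ⟨a, ⟨h1, h2, h3⟩, h4⟩; exact ⟨a, h1, h2, h3, h4⟩
    · rintro ⟨a, h1, h2, h3, h4⟩; exact ⟨a, ⟨h1, h2, h3⟩, h4⟩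
  have hG : ∀ S, ∃ g : ℕ → ℕ, (∀ u ∈ U S, g u ∈ S \ F) ∧ Set.InjOn g (U S) ∧
      ∀ u ∈ (U S).filter (fun u => s.prim (r u) ∈ s.failed ∧ s.cur (r u) ∉ F),
        g u = s.cur (r u) := by
    intro S
    apply exists_injOn_extend _ _ _ _ (Finset.filter_subset _ _)
    · intro u hu
      rw [Finset.mem_filter, hU] at hu
      obtain ⟨⟨a, ha, h1, h2, rfl⟩, h3, h4⟩ := hu
      have := (hw.cur_mem _ (hr a ha).1 h3).1
      rw [(hrp a ha).2, h2] at this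
      exact Finset.mem_sdiff.2 ⟨this, h4⟩
    · intro u hu v hv huv
      rw [Finset.mem_coe, Finset.mem_filter, hU] at hu hv
      obtain ⟨⟨a, ha, -, -, rfl⟩, h3, -⟩ := hu
      obtain ⟨⟨b, hb, -, -, rfl⟩, h3', -⟩ := hv
      have := (hw.cur_iff _ (hr a ha).1 _ (hr b hb).1 h3 h3').1 huv
      rwa [(hr a ha).2, (hr b hb).2] at this
    · rcases (U S).eq_empty_or_nonempty with h0 | ⟨u₀, hu₀⟩
      · simp [h0]
      have hSf : S.card = f := by
        obtain ⟨a, ha, -, h2, -⟩ := (hU _ _).1 hu₀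
        rw [← h2]; exact hs.card_stby a ha
      have h1 : (U S).card ≤ (F \ S).card := by
        apply Finset.card_le_card_of_injOn fun u => s.prim (r u)
        · intro u hu
          obtain ⟨a, ha, h1, h2, rfl⟩ := (hU _ _).1 hu
          simp only [Finset.coe_sdiff, Set.mem_sdiff, Finset.mem_coe]
          rw [(hrp a ha).1, ← h2]
          exact ⟨h1, hs.prim_notMem a ha a ha⟩
        · intro u hu v hv huv
          obtain ⟨a, ha, h1, h2, rfl⟩ := (hU _ _).1 hu
          obtain ⟨b, hb, h1', h2', rfl⟩ := (hU _ _).1 hv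
          simp only [(hrp a ha).1, (hrp b hb).1] at huv
          -- Units are told apart by `unit_eq`, which needs a common standby bin. There is one,
          -- since a failed primary bin exists and hence f > 0.
          have hfpos : 0 < S.card := by
            rw [hSf]; exact (Finset.card_pos.2 ⟨_, h1⟩).trans_le hF
          obtain ⟨β, hβ⟩ := Finset.card_pos.1 hfpos
          exact hs.unit_eq a ha b hb β (h2 ▸ hβ) (h2' ▸ hβ) huv
      refine h1.trans ?_
      rw [Finset.card_sdiff_le_card_sdiff_iff]
      omega
  choose G hG1 hG2 hG3 using hG
  have hUa : ∀ a < s.n, s.prim a ∈ F → s.unit a ∈ U (s.stby a) := fun a ha h =>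
    (hU _ _).2 ⟨a, ha, h, rfl, rfl⟩
  refine ⟨fun a => if s.prim a ∈ F then G (s.stby a) (s.unit a) else s.prim a,
    fun a _ h => if_neg h, fun a ha h => ?_, fun a ha b hb h h' => ?_, fun a ha h h' h'' => ?_⟩
  · simp only [if_pos h]
    exact Finset.mem_sdiff.1 (hG1 _ _ (hUa a ha h))
  · simp only [if_pos h, if_pos h']
    constructor
    · intro he
      have m1 := (Finset.mem_sdiff.1 (hG1 _ _ (hUa a ha h))).1
      have m2 := (Finset.mem_sdiff.1 (hG1 _ _ (hUa b hb h'))).1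
      -- A common target lies in both standby sets, so the sets coincide and injectivity for a
      -- single set suffices.
      have hst := hs.stby_eq a ha b hb _ m1 (he ▸ m2)
      rw [hst] at he
      exact hG2 _ (hst ▸ hUa a ha h) (hUa b hb h') he
    · intro he
      rw [he, (hs.of_unit_eq a ha b hb he).2]
  · simp only [if_pos h]
    rw [hG3 _ _ (Finset.mem_filter.2 ⟨hUa a ha h, ?_, ?_⟩), hrc a ha h']
    · rwa [(hrp a ha).1]
    · rwa [hrc a ha h']

/-- In the bins of well-adjusted packings there is no overload. -/
lemma served_of_wellAdjusted {f : ℕ} {η : ℝ} (hη : 1 < η) {s : State} (hs : Separated f s)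
    (hpos : ∀ a < s.n, 0 < s.size a) (hp : ∀ a < s.n, level η s (s.prim a) ≤ 1)
    (hst : ∀ a < s.n, ∀ β ∈ s.stby a, level η s β + unitSize s (s.unit a) * (1 - 1 / η) ≤ 1)
    {F : Finset ℕ} {cur : ℕ → ℕ} (hw : WellAdjusted F s cur) :
    s.toPacking.Served η F cur := by
  have hη0 : 0 < η := by linarith
  have hη1 : 0 ≤ 1 - 1 / η := by
    rw [sub_nonneg, div_le_one hη0]; exact hη.le
  refine ⟨fun a ha => ?_, fun b hb => ?_⟩
  · by_cases h : s.prim a ∈ F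
    · have := hw.cur_mem a ha h
      exact ⟨by simp [Packing.holders, this.1], this.2⟩
    · rw [hw.cur_eq a ha h]
      exact ⟨by simp [Packing.holders], h⟩
  -- By `cur_iff`, a bin receives promotions from at most one unit, which adds 1 - 1/η times the
  -- size of the unit to the level. Without promotions, the load equals the level.
  · by_cases hex : ∃ a < s.n, s.prim a ∈ F ∧ cur a = b
    · obtain ⟨a, ha, haF, hab⟩ := hex
      have hba : b ∈ s.stby a := hab ▸ (hw.cur_mem a ha haF).1
      refine le_trans ?_ (hst a ha b hba)
      rw [level, unitSize, Packing.load, Packing.load, Finset.sum_mul, ← Finset.sum_add_distrib]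
      refine Finset.sum_le_sum fun c hc => ?_
      rw [Finset.mem_range] at hc
      have hbc : b ≠ s.prim c := fun h => hs.prim_notMem c hc a ha (h ▸ hba)
      have hc0 := hpos c hc
      rw [if_neg hbc]
      by_cases hcur : b = cur c
      · have hcF : s.prim c ∈ F := by
          by_contra h
          exact hbc (hcur.trans (hw.cur_eq c hc h))
        have hu := (hw.cur_iff c hc a ha hcF haF).1 (by rw [← hcur, hab])
        have hm : b ∈ s.holders c := by
          simp [Packing.holders, hcur, (hw.cur_mem c hc hcF).1]
        rw [if_pos hcur, if_pos hm, if_pos hu]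
        apply le_of_eq; field_simp; ring
      · rw [if_neg hcur]
        apply le_add_of_nonneg_right
        apply mul_nonneg _ hη1
        split_ifs <;> linarith
    · push Not at hex
      have hload : s.load η cur b = level η s b := by
        rw [level, Packing.load, Packing.load]
        refine Finset.sum_congr rfl fun c hc => ?_
        rw [Finset.mem_range] at hc
        by_cases hcF : s.prim c ∈ F
        · have h1 : b ≠ cur c := fun h => hex c hc hcF h.symm
          have h2 : b ≠ s.prim c := fun h => hb (h ▸ hcF)
          rw [if_neg h1, if_neg h2]
        · rw [hw.cur_eq c hc hcF]
      rw [hload]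
      by_cases hh : ∃ a < s.n, b ∈ s.holders a
      · obtain ⟨a, ha, hba⟩ := hh
        rcases Finset.mem_insert.1 hba with h | h
        · rw [h]; exact hp a ha
        · have hu : 0 ≤ unitSize s (s.unit a) := Finset.sum_nonneg fun c hc => by
            have := hpos c (Finset.mem_range.1 hc)
            split_ifs <;> linarith
          have := hst a ha b h
          nlinarith [mul_nonneg hu hη1]
      · push Not at hh
        have : level η s b = 0 := by
          rw [level, Packing.load]
          refine Finset.sum_eq_zero fun c hc => ?_
          have hbc := hh c (Finset.mem_range.1 hc)
          rw [if_neg hbc, if_neg fun h => hbc (by simp [Packing.holders, h])]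
        rw [this]; norm_num

/-! ### Classes -/

/-- The capacity of a primary super-replica. -/
noncomputable def cap (η : ℝ) : ℝ := 2 * η / (7 * η - 1)

lemma two_div_eq_cap {η : ℝ} (hη : 1 < η) : 2 / (7 - 1 / η) = cap η := by
  have h : 7 * η - 1 ≠ 0 := by linarith
  have h0 : η ≠ 0 := by linarith
  have h1 : 7 - 1 / η = (7 * η - 1) / η := by field_simp
  rw [cap, h1, div_div_eq_mul_div]

lemma one_div_eq_cap {η : ℝ} (hη : 1 < η) : 1 / (7 - 1 / η) = cap η / 2 := by
  rw [← two_div_eq_cap hη]; ring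

lemma two_div_eq_cap_div {η : ℝ} (hη : 1 < η) : 2 / (7 * η - 1) = cap η / η := by
  have h : 7 * η - 1 ≠ 0 := by linarith
  have h0 : η ≠ 0 := by linarith
  rw [cap]; field_simp

lemma one_div_eq_cap_div {η : ℝ} (hη : 1 < η) : 1 / (7 * η - 1) = cap η / 2 / η := by
  have h : 7 * η - 1 ≠ 0 := by linarith
  have h0 : η ≠ 0 := by linarith
  rw [cap]; field_simp

lemma cap_pos {η : ℝ} (hη : 1 < η) : 0 < cap η := div_pos (by linarith) (by linarith)

lemma cap_le_one {η : ℝ} (hη : 1 < η) : cap η ≤ 1 := by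
  rw [cap, div_le_one (by linarith)]; linarith

/-- This equation explains the choice of the density: level 1 - cap is where a bin ceases to have
room for another super-replica, and there its weight reaches 1. -/
lemma smallDensity_mul_cap {η : ℝ} (hη : 1 < η) : smallDensity η * (1 - cap η) = 1 := by
  have h : 7 * η - 1 ≠ 0 := by linarith
  have h5 : 5 * η - 1 ≠ 0 := by linarith
  rw [cap, smallDensity, div_mul_eq_mul_div, div_eq_one_iff_eq h5]; field_simp; ring

lemma mem_classes {η : ℝ} {c : ℕ × ℕ} : c ∈ classes η ↔
    c = small η ∨ (1 ≤ c.1 ∧ c.1 ≤ 6 ∧ 1 ≤ c.2 ∧ c.2 ≤ ⌊6 * η⌋₊) := by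
  obtain ⟨i, j⟩ := c
  simp only [classes, List.mem_cons, List.mem_map, Prod.exists, List.product, List.mem_flatMap,
    List.mem_range, Prod.mk.injEq]
  constructor
  · rintro (h | ⟨a, b, ⟨a', ha, b', hb, rfl, rfl⟩, rfl, rfl⟩)
    · exact Or.inl h
    · exact Or.inr ⟨Nat.le_add_left _ _, Nat.succ_le_of_lt ha, Nat.le_add_left _ _,
        Nat.succ_le_of_lt hb⟩
  · rintro (h | ⟨h1, h2, h3, h4⟩)
    · exact Or.inl h
    · exact Or.inr ⟨i - 1, j - 1, ⟨i - 1, by omega, j - 1, by omega, rfl, rfl⟩, by omega, by omega⟩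

lemma nodup_classes (η : ℝ) : (classes η).Nodup := by
  rw [classes, List.nodup_cons]
  constructor
  · simp only [List.mem_map, Prod.exists, List.product, List.mem_flatMap, List.mem_range, small,
      Prod.mk.injEq]
    rintro ⟨a, b, ⟨a', ha, b', hb, rfl, rfl⟩, h, -⟩
    omega
  · refine List.Nodup.map ?_ (List.nodup_range.product List.nodup_range)
    rintro ⟨a, b⟩ ⟨a', b'⟩ h
    simpa using h

lemma div_le_cap_iff {η x : ℝ} (hη : 1 < η) :
    x / η ≤ 1 / (7 * η - 1) ↔ x ≤ 1 / (7 - 1 / η) := by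
  rw [one_div_eq_cap hη, one_div_eq_cap_div hη, div_le_div_iff_of_pos_right (by linarith)]

lemma six_lt {η : ℝ} (hη : 1 < η) : 6 < 7 - 1 / η ∧ 7 - 1 / η < 7 := by
  have h1 : 1 / η < 1 := by rw [div_lt_one (by linarith)]; exact hη
  have h2 : 0 < 1 / η := by positivity
  constructor <;> linarith

lemma floor_six_mul {η : ℝ} (hη : 1 < η) :
    6 ≤ ⌊6 * η⌋₊ ∧ (⌊6 * η⌋₊ : ℝ) ≤ 6 * η ∧ 6 * η < ⌊6 * η⌋₊ + 1 :=
  ⟨Nat.le_floor (by push_cast; linarith), Nat.floor_le (by linarith), Nat.lt_floor_add_one _⟩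

lemma exists_primaryClass {η x : ℝ} (hη : 1 < η) (hx : 0 < x) (hx1 : x ≤ 1) :
    ∃ i, PrimaryClass η x i := by
  obtain ⟨h6, h7⟩ := six_lt hη
  by_cases hs : x ≤ 1 / (7 - 1 / η)
  · exact ⟨7, Or.inr (Or.inr ⟨rfl, hx, hs⟩)⟩
  by_cases hs6 : x ≤ 1 / 6
  · exact ⟨6, Or.inr (Or.inl ⟨rfl, not_le.1 hs, hs6⟩)⟩
  have h1 : 1 ≤ ⌊1 / x⌋₊ := by rw [Nat.one_le_floor_iff, le_div_iff₀ hx]; linarith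
  have h2 : (⌊1 / x⌋₊ : ℝ) ≤ 1 / x := Nat.floor_le (by positivity)
  have h3 : 1 / x < ⌊1 / x⌋₊ + 1 := Nat.lt_floor_add_one _
  refine ⟨⌊1 / x⌋₊, Or.inl ⟨h1, ?_, ?_, ?_⟩⟩
  · have : 1 / x < 6 := by rw [div_lt_iff₀ hx]; linarith
    have : (⌊1 / x⌋₊ : ℝ) < 6 := by linarith
    have : ⌊1 / x⌋₊ < 6 := by exact_mod_cast this
    omega
  · rw [div_lt_comm₀ (by linarith) hx]; exact h3
  · rw [le_div_comm₀ hx (by exact_mod_cast h1)]; exact h2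

lemma exists_standbyClass {η y : ℝ} (hη : 1 < η) (hy : 0 < y) (hy1 : η * y ≤ 1) :
    ∃ j, StandbyClass η y j := by
  obtain ⟨hJ, hJ1, hJ2⟩ := floor_six_mul hη
  by_cases hs : y ≤ 1 / (7 * η - 1)
  · exact ⟨_, Or.inr (Or.inr ⟨rfl, hy, hs⟩)⟩
  have hJ6 : (6 : ℝ) ≤ ⌊6 * η⌋₊ := by exact_mod_cast hJ
  by_cases hs6 : y ≤ 1 / ((⌊6 * η⌋₊ : ℝ) + η - 1)
  · exact ⟨_, Or.inr (Or.inl ⟨rfl, not_le.1 hs, hs6⟩)⟩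
  obtain ⟨j, hj, -, h2, h3⟩ := stbyWeight_eq hy hy1 hs
  have hj' : (1 : ℝ) ≤ j := by exact_mod_cast hj
  refine ⟨j, Or.inl ⟨hj, ?_, ?_, ?_⟩⟩
  · by_contra hlt
    have : (⌊6 * η⌋₊ : ℝ) ≤ j := by exact_mod_cast (by omega : ⌊6 * η⌋₊ ≤ j)
    rw [not_le, div_lt_iff₀ (by linarith)] at hs6
    nlinarith
  · rw [div_lt_iff₀ (by linarith)]; linarith
  · rw [le_div_iff₀ (by linarith)]; linarith

/-- What the analysis needs to know about regular items. -/
structure RegularSize (η x : ℝ) (i j : ℕ) : Prop where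
  mem : (i, j) ∈ classes η
  ne : (i, j) ≠ small η
  mul_le : (i : ℝ) * x ≤ 1
  mul_div_le : (j + η - 1) * (x / η) ≤ 1
  weight_prim : i * primWeight η x = 1
  weight_stby : j * stbyWeight η (x / η) = 1

/-- In every regular case the class is ⌊1/x⌋, the integer used by `primWeight`. For class 6 this
holds because its lower end 1/(7 - 1/η) exceeds 1/7. -/
lemma PrimaryClass.regular {η x : ℝ} (hη : 1 < η) {i : ℕ} (h : PrimaryClass η x i) (hi : i ≠ 7) :
    1 ≤ i ∧ i ≤ 6 ∧ i * x ≤ 1 ∧ i * primWeight η x = 1 ∧ ¬ x ≤ 1 / (7 - 1 / η) := by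
  obtain ⟨h6, h7⟩ := six_lt hη
  have hlt : 1 / (7 - 1 / η) < 1 / 6 := one_div_lt_one_div_of_lt (by norm_num) h6
  have key : ∀ i : ℕ, 1 ≤ i → 0 < x → i * x ≤ 1 → 1 < (i + 1) * x → ¬ x ≤ 1 / (7 - 1 / η) →
      i * primWeight η x = 1 := by
    intro i hi hx h1 h2 h3
    have hi' : (1 : ℝ) ≤ i := by exact_mod_cast hi
    rw [primWeight, if_neg h3]
    have : ⌊1 / x⌋₊ = i := by
      rw [Nat.floor_eq_iff (by positivity), le_div_iff₀ hx, div_lt_iff₀ hx]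
      exact ⟨h1, h2⟩
    rw [this]
    field_simp
  rcases h with ⟨h1, h2, h3, h4⟩ | ⟨rfl, h3, h4⟩ | ⟨h, -⟩
  · have hi' : (1 : ℝ) ≤ i := by exact_mod_cast h1
    have hi5 : (i : ℝ) ≤ 5 := by exact_mod_cast h2
    have hx : 0 < x := lt_trans (by positivity) h3
    have hn : ¬ x ≤ 1 / (7 - 1 / η) := by
      have : 1 / 6 ≤ 1 / ((i : ℝ) + 1) := one_div_le_one_div_of_le (by linarith) (by linarith)
      linarith
    rw [div_lt_iff₀ (by linarith)] at h3
    rw [le_div_iff₀ (by linarith)] at h4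
    exact ⟨h1, by omega, by linarith, key i h1 hx (by linarith) (by linarith) hn, hn⟩
  · have h0 : 0 < 1 / (7 - 1 / η) := by apply one_div_pos.2; linarith
    have hx : 0 < x := h0.trans h3
    have h17 : 1 / 7 < 1 / (7 - 1 / η) := one_div_lt_one_div_of_lt (by linarith) h7
    refine ⟨by norm_num, le_rfl, by push_cast; linarith, ?_, by linarith⟩
    exact key 6 (by norm_num) hx (by push_cast; linarith) (by push_cast; linarith) (by linarith)
  · exact absurd h hi

lemma StandbyClass.regular {η y : ℝ} (hη : 1 < η) {j : ℕ} (h : StandbyClass η y j)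
    (hj : j ≠ ⌊6 * η⌋₊ + 1) :
    1 ≤ j ∧ j ≤ ⌊6 * η⌋₊ ∧ (j + η - 1) * y ≤ 1 ∧ j * stbyWeight η y = 1 := by
  obtain ⟨hJ, hJ1, hJ2⟩ := floor_six_mul hη
  have key : ∀ j : ℕ, 1 ≤ j → 0 < y → (j + η - 1) * y ≤ 1 → 1 < (j + η) * y →
      ¬ y ≤ 1 / (7 * η - 1) → j * stbyWeight η y = 1 := by
    intro j hi hx h1 h2 h3
    have hi' : (1 : ℝ) ≤ j := by exact_mod_cast hi
    rw [stbyWeight, if_neg h3]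
    have e1 : (j : ℝ) + η - 1 ≤ 1 / y := by rwa [le_div_iff₀ hx]
    have e2 : 1 / y < (j : ℝ) + η := by rwa [div_lt_iff₀ hx]
    have : ⌊1 / y - η + 1⌋₊ = j := by
      rw [Nat.floor_eq_iff (by linarith)]
      constructor <;> linarith
    rw [this]
    field_simp
  rcases h with ⟨h1, h2, h3, h4⟩ | ⟨rfl, h3, h4⟩ | ⟨h, -⟩
  · have hi' : (1 : ℝ) ≤ j := by exact_mod_cast h1
    have hiJ : (j : ℝ) + 1 ≤ ⌊6 * η⌋₊ := by exact_mod_cast h2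
    have hx : 0 < y := lt_trans (by positivity) h3
    have hn : ¬ y ≤ 1 / (7 * η - 1) := by
      have : 1 / (7 * η - 1) ≤ 1 / ((j : ℝ) + η) :=
        one_div_le_one_div_of_le (by linarith) (by linarith)
      linarith
    rw [div_lt_iff₀ (by linarith)] at h3
    rw [le_div_iff₀ (by linarith)] at h4
    exact ⟨h1, by omega, by linarith, key j h1 hx (by linarith) (by linarith) hn⟩
  · have hJ6 : (6 : ℝ) ≤ ⌊6 * η⌋₊ := by exact_mod_cast hJ
    have h0 : 0 < 1 / (7 * η - 1) := by apply one_div_pos.2; linarith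
    have hx : 0 < y := h0.trans h3
    have hn : ¬ y ≤ 1 / (7 * η - 1) := by linarith
    rw [div_lt_iff₀ (by linarith)] at h3
    rw [le_div_iff₀ (by linarith)] at h4
    refine ⟨by omega, le_rfl, by linarith, key _ (by omega) hx (by linarith) ?_ hn⟩
    -- From 6η < J + 1 follows 7η - 1 < J + η, so a replica above the threshold 1/(7η - 1) is larger
    -- than 1/(J + η), as weight 1/J requires.
    nlinarith
  · exact absurd h hj

/-- The thresholds for primary and standby replicas correspond under division by η, so no item is
small in one respect and regular in the other. -/
lemma class_small_iff {η x : ℝ} (hη : 1 < η) {i j : ℕ} (hi : PrimaryClass η x i)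
    (hj : StandbyClass η (x / η) j) : i = 7 ↔ j = ⌊6 * η⌋₊ + 1 := by
  obtain ⟨hJ, hJ1, hJ2⟩ := floor_six_mul hη
  constructor
  · rintro rfl
    have hx : x / η ≤ 1 / (7 * η - 1) := by
      rw [div_le_cap_iff hη]
      rcases hi with ⟨-, h, -⟩ | ⟨h, -⟩ | ⟨-, -, h⟩
      · omega
      · omega
      · exact h
    rcases hj with ⟨h1, h2, h3, h4⟩ | ⟨rfl, h3, h4⟩ | ⟨h, -⟩
    · have hiJ : (j : ℝ) + 1 ≤ ⌊6 * η⌋₊ := by exact_mod_cast h2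
      have : 1 / (7 * η - 1) ≤ 1 / ((j : ℝ) + η) :=
        one_div_le_one_div_of_le (by positivity) (by linarith)
      linarith
    · linarith
    · exact h
  · rintro rfl
    by_contra hne
    have := (hi.regular hη hne).2.2.2.2
    rw [← div_le_cap_iff hη] at this
    rcases hj with ⟨-, h, -⟩ | ⟨h, -⟩ | ⟨-, -, h⟩
    · omega
    · omega
    · exact this h

lemma regularSize_of_class {η x : ℝ} (hη : 1 < η) {i j : ℕ} (hi : PrimaryClass η x i)
    (hj : StandbyClass η (x / η) j) (h : (i, j) ≠ small η) : RegularSize η x i j := by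
  have hiff := class_small_iff hη hi hj
  have hi7 : i ≠ 7 := fun h7 => h (by rw [small, h7, hiff.1 h7])
  obtain ⟨a1, a2, a3, a4, -⟩ := hi.regular hη hi7
  obtain ⟨b1, b2, b3, b4⟩ := hj.regular hη fun h7 => hi7 (hiff.2 h7)
  exact ⟨mem_classes.2 (Or.inr ⟨a1, a2, b1, b2⟩), h, a3, b3, a4, b4⟩

lemma le_cap_of_class {η x : ℝ} (hη : 1 < η) {i j : ℕ} (hi : PrimaryClass η x i)
    (h : (i, j) = small η) : x ≤ cap η / 2 := by
  rw [small, Prod.mk.injEq] at h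
  rw [← one_div_eq_cap hη]
  rcases hi with ⟨-, h2, -⟩ | ⟨h2, -⟩ | ⟨-, -, h3⟩
  · omega
  · omega
  · exact h3

lemma primWeight_of_le_cap {η x : ℝ} (hη : 1 < η) (hx : x ≤ cap η / 2) :
    primWeight η x = smallDensity η * x := by
  rw [primWeight, if_pos (by rwa [one_div_eq_cap hη])]

lemma stbyWeight_of_le_cap {η x : ℝ} (hη : 1 < η) (hx : x ≤ cap η / 2) :
    stbyWeight η (x / η) = smallDensity η * (x / η) := by
  rw [stbyWeight, if_pos (by rwa [div_le_cap_iff hη, one_div_eq_cap hη])]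

/-! ### Counting residues and quotients -/

/-- Item t of a regular group goes to the primary bin t mod j and to the standby bins with index
⌊t/j⌋. So residues and quotients count the replicas per bin, and a full group has i in each primary
bin and j in each standby bin. -/
lemma count_mod {j w : ℕ} (hw : w < j) (i : ℕ) : Nat.count (fun q => q % j = w) (i * j) = i := by
  induction i with
  | zero => simp
  | succ i ih =>
    rw [add_mul, one_mul, Nat.count_add, ih]
    congr 1
    have : (fun k => (i * j + k) % j = w) = fun k => k % j = w := by
      funext k; rw [mul_comm, Nat.mul_add_mod]
    simp only [this]
    rw [Nat.count_eq_card_filter_range, Finset.card_eq_one]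
    refine ⟨w, ?_⟩
    ext q
    simp only [Finset.mem_filter, Finset.mem_range, Finset.mem_singleton]
    constructor
    · rintro ⟨h1, h2⟩; rwa [Nat.mod_eq_of_lt h1] at h2
    · rintro rfl; exact ⟨hw, Nat.mod_eq_of_lt hw⟩

lemma count_div {i j z : ℕ} (hj : 0 < j) (hz : z < i) :
    Nat.count (fun q => q / j = z) (i * j) = j := by
  rw [Nat.count_eq_card_filter_range]
  have : (Finset.range (i * j)).filter (fun q => q / j = z) = Finset.Ico (z * j) (z * j + j) := by
    ext q
    simp only [Finset.mem_filter, Finset.mem_range, Finset.mem_Ico]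
    have h1 : (z + 1) * j ≤ i * j := Nat.mul_le_mul_right _ hz
    rw [Nat.div_eq_iff hj]
    have h2 : (z + 1) * j = z * j + j := by ring
    rw [h2] at h1
    omega
  rw [this, Nat.card_Ico, Nat.add_sub_cancel_left]

/-! ### The invariants -/

/-- The number of bins of a group, not counting a committed bin. -/
noncomputable def Group.len (f : ℕ) (η : ℝ) (g : Group) : ℕ :=
  if g.cls = small η then f else g.cls.2 + f * g.cls.1

/-- The bins of a group, not counting a committed bin. -/
noncomputable def Group.own (f : ℕ) (η : ℝ) (g : Group) : Finset ℕ :=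
  Finset.Ico g.base (g.base + g.len f η)

lemma Group.own_small {f : ℕ} {η : ℝ} {g : Group} (h : g.cls = small η) :
    g.own f η = Finset.Ico g.base (g.base + f) := by rw [own, len, if_pos h]

lemma Group.own_regular {f : ℕ} {η : ℝ} {g : Group} (h : g.cls ≠ small η) :
    g.own f η = Finset.Ico g.base (g.base + (g.cls.2 + f * g.cls.1)) := by rw [own, len, if_neg h]

/-- The weight of bin `b`. -/
noncomputable def weight (η : ℝ) (s : State) (b : ℕ) : ℝ :=
  s.binSum (primWeight η) (fun x => stbyWeight η (x / η)) b

/-- The primary bins that share an item with bin `β`. -/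
def sharing (s : State) (β : ℕ) : Finset ℕ :=
  ((Finset.range s.n).filter fun a => β ∈ s.stby a).image s.prim

/-- The primary bins for small items that have room for another super-replica. -/
noncomputable def unfilled (η : ℝ) (s : State) : Finset ℕ :=
  open Classical in s.smallPrim.filter fun b => level η s b ≤ 1 - cap η

/-- The incomplete groups for class `c`. -/
def incomplete (s : State) (c : ℕ × ℕ) : Finset ℕ :=
  (Finset.range s.numGroups).filter fun k => (s.grp k).cls = c ∧ (s.grp k).complete = false

/-- A bound on the number of unfilled primary bins for small items. -/
noncomputable def maxUnfilled (f : ℕ) (η : ℝ) : ℕ := f + (f + 1) + f * ⌊7 * η⌋₊ + 1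

/-- The bins of the groups. -/
structure Layout (f : ℕ) (η : ℝ) (s : State) : Prop where
  mem_classes : ∀ k < s.numGroups, (s.grp k).cls ∈ classes η
  own_lt : ∀ k < s.numGroups, ∀ b ∈ (s.grp k).own f η, b < s.numBins
  smallPrim_lt : ∀ b ∈ s.smallPrim, b < s.numBins
  own_disjoint : ∀ k < s.numGroups, ∀ k' < s.numGroups, ∀ b, b ∈ (s.grp k).own f η →
    b ∈ (s.grp k').own f η → k = k'
  own_smallPrim : ∀ k < s.numGroups, ∀ b ∈ (s.grp k).own f η, b ∉ s.smallPrim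
  cover : ∀ b < s.numBins, b ∈ s.smallPrim ∨ ∃ k < s.numGroups, b ∈ (s.grp k).own f η
  sr : ∀ k < s.numGroups, ∀ b u, (s.grp k).sr = some (b, u) →
    (s.grp k).cls = small η ∧ (s.grp k).complete = false ∧ b ∈ s.smallPrim
  sr_inj : ∀ k < s.numGroups, ∀ k' < s.numGroups, ∀ b u b' u', (s.grp k).sr = some (b, u) →
    (s.grp k').sr = some (b', u') → b = b' ∨ u = u' → k = k'
  count_lt : ∀ k < s.numGroups, (s.grp k).cls ≠ small η → (s.grp k).complete = false →
    (s.grp k).count < (s.grp k).cls.1 * (s.grp k).cls.2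
  count_eq : ∀ k < s.numGroups, (s.grp k).cls ≠ small η → (s.grp k).complete = true →
    (s.grp k).count = (s.grp k).cls.1 * (s.grp k).cls.2
  card_incomplete : ∀ c, (incomplete s c).card ≤ f + 1

/-- Item `a` has been placed as a regular item in group `k`. -/
structure RegularItem (f : ℕ) (η : ℝ) (s : State) (a k : ℕ) : Prop where
  cls : (s.grp k).cls ≠ small η
  mul_div_le : ((s.grp k).cls.2 + η - 1) * (s.size a / η) ≤ 1
  unit : s.unit a = a
  unitSize : unitSize s a = s.size a
  pos : ∃ t < (s.grp k).count, s.prim a = (s.grp k).base + t % (s.grp k).cls.2 ∧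
    s.stby a = (Finset.range f).image fun m =>
      (s.grp k).base + (s.grp k).cls.2 + m * (s.grp k).cls.1 + t / (s.grp k).cls.2

/-- Item `a` has been placed as a small item in group `k`. -/
structure SmallItem (f : ℕ) (η : ℝ) (s : State) (a k : ℕ) : Prop where
  cls : (s.grp k).cls = small η
  prim : s.prim a ∈ s.smallPrim
  stby : s.stby a = (s.grp k).own f η
  unitSize : unitSize s (s.unit a) ≤ cap η

/-- The placement of the items. -/
structure Items (f : ℕ) (η : ℝ) (s : State) : Prop where
  size : ∀ a < s.n, 0 < s.size a ∧ s.size a ≤ 1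
  item : ∀ a < s.n, ∃ k < s.numGroups, RegularItem f η s a k ∨ SmallItem f η s a k
  unit_lt : ∀ a < s.n, s.unit a < s.n
  of_unit_eq : ∀ a < s.n, ∀ b < s.n, s.unit a = s.unit b →
    s.prim a = s.prim b ∧ s.stby a = s.stby b
  unit_eq : ∀ a < s.n, ∀ b < s.n, ∀ β, β ∈ s.stby a → β ∈ s.stby b → s.prim a = s.prim b →
    s.unit a = s.unit b
  -- For f > 0, this field and the next say that the open unit consists exactly of the items shared
  -- by the committed bin and the standby bins of the group. This preserves `of_unit_eq` and
  -- `unit_eq` when an item joins.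
  of_sr : ∀ k < s.numGroups, ∀ b u, (s.grp k).sr = some (b, u) → ∀ a < s.n, s.unit a = u →
    s.prim a = b ∧ s.stby a = (s.grp k).own f η
  sr_unit : ∀ k < s.numGroups, ∀ b u, (s.grp k).sr = some (b, u) → ∀ a < s.n, s.prim a = b →
    ∀ β ∈ (s.grp k).own f η, β ∈ s.stby a → s.unit a = u

/-- The loads and the weights of the bins. -/
structure Loads (f : ℕ) (η : ℝ) (s : State) : Prop where
  prim : ∀ k < s.numGroups, (s.grp k).cls ≠ small η → ∀ w < (s.grp k).cls.2,
    (s.grp k).cls.1 * level η s ((s.grp k).base + w) ≤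
      Nat.count (fun q => q % (s.grp k).cls.2 = w) (s.grp k).count ∧
    (Nat.count (fun q => q % (s.grp k).cls.2 = w) (s.grp k).count : ℝ) ≤
      (s.grp k).cls.1 * weight η s ((s.grp k).base + w)
  stby : ∀ k < s.numGroups, (s.grp k).cls ≠ small η → ∀ m < f, ∀ z < (s.grp k).cls.1,
    ((s.grp k).cls.2 + η - 1) *
        level η s ((s.grp k).base + (s.grp k).cls.2 + m * (s.grp k).cls.1 + z) ≤
      Nat.count (fun q => q / (s.grp k).cls.2 = z) (s.grp k).count ∧
    (Nat.count (fun q => q / (s.grp k).cls.2 = z) (s.grp k).count : ℝ) ≤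
      (s.grp k).cls.2 *
        weight η s ((s.grp k).base + (s.grp k).cls.2 + m * (s.grp k).cls.1 + z)
  smallPrim : ∀ b ∈ s.smallPrim, level η s b ≤ 1 ∧ smallDensity η * level η s b ≤ weight η s b
  -- The first bound leaves the room cap - cap/η that the promotion of one full super-replica takes.
  -- Equality of the levels expresses that the standby bins mirror each other.
  smallStby : ∀ k < s.numGroups, (s.grp k).cls = small η → ∀ β ∈ (s.grp k).own f η,
    level η s β ≤ 1 - cap η + cap η / η ∧ smallDensity η * level η s β ≤ weight η s β ∧
      ∀ β' ∈ (s.grp k).own f η, level η s β = level η s β'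
  complete : ∀ k < s.numGroups, (s.grp k).cls = small η → (s.grp k).complete = true →
    ∀ β ∈ (s.grp k).own f η, 1 - cap η ≤ level η s β
  -- The unused capacity of the open super-replica stays reserved in the committed bin.
  sr_prim : ∀ k < s.numGroups, ∀ b u, (s.grp k).sr = some (b, u) →
    level η s b + cap η - unitSize s u ≤ 1
  -- Without the open super-replica the level is at most 1 - cap. Closed super-replicas are more
  -- than half full, so the level also pays cap/(2η) for each primary bin, other than the committed
  -- one, that shares an item with the standby bin.
  sr_stby : ∀ k < s.numGroups, ∀ b u, (s.grp k).sr = some (b, u) → ∀ β ∈ (s.grp k).own f η,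
    level η s β - unitSize s u / η ≤ 1 - cap η ∧
      ((sharing s β).erase b).card * (cap η / η / 2) + unitSize s u / η ≤ level η s β
  sr_none : ∀ k < s.numGroups, (s.grp k).cls = small η → (s.grp k).complete = false →
    (s.grp k).sr = none → ∀ β ∈ (s.grp k).own f η, ∀ a < s.n, β ∉ s.stby a
  unfilled : (unfilled η s).card ≤ maxUnfilled f η

/-- The invariant of the packing strategy. -/
structure Inv (f : ℕ) (η : ℝ) (s : State) : Prop where
  layout : Layout f η s
  items : Items f η s
  loads : Loads f η s

/-- The packing invariant does not refer to failures, promotions or active groups; these are covered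
by `WellAdjusted` and `Ready`. -/
lemma Inv.update {f : ℕ} {η : ℝ} {s : State} (h : Inv f η s) (cur : ℕ → ℕ) (F : Finset ℕ)
    (active : ℕ × ℕ → ℕ) : Inv f η { s with cur := cur, failed := F, active := active } where
  layout := ⟨h.1.1, h.1.2, h.1.3, h.1.4, h.1.5, h.1.6, h.1.7, h.1.8, h.1.9, h.1.10, h.1.11⟩
  items := {
    size := h.2.1
    item := fun a ha => by
      obtain ⟨k, hk, h | h⟩ := h.2.2 a ha
      · exact ⟨k, hk, Or.inl ⟨h.1, h.2, h.3, h.4, h.5⟩⟩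
      · exact ⟨k, hk, Or.inr ⟨h.1, h.2, h.3, h.4⟩⟩
    unit_lt := h.2.3
    of_unit_eq := h.2.4
    unit_eq := h.2.5
    of_sr := h.2.6
    sr_unit := h.2.7 }
  loads := ⟨h.3.1, h.3.2, h.3.3, h.3.4, h.3.5, h.3.6, h.3.7, h.3.8, h.3.9⟩

/-! ### Consequences of the invariants -/

section

variable {f : ℕ} {η : ℝ} {s : State}

lemma Layout.bounds (hL : Layout f η s) {k : ℕ} (hk : k < s.numGroups)
    (hc : (s.grp k).cls ≠ small η) : 1 ≤ (s.grp k).cls.1 ∧ (s.grp k).cls.1 ≤ 6 ∧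
      1 ≤ (s.grp k).cls.2 ∧ (s.grp k).cls.2 ≤ ⌊6 * η⌋₊ :=
  (HS.mem_classes.1 (hL.mem_classes k hk)).resolve_left hc

lemma Layout.count_le (hL : Layout f η s) {k : ℕ} (hk : k < s.numGroups)
    (hc : (s.grp k).cls ≠ small η) : (s.grp k).count ≤ (s.grp k).cls.1 * (s.grp k).cls.2 := by
  cases h : (s.grp k).complete
  · exact (hL.count_lt k hk hc h).le
  · exact (hL.count_eq k hk hc h).le

lemma Group.prim_mem_own {g : Group} (hc : g.cls ≠ small η) {w : ℕ} (hw : w < g.cls.2) :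
    g.base + w ∈ g.own f η := by
  rw [Group.own_regular hc, Finset.mem_Ico]
  omega

lemma Group.stby_mem_own {g : Group} (hc : g.cls ≠ small η) {m z : ℕ} (hm : m < f)
    (hz : z < g.cls.1) : g.base + g.cls.2 + m * g.cls.1 + z ∈ g.own f η := by
  rw [Group.own_regular hc, Finset.mem_Ico]
  have : (m + 1) * g.cls.1 ≤ f * g.cls.1 := Nat.mul_le_mul_right _ hm
  rw [add_mul] at this
  omega

lemma Group.mem_own_cases {g : Group} (hc : g.cls ≠ small η) (hi : 1 ≤ g.cls.1) {b : ℕ}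
    (hb : b ∈ g.own f η) : (∃ w < g.cls.2, b = g.base + w) ∨
      ∃ m < f, ∃ z < g.cls.1, b = g.base + g.cls.2 + m * g.cls.1 + z := by
  rw [Group.own_regular hc, Finset.mem_Ico] at hb
  by_cases h : b < g.base + g.cls.2
  · exact Or.inl ⟨b - g.base, by omega, by omega⟩
  · right
    have hd := Nat.div_add_mod (b - g.base - g.cls.2) g.cls.1
    refine ⟨(b - g.base - g.cls.2) / g.cls.1, ?_, (b - g.base - g.cls.2) % g.cls.1,
      Nat.mod_lt _ hi, ?_⟩
    · rw [Nat.div_lt_iff_lt_mul hi]; omega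
    · rw [mul_comm] at hd; omega

lemma stby_index_eq {B i m z m' z' : ℕ} (hz : z < i) (hz' : z' < i)
    (h : B + m * i + z = B + m' * i + z') : z = z' := by
  have h' : m * i + z = m' * i + z' := by omega
  have := congrArg (· % i) h'
  simpa only [mul_comm _ i, Nat.mul_add_mod, Nat.mod_eq_of_lt hz, Nat.mod_eq_of_lt hz'] using this

lemma RegularItem.prim_mem (hL : Layout f η s) {a k : ℕ} (hk : k < s.numGroups)
    (h : RegularItem f η s a k) : s.prim a ∈ (s.grp k).own f η := by
  obtain ⟨t, ht, hp, -⟩ := h.pos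
  rw [hp]
  exact Group.prim_mem_own h.cls (Nat.mod_lt _ (hL.bounds hk h.cls).2.2.1)

lemma div_lt_of_lt_count (hL : Layout f η s) {k : ℕ} (hk : k < s.numGroups)
    (hc : (s.grp k).cls ≠ small η) {t : ℕ} (ht : t < (s.grp k).count) :
    t / (s.grp k).cls.2 < (s.grp k).cls.1 := by
  rw [Nat.div_lt_iff_lt_mul (hL.bounds hk hc).2.2.1]
  exact ht.trans_le (hL.count_le hk hc)

lemma RegularItem.stby_subset (hL : Layout f η s) {a k : ℕ} (hk : k < s.numGroups)
    (h : RegularItem f η s a k) : s.stby a ⊆ (s.grp k).own f η := by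
  obtain ⟨t, ht, -, hp⟩ := h.pos
  rw [hp]
  intro b hb
  simp only [Finset.mem_image, Finset.mem_range] at hb
  obtain ⟨m, hm, rfl⟩ := hb
  exact Group.stby_mem_own h.cls hm (div_lt_of_lt_count hL hk h.cls ht)

lemma Inv.stby_subset (h : Inv f η s) {a k : ℕ} (hk : k < s.numGroups)
    (hi : RegularItem f η s a k ∨ SmallItem f η s a k) : s.stby a ⊆ (s.grp k).own f η := by
  rcases hi with hi | hi
  · exact hi.stby_subset h.layout hk
  · rw [hi.stby]

lemma Inv.holders_lt (h : Inv f η s) {a : ℕ} (ha : a < s.n) : ∀ b ∈ s.holders a, b < s.numBins := by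
  intro b hb
  obtain ⟨k, hk, hi⟩ := h.items.item a ha
  rcases Finset.mem_insert.1 hb with rfl | hb
  · rcases hi with hi | hi
    · exact h.layout.own_lt k hk _ (hi.prim_mem h.layout hk)
    · exact h.layout.smallPrim_lt _ hi.prim
  · exact h.layout.own_lt k hk b (h.stby_subset hk hi hb)

lemma Inv.notMem_stby_of_smallPrim (h : Inv f η s) {a b : ℕ} (ha : a < s.n)
    (hb : b ∈ s.smallPrim) : b ∉ s.stby a := fun hba => by
  obtain ⟨k, hk, hi⟩ := h.items.item a ha
  exact h.layout.own_smallPrim k hk b (h.stby_subset hk hi hba) hb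

/-- Groups have disjoint own bins, and these are disjoint from the primary bins for small items.
Within a regular group, primary bins have offsets below j and standby bins offsets from j on, and a
standby bin determines the quotient ⌊t/j⌋ and thereby the whole standby set. -/
lemma Inv.separated (h : Inv f η s) : Separated f s where
  card_stby a ha := by
    obtain ⟨k, hk, hi | hi⟩ := h.items.item a ha
    · obtain ⟨t, -, -, hp⟩ := hi.pos
      rw [hp, Finset.card_image_of_injective, Finset.card_range]
      intro m m' hm
      have := (h.layout.bounds hk hi.cls).1
      simp only [Nat.add_right_cancel_iff, Nat.add_left_cancel_iff] at hm
      exact Nat.eq_of_mul_eq_mul_right this hm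
    · rw [hi.stby, Group.own_small hi.cls, Nat.card_Ico, Nat.add_sub_cancel_left]
  prim_notMem a ha b hb hab := by
    obtain ⟨k, hk, hi⟩ := h.items.item a ha
    obtain ⟨k', hk', hi'⟩ := h.items.item b hb
    have hm := h.stby_subset hk' hi' hab
    rcases hi with hi | hi
    · have hkk := h.layout.own_disjoint k hk k' hk' _ (hi.prim_mem h.layout hk) hm
      subst hkk
      rcases hi' with hi' | hi'
      · obtain ⟨t, -, hp, -⟩ := hi.pos
        obtain ⟨t', -, -, hp'⟩ := hi'.pos
        rw [hp, hp'] at hab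
        simp only [Finset.mem_image, Finset.mem_range] at hab
        obtain ⟨m, -, hm⟩ := hab
        have := Nat.mod_lt t (h.layout.bounds hk hi.cls).2.2.1
        generalize m * (s.grp k).cls.1 = p at hm
        generalize t' / (s.grp k).cls.2 = q at hm
        omega
      · exact hi.cls hi'.cls
    · exact h.layout.own_smallPrim k' hk' _ hm hi.prim
  stby_eq a ha b hb β hβ hβ' := by
    obtain ⟨k, hk, hi⟩ := h.items.item a ha
    obtain ⟨k', hk', hi'⟩ := h.items.item b hb
    have hkk := h.layout.own_disjoint k hk k' hk' β (h.stby_subset hk hi hβ)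
      (h.stby_subset hk' hi' hβ')
    subst hkk
    rcases hi with hi | hi <;> rcases hi' with hi' | hi'
    · obtain ⟨t, ht, -, hp⟩ := hi.pos
      obtain ⟨t', ht', -, hp'⟩ := hi'.pos
      rw [hp] at hβ
      rw [hp'] at hβ'
      simp only [Finset.mem_image, Finset.mem_range] at hβ hβ'
      obtain ⟨m, -, rfl⟩ := hβ
      obtain ⟨m', -, hm⟩ := hβ'
      rw [hp, hp', stby_index_eq (div_lt_of_lt_count h.layout hk hi.cls ht')
        (div_lt_of_lt_count h.layout hk hi.cls ht) hm]
    · exact absurd hi'.cls hi.cls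
    · exact absurd hi.cls hi'.cls
    · rw [hi.stby, hi'.stby]
  of_unit_eq := h.items.of_unit_eq
  unit_eq := h.items.unit_eq

lemma count_mod_le {i j w t : ℕ} (hw : w < j) (ht : t ≤ i * j) :
    Nat.count (fun q => q % j = w) t ≤ i :=
  (Nat.count_monotone _ ht).trans (count_mod hw i).le

lemma count_div_le {i j z t : ℕ} (hj : 0 < j) (hz : z < i) (ht : t ≤ i * j) :
    Nat.count (fun q => q / j = z) t ≤ j :=
  (Nat.count_monotone _ ht).trans (count_div hj hz).le

lemma Inv.level_prim_le (h : Inv f η s) {a : ℕ} (ha : a < s.n) : level η s (s.prim a) ≤ 1 := by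
  obtain ⟨k, hk, hi | hi⟩ := h.items.item a ha
  · obtain ⟨t, -, hp, -⟩ := hi.pos
    obtain ⟨b1, -, b3, -⟩ := h.layout.bounds hk hi.cls
    have hw := Nat.mod_lt t b3
    have h1 := (h.loads.prim k hk hi.cls _ hw).1
    have h2 : (Nat.count (fun q => q % (s.grp k).cls.2 = t % (s.grp k).cls.2)
        (s.grp k).count : ℝ) ≤ (s.grp k).cls.1 := by
      exact_mod_cast count_mod_le hw (h.layout.count_le hk hi.cls)
    rw [hp]
    have h3 : (0 : ℝ) < (s.grp k).cls.1 := by exact_mod_cast b1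
    nlinarith
  · exact (h.loads.smallPrim _ hi.prim).1

/-- For a regular item both estimates are scaled by j + η - 1: the level contributes at most j, and
the promotion, which adds (η - 1)(x/η), contributes at most η - 1. For a small item, 1 - cap + cap/η
and the promotion cost cap - cap/η add up to 1. -/
lemma Inv.level_stby_le (h : Inv f η s) (hη : 1 < η) {a : ℕ} (ha : a < s.n) :
    ∀ β ∈ s.stby a, level η s β + unitSize s (s.unit a) * (1 - 1 / η) ≤ 1 := by
  intro β hβ
  have hη0 : 0 < η := by linarith
  obtain ⟨k, hk, hi | hi⟩ := h.items.item a ha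
  · obtain ⟨t, ht, -, hp⟩ := hi.pos
    obtain ⟨b1, -, b3, -⟩ := h.layout.bounds hk hi.cls
    rw [hp] at hβ
    simp only [Finset.mem_image, Finset.mem_range] at hβ
    obtain ⟨m, hm, rfl⟩ := hβ
    have hz := div_lt_of_lt_count h.layout hk hi.cls ht
    have h1 := (h.loads.stby k hk hi.cls m hm _ hz).1
    have h2 : (Nat.count (fun q => q / (s.grp k).cls.2 = t / (s.grp k).cls.2)
        (s.grp k).count : ℝ) ≤ (s.grp k).cls.2 := by
      exact_mod_cast count_div_le b3 hz (h.layout.count_le hk hi.cls)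
    have h3 : (1 : ℝ) ≤ (s.grp k).cls.2 := by exact_mod_cast b3
    have h4 := hi.mul_div_le
    rw [hi.unit, hi.unitSize]
    have h5 : s.size a * (1 - 1 / η) = (η - 1) * (s.size a / η) := by field_simp
    rw [h5]
    have h6 : (0 : ℝ) < (s.grp k).cls.2 + η - 1 := by linarith
    refine le_of_mul_le_mul_left ?_ h6
    rw [mul_add, mul_one, mul_left_comm]
    nlinarith
  · have h1 := (h.loads.smallStby k hk hi.cls β (hi.stby ▸ hβ)).1
    have h2 := hi.unitSize
    have h3 : 0 ≤ 1 - 1 / η := by rw [sub_nonneg, div_le_one hη0]; exact hη.le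
    have h4 := mul_le_mul_of_nonneg_right h2 h3
    have h5 : cap η * (1 - 1 / η) = cap η - cap η / η := by ring
    linarith

lemma Inv.served (h : Inv f η s) (hη : 1 < η) {F : Finset ℕ} {cur : ℕ → ℕ}
    (hw : WellAdjusted F s cur) : s.toPacking.Served η F cur :=
  served_of_wellAdjusted hη h.separated (fun a ha => (h.items.size a ha).1)
    (fun _ ha => h.level_prim_le ha) (fun _ ha => h.level_stby_le hη ha) hw

/-- The adjustment that the algorithm would perform upon failure of F is the witness required by
validity. -/
lemma Inv.valid (h : Inv f η s) (hη : 1 < η) (hw : WellAdjusted s.failed s s.cur) :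
    s.toPacking.Valid f η := by
  refine ⟨fun a ha => ⟨h.separated.prim_notMem a ha a ha, h.separated.card_stby a ha⟩,
    fun F hF => ?_⟩
  obtain ⟨cur, hcur⟩ := exists_adjusted h.separated hw hF
  exact ⟨cur, hcur.1, h.served hη hcur.wellAdjusted⟩

lemma level_nonneg (h : Inv f η s) (hη : 1 < η) (b : ℕ) : 0 ≤ level η s b := by
  rw [level, Packing.load]
  refine Finset.sum_nonneg fun a ha => ?_
  have := (h.items.size a (Finset.mem_range.1 ha)).1
  split_ifs <;> positivity

lemma level_eq_zero {b : ℕ} (h : ∀ a < s.n, b ∉ s.holders a) : level η s b = 0 := by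
  rw [level, Packing.load]
  refine Finset.sum_eq_zero fun c hc => ?_
  have hbc := h c (Finset.mem_range.1 hc)
  rw [if_neg hbc, if_neg fun h => hbc (by simp [Packing.holders, h])]

lemma weight_eq_zero {b : ℕ} (h : ∀ a < s.n, b ∉ s.holders a) : weight η s b = 0 := by
  rw [weight, Packing.binSum]
  refine Finset.sum_eq_zero fun c hc => ?_
  have hbc := h c (Finset.mem_range.1 hc)
  rw [if_neg hbc, if_neg fun h => hbc (by simp [Packing.holders, h])]

lemma sharing_eq_empty {β : ℕ} (h : ∀ a < s.n, β ∉ s.stby a) : sharing s β = ∅ := by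
  simp only [sharing, Finset.image_eq_empty, Finset.filter_eq_empty_iff, Finset.mem_range]
  exact fun a ha => h a ha

lemma unitSize_eq_zero {u : ℕ} (h : ∀ a < s.n, s.unit a ≠ u) : unitSize s u = 0 :=
  Finset.sum_eq_zero fun a ha => if_neg (h a (Finset.mem_range.1 ha))

end

section

variable {f : ℕ} {η : ℝ} {s s' : State}

/-! ### Changes of the groups and the bins -/

lemma Group.own_congr {g g' : Group} (hc : g'.cls = g.cls) (hb : g'.base = g.base) :
    g'.own f η = g.own f η := by
  rw [Group.own, Group.own, Group.len, Group.len, hc, hb]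

lemma RegularItem.congr {a k : ℕ} (h : RegularItem f η s a k)
    (hc : (s'.grp k).cls = (s.grp k).cls) (hb : (s'.grp k).base = (s.grp k).base)
    (ht : (s.grp k).count ≤ (s'.grp k).count) (hz : s'.size a = s.size a)
    (hp : s'.prim a = s.prim a) (hs : s'.stby a = s.stby a) (hu : s'.unit a = s.unit a)
    (hus : HS.unitSize s' a = HS.unitSize s a) : RegularItem f η s' a k where
  cls := hc ▸ h.cls
  mul_div_le := by rw [hc, hz]; exact h.mul_div_le
  unit := hu.trans h.unit
  unitSize := by rw [hus, hz, h.unitSize]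
  pos := by
    obtain ⟨t, h1, h2, h3⟩ := h.pos
    exact ⟨t, h1.trans_le ht, by rw [hp, hb, hc, h2], by rw [hs, hb, hc, h3]⟩

lemma SmallItem.congr {a k : ℕ} (h : SmallItem f η s a k)
    (hc : (s'.grp k).cls = (s.grp k).cls) (hb : (s'.grp k).base = (s.grp k).base)
    (hsp : s.smallPrim ⊆ s'.smallPrim)
    (hp : s'.prim a = s.prim a) (hs : s'.stby a = s.stby a) (hu : s'.unit a = s.unit a)
    (hus : HS.unitSize s' (s.unit a) ≤ cap η) : SmallItem f η s' a k where
  cls := hc.trans h.cls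
  prim := by rw [hp]; exact hsp h.prim
  stby := by rw [hs, h.stby, Group.own_congr hc hb]
  unitSize := by rwa [hu]

/-- All replicas lie in bins below `numBins`, so the fresh bins are empty and belong to no other
group. `hcard` leaves room for one more incomplete group. -/
lemma Inv.openFresh (hη : 1 < η) (h : Inv f η s) {c : ℕ × ℕ} (hc : c ∈ classes η)
    (hcard : (incomplete s c).card ≤ f) : Inv f η (openFresh f η s c) := by
  set s' := HS.openFresh f η s c with hs'
  have hold : ∀ k < s.numGroups, s'.grp k = s.grp k :=
    fun k hk => Function.update_of_ne hk.ne _ _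
  have hnew : s'.grp s.numGroups = ⟨c, s.numBins, 0, none, false⟩ := Function.update_self ..
  have hlt : ∀ k, k < s'.numGroups → k < s.numGroups ∨ k = s.numGroups :=
    fun k hk => Nat.lt_succ_iff_lt_or_eq.1 hk
  have hown : (⟨c, s.numBins, 0, none, false⟩ : Group).own f η = Finset.Ico s.numBins s'.numBins :=
    rfl
  have hbins : s.numBins ≤ s'.numBins := Nat.le_add_right _ _
  have hzero : ∀ b, s.numBins ≤ b → ∀ a < s.n, b ∉ s.holders a := fun b hb a ha hba =>
    absurd (h.holders_lt ha b hba) hb.not_gt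
  have hl0 : ∀ b, s.numBins ≤ b → level η s' b = 0 := fun b hb => level_eq_zero (hzero b hb)
  have hw0 : ∀ b, s.numBins ≤ b → weight η s' b = 0 := fun b hb => weight_eq_zero (hzero b hb)
  refine ⟨⟨?_, ?_, ?_, ?_, ?_, ?_, ?_, ?_, ?_, ?_, ?_⟩, ⟨h.2.1, ?_, h.2.3, h.2.4, h.2.5, ?_, ?_⟩,
    ⟨?_, ?_, h.3.3, ?_, ?_, ?_, ?_, ?_, h.3.9⟩⟩
  · intro k hk
    rcases hlt k hk with hk | rfl
    · rw [hold k hk]; exact h.1.1 k hk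
    · rw [hnew]; exact hc
  · intro k hk b
    rcases hlt k hk with hk | rfl
    · rw [hold k hk]; exact fun hb => (h.1.2 k hk b hb).trans_le hbins
    · rw [hnew, hown, Finset.mem_Ico]; exact fun hb => hb.2
  · exact fun b hb => (h.1.3 b hb).trans_le hbins
  · intro k hk k' hk' b
    rcases hlt k hk with hk | rfl <;> rcases hlt k' hk' with hk' | rfl
    · rw [hold k hk, hold k' hk']; exact h.1.4 k hk k' hk' b
    · rw [hold k hk, hnew, hown, Finset.mem_Ico]
      exact fun hb hb' => absurd (h.1.2 k hk b hb) hb'.1.not_gt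
    · rw [hold k' hk', hnew, hown, Finset.mem_Ico]
      exact fun hb' hb => absurd (h.1.2 k' hk' b hb) hb'.1.not_gt
    · exact fun _ _ => rfl
  · intro k hk b
    rcases hlt k hk with hk | rfl
    · rw [hold k hk]; exact h.1.5 k hk b
    · rw [hnew, hown, Finset.mem_Ico]
      exact fun hb hb' => absurd (h.1.3 b hb') hb.1.not_gt
  · intro b hb
    rcases lt_or_ge b s.numBins with hlt | hge
    · rcases h.1.6 b hlt with h' | ⟨k, hk, h'⟩
      · exact Or.inl h'
      · exact Or.inr ⟨k, Nat.lt_succ_of_lt hk, by rwa [hold k hk]⟩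
    · refine Or.inr ⟨s.numGroups, Nat.lt_succ_self _, ?_⟩
      rw [hnew, hown, Finset.mem_Ico]; exact ⟨hge, hb⟩
  · intro k hk b u
    rcases hlt k hk with hk | rfl
    · rw [hold k hk]; exact h.1.7 k hk b u
    · rw [hnew]; simp
  · intro k hk k' hk' b u b' u'
    rcases hlt k hk with hk | rfl <;> rcases hlt k' hk' with hk' | rfl
    · rw [hold k hk, hold k' hk']; exact h.1.8 k hk k' hk' b u b' u'
    · rw [hnew]; simp
    · rw [hnew]; simp
    · rw [hnew]; simp
  · intro k hk
    rcases hlt k hk with hk | rfl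
    · rw [hold k hk]; exact h.1.9 k hk
    · rw [hnew]
      intro hne _
      obtain ⟨h1, -, h2, -⟩ := (HS.mem_classes.1 hc).resolve_left hne
      exact Nat.mul_pos h1 h2
  · intro k hk
    rcases hlt k hk with hk | rfl
    · rw [hold k hk]; exact h.1.10 k hk
    · rw [hnew]; simp
  · intro c'
    by_cases hcc : c' = c
    · subst hcc
      refine (Finset.card_le_card (t := insert s.numGroups (incomplete s c')) ?_).trans
        ((Finset.card_insert_le _ _).trans (by omega))
      intro k hk
      simp only [incomplete, Finset.mem_filter, Finset.mem_range, Finset.mem_insert] at hk ⊢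
      obtain ⟨hk, hk'⟩ := hk
      rcases hlt k hk with hk | rfl
      · rw [hold k hk] at hk'; exact Or.inr ⟨hk, hk'⟩
      · exact Or.inl rfl
    · refine (Finset.card_le_card ?_).trans (h.1.11 c')
      intro k hk
      simp only [incomplete, Finset.mem_filter, Finset.mem_range] at hk ⊢
      obtain ⟨hk, hk'⟩ := hk
      rcases hlt k hk with hk | rfl
      · rw [hold k hk] at hk'; exact ⟨hk, hk'⟩
      · rw [hnew] at hk'; exact absurd hk'.1.symm hcc
  · intro a ha
    obtain ⟨k, hk, hi⟩ := h.2.2 a ha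
    refine ⟨k, Nat.lt_succ_of_lt hk, hi.imp (fun hi => ?_) fun hi => ?_⟩
    · exact hi.congr (by rw [hold k hk]) (by rw [hold k hk]) (by rw [hold k hk]) rfl rfl rfl rfl rfl
    · exact hi.congr (by rw [hold k hk]) (by rw [hold k hk]) subset_rfl rfl rfl rfl hi.unitSize
  · intro k hk b u
    rcases hlt k hk with hk | rfl
    · rw [hold k hk]; exact h.2.6 k hk b u
    · rw [hnew]; simp
  · intro k hk b u
    rcases hlt k hk with hk | rfl
    · rw [hold k hk]; exact h.2.7 k hk b u
    · rw [hnew]; simp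
  · intro k hk
    rcases hlt k hk with hk | rfl
    · rw [hold k hk]; exact h.3.1 k hk
    · rw [hnew]
      intro _ w _
      rw [hl0 _ (Nat.le_add_right _ _), hw0 _ (Nat.le_add_right _ _)]
      simp
  · intro k hk
    rcases hlt k hk with hk | rfl
    · rw [hold k hk]; exact h.3.2 k hk
    · rw [hnew]
      intro _ m _ z _
      have : s.numBins ≤ s.numBins + c.2 + m * c.1 + z := by
        rw [add_assoc, add_assoc]; exact Nat.le_add_right _ _
      rw [hl0 _ this, hw0 _ this]
      simp
  · intro k hk
    rcases hlt k hk with hk | rfl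
    · rw [hold k hk]; exact h.3.4 k hk
    · rw [hnew, hown]
      intro _ β hβ
      rw [Finset.mem_Ico] at hβ
      rw [hl0 _ hβ.1, hw0 _ hβ.1]
      have := cap_le_one hη
      have h' : 0 ≤ cap η / η := div_nonneg (cap_pos hη).le (by linarith)
      exact ⟨by linarith, by simp, fun β' hβ' => (hl0 _ (Finset.mem_Ico.1 hβ').1).symm⟩
  · intro k hk
    rcases hlt k hk with hk | rfl
    · rw [hold k hk]; exact h.3.5 k hk
    · rw [hnew]; simp
  · intro k hk b u
    rcases hlt k hk with hk | rfl
    · rw [hold k hk]; exact h.3.6 k hk b u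
    · rw [hnew]; simp
  · intro k hk b u
    rcases hlt k hk with hk | rfl
    · rw [hold k hk]; exact h.3.7 k hk b u
    · rw [hnew]; simp
  · intro k hk
    rcases hlt k hk with hk | rfl
    · rw [hold k hk]; exact h.3.8 k hk
    · rw [hnew, hown]
      intro _ _ _ β hβ a ha hba
      rw [Finset.mem_Ico] at hβ
      exact hzero β hβ.1 a ha (Finset.mem_insert_of_mem hba)

/-- Open a new primary bin for small items. -/
def addSmallBin (s : State) : State :=
  { s with numBins := s.numBins + 1, smallPrim := insert s.numBins s.smallPrim }

lemma Inv.addSmallBin (h : Inv f η s)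
    (hu : (HS.unfilled η s).card + 1 ≤ maxUnfilled f η) : Inv f η (addSmallBin s) := by
  set s' := HS.addSmallBin s with hs'
  have hzero : ∀ a < s.n, s.numBins ∉ s.holders a := fun a ha hba =>
    absurd (h.holders_lt ha _ hba) (lt_irrefl _)
  have hsp : s'.smallPrim = insert s.numBins s.smallPrim := rfl
  have hl0 : level η s' s.numBins = 0 := level_eq_zero hzero
  have hw0 : weight η s' s.numBins = 0 := weight_eq_zero hzero
  refine ⟨⟨h.1.1, ?_, ?_, h.1.4, ?_, ?_, ?_, h.1.8, h.1.9, h.1.10, h.1.11⟩,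
    ⟨h.2.1, ?_, h.2.3, h.2.4, h.2.5, h.2.6, h.2.7⟩,
    ⟨h.3.1, h.3.2, ?_, h.3.4, h.3.5, h.3.6, h.3.7, h.3.8, ?_⟩⟩
  · exact fun k hk b hb => (h.1.2 k hk b hb).trans (Nat.lt_succ_self _)
  · intro b hb
    rcases Finset.mem_insert.1 hb with rfl | hb
    · exact Nat.lt_succ_self _
    · exact (h.1.3 b hb).trans (Nat.lt_succ_self _)
  · intro k hk b hb hb'
    rcases Finset.mem_insert.1 hb' with rfl | hb'
    · exact lt_irrefl _ (h.1.2 k hk _ hb)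
    · exact h.1.5 k hk b hb hb'
  · intro b hb
    rcases Nat.lt_succ_iff_lt_or_eq.1 hb with hb | rfl
    · exact (h.1.6 b hb).imp_left fun hb => Finset.mem_insert_of_mem hb
    · exact Or.inl (Finset.mem_insert_self _ _)
  · intro k hk b u hbu
    obtain ⟨h1, h2, h3⟩ := h.1.7 k hk b u hbu
    exact ⟨h1, h2, Finset.mem_insert_of_mem h3⟩
  · intro a ha
    obtain ⟨k, hk, hi⟩ := h.2.2 a ha
    refine ⟨k, hk, hi.imp (fun hi => ?_) fun hi => ?_⟩
    · exact hi.congr rfl rfl le_rfl rfl rfl rfl rfl rfl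
    · exact hi.congr rfl rfl (Finset.subset_insert _ _) rfl rfl rfl hi.unitSize
  · intro b hb
    rcases Finset.mem_insert.1 hb with rfl | hb
    · rw [hl0, hw0]; simp
    · exact h.3.3 b hb
  · refine le_trans ?_ hu
    refine le_trans (Finset.card_le_card (t := insert s.numBins (HS.unfilled η s)) ?_)
      (Finset.card_insert_le _ _)
    intro b hb
    simp only [HS.unfilled, Finset.mem_filter, Finset.mem_insert] at hb ⊢
    obtain ⟨hb, hb'⟩ := hb
    rcases Finset.mem_insert.1 hb with rfl | hb
    · exact Or.inl rfl
    · exact Or.inr ⟨hb, hb'⟩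

/-- The open super-replica of a group is more than half full, if there is one. -/
def HalfFull (η : ℝ) (s : State) (g : Group) : Prop :=
  ∀ b u, g.sr = some (b, u) → cap η / 2 < unitSize s u

/-- This describes an intermediate state in which the new super-replica, named `s.n`, is still
empty; no item has this unit because units are named by earlier items. `Inv.join` then adds the
first item. -/
lemma Inv.commit (hη : 1 < η) (h : Inv f η s) {k : ℕ} (hk : k < s.numGroups)
    (hc : (s.grp k).cls = small η) (hcpl : (s.grp k).complete = false)
    (hsr : ∀ k' < s.numGroups, ∀ b u, (s.grp k').sr = some (b, u) → u < s.n)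
    (hhalf : HalfFull η s (s.grp k))
    (hroom : ∀ β ∈ (s.grp k).own f η, level η s β ≤ 1 - cap η) {b : ℕ} (hb : b ∈ s.smallPrim)
    (hbl : level η s b ≤ 1 - cap η)
    (hbc : ∀ k' < s.numGroups, k' ≠ k → ∀ u, (s.grp k').sr ≠ some (b, u))
    (hbs : ∀ β ∈ (s.grp k).own f η, ∀ a < s.n, s.prim a = b → β ∉ s.stby a) :
    Inv f η (setGroup k { s.grp k with sr := some (b, s.n) } s) := by
  set s' := setGroup k { s.grp k with sr := some (b, s.n) } s with hs'
  have hgrp : ∀ k', s'.grp k' = if k' = k then { s.grp k with sr := some (b, s.n) } else s.grp k' :=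
    fun k' => by simp [hs', setGroup, Function.update_apply]
  have hcls : ∀ k', (s'.grp k').cls = (s.grp k').cls := fun k' => by
    rw [hgrp]; split_ifs with e <;> simp [e]
  have hbase : ∀ k', (s'.grp k').base = (s.grp k').base := fun k' => by
    rw [hgrp]; split_ifs with e <;> simp [e]
  have hcount : ∀ k', (s'.grp k').count = (s.grp k').count := fun k' => by
    rw [hgrp]; split_ifs with e <;> simp [e]
  have hcomp : ∀ k', (s'.grp k').complete = (s.grp k').complete := fun k' => by
    rw [hgrp]; split_ifs with e <;> simp [e]
  have hown : ∀ k', (s'.grp k').own f η = (s.grp k').own f η := fun k' =>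
    Group.own_congr (hcls k') (hbase k')
  have hsrk : ∀ k' b' u', (s'.grp k').sr = some (b', u') →
      (k' = k ∧ b' = b ∧ u' = s.n) ∨ (k' ≠ k ∧ (s.grp k').sr = some (b', u')) := by
    intro k' b' u' h'
    rw [hgrp] at h'
    split_ifs at h' with e
    · simp only [Option.some.injEq, Prod.mk.injEq] at h'
      exact Or.inl ⟨e, h'.1.symm, h'.2.symm⟩
    · exact Or.inr ⟨e, h'⟩
  have hu0 : unitSize s' s.n = 0 := unitSize_eq_zero fun a ha => (h.2.3 a ha).ne
  have hcap := cap_pos hη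
  have hcap' : 0 < cap η / η := div_pos hcap (by linarith)
  have hl : ∀ b, level η s' b = level η s b := fun _ => rfl
  refine ⟨⟨?_, ?_, h.1.3, ?_, ?_, ?_, ?_, ?_, ?_, ?_, ?_⟩,
    ⟨h.2.1, ?_, h.2.3, h.2.4, h.2.5, ?_, ?_⟩,
    ⟨?_, ?_, h.3.3, ?_, ?_, ?_, ?_, ?_, h.3.9⟩⟩
  · intro k' hk'; rw [hcls]; exact h.1.1 k' hk'
  · intro k' hk'; rw [hown]; exact h.1.2 k' hk'
  · intro k' hk' k'' hk''; rw [hown, hown]; exact h.1.4 k' hk' k'' hk''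
  · intro k' hk'; rw [hown]; exact h.1.5 k' hk'
  · intro b hb
    refine (h.1.6 b hb).imp_right fun ⟨k', hk', h'⟩ => ⟨k', hk', ?_⟩
    rwa [hown]
  · intro k' hk' b' u' h'
    rw [hcls, hcomp]
    rcases hsrk k' b' u' h' with ⟨rfl, rfl, rfl⟩ | ⟨-, h'⟩
    · exact ⟨hc, hcpl, hb⟩
    · exact h.1.7 k' hk' b' u' h'
  · intro k₁ hk₁ k₂ hk₂ b₁ u₁ b₂ u₂ h₁ h₂ he
    rcases hsrk _ _ _ h₁ with ⟨rfl, rfl, rfl⟩ | ⟨e₁, g₁⟩ <;>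
      rcases hsrk _ _ _ h₂ with ⟨rfl, rfl, rfl⟩ | ⟨e₂, g₂⟩
    · rfl
    · rcases he with rfl | rfl
      · exact absurd g₂ (hbc _ hk₂ e₂ _)
      · exact absurd (hsr _ hk₂ _ _ g₂) (lt_irrefl _)
    · rcases he with rfl | rfl
      · exact absurd g₁ (hbc _ hk₁ e₁ _)
      · exact absurd (hsr _ hk₁ _ _ g₁) (lt_irrefl _)
    · exact h.1.8 _ hk₁ _ hk₂ _ _ _ _ g₁ g₂ he
  · intro k' hk'; rw [hcls, hcomp, hcount]; exact h.1.9 k' hk'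
  · intro k' hk'; rw [hcls, hcomp, hcount]; exact h.1.10 k' hk'
  · intro c
    have : incomplete s' c = incomplete s c := by simp only [incomplete, hcls, hcomp]; rfl
    rw [this]; exact h.1.11 c
  · intro a ha
    obtain ⟨k', hk', hi⟩ := h.2.2 a ha
    refine ⟨k', hk', hi.imp (fun hi => ?_) fun hi => ?_⟩
    · exact hi.congr (hcls _) (hbase _) (hcount _).ge rfl rfl rfl rfl rfl
    · exact hi.congr (hcls _) (hbase _) subset_rfl rfl rfl rfl hi.unitSize
  · intro k' hk' b' u' h' a ha hau
    rw [hown]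
    rcases hsrk _ _ _ h' with ⟨rfl, rfl, rfl⟩ | ⟨e, h'⟩
    · exact absurd hau (h.2.3 a ha).ne
    · exact h.2.6 k' hk' b' u' h' a ha hau
  · intro k' hk' b' u' h' a ha hab β hβ hβa
    rw [hown] at hβ
    rcases hsrk _ _ _ h' with ⟨rfl, rfl, rfl⟩ | ⟨e, h'⟩
    · exact absurd hβa (hbs β hβ a ha hab)
    · exact h.2.7 k' hk' b' u' h' a ha hab β hβ hβa
  · intro k' hk'; rw [hcls, hcount, hbase]; exact h.3.1 k' hk'
  · intro k' hk'; rw [hcls, hcount, hbase]; exact h.3.2 k' hk'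
  · intro k' hk'; rw [hcls, hown]; exact h.3.4 k' hk'
  · intro k' hk'; rw [hcls, hown, hcomp]; exact h.3.5 k' hk'
  · intro k' hk' b' u' h'
    rcases hsrk _ _ _ h' with ⟨rfl, rfl, rfl⟩ | ⟨e, h'⟩
    · rw [hu0, hl]; linarith
    · exact h.3.6 k' hk' b' u' h'
  · intro k' hk' b' u' h' β hβ
    rw [hown] at hβ
    rcases hsrk _ _ _ h' with ⟨rfl, rfl, rfl⟩ | ⟨e, h'⟩
    · rw [hu0, hl]
      refine ⟨by have := hroom β hβ; simpa using this, ?_⟩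
      rw [zero_div, add_zero]
      change (((sharing s β).erase b').card : ℝ) * _ ≤ _
      cases hs0 : (s.grp k').sr with
      | none =>
        rw [sharing_eq_empty (h.3.8 k' hk hc hcpl hs0 β hβ)]
        simpa using level_nonneg h hη β
      | some p =>
        obtain ⟨b₀, u₀⟩ := p
        have h1 := (h.3.7 k' hk b₀ u₀ hs0 β hβ).2
        have h2 : cap η / 2 / η < unitSize s u₀ / η :=
          div_lt_div_of_pos_right (hhalf b₀ u₀ hs0) (by linarith)
        -- The previously committed bin `b₀` may now count as a sharing bin; its super-replica,
        -- being more than half full, pays for it.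
        have h3 : ((sharing s β).erase b').card ≤ ((sharing s β).erase b₀).card + 1 := by
          have e1 := Finset.card_le_card (Finset.erase_subset b' (sharing s β))
          have e2 := Finset.pred_card_le_card_erase (s := sharing s β) (a := b₀)
          omega
        have h4 : (((sharing s β).erase b').card : ℝ) ≤ ((sharing s β).erase b₀).card + 1 := by
          exact_mod_cast h3
        have h5 : cap η / 2 / η = cap η / η / 2 := by ring
        nlinarith
    · exact h.3.7 k' hk' b' u' h' β hβ
  · intro k' hk' h1 h2 h3
    rw [hcls] at h1
    rw [hcomp] at h2
    rw [hown]
    rw [hgrp] at h3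
    split_ifs at h3
    exact h.3.8 k' hk' h1 h2 h3

lemma Inv.completeSmall (h : Inv f η s) {k : ℕ} (hk : k < s.numGroups)
    (hc : (s.grp k).cls = small η) (hroom : ∀ β ∈ (s.grp k).own f η, 1 - cap η ≤ level η s β) :
    Inv f η (setGroup k { s.grp k with sr := none, complete := true } s) := by
  set s' := setGroup k { s.grp k with sr := none, complete := true } s with hs'
  have hgrp : ∀ k', s'.grp k' =
      if k' = k then { s.grp k with sr := none, complete := true } else s.grp k' :=
    fun k' => by simp [hs', setGroup, Function.update_apply]
  have hcls : ∀ k', (s'.grp k').cls = (s.grp k').cls := fun k' => by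
    rw [hgrp]; split_ifs with e <;> simp [e]
  have hbase : ∀ k', (s'.grp k').base = (s.grp k').base := fun k' => by
    rw [hgrp]; split_ifs with e <;> simp [e]
  have hcount : ∀ k', (s'.grp k').count = (s.grp k').count := fun k' => by
    rw [hgrp]; split_ifs with e <;> simp [e]
  have hcomp : ∀ k', k' ≠ k → (s'.grp k').complete = (s.grp k').complete := fun k' e => by
    rw [hgrp, if_neg e]
  have hown : ∀ k', (s'.grp k').own f η = (s.grp k').own f η := fun k' =>
    Group.own_congr (hcls k') (hbase k')
  have hsrk : ∀ k' b' u', (s'.grp k').sr = some (b', u') →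
      k' ≠ k ∧ (s.grp k').sr = some (b', u') := by
    intro k' b' u' h'
    rw [hgrp] at h'
    split_ifs at h' with e
    exact ⟨e, h'⟩
  refine ⟨⟨?_, ?_, h.1.3, ?_, ?_, ?_, ?_, ?_, ?_, ?_, ?_⟩,
    ⟨h.2.1, ?_, h.2.3, h.2.4, h.2.5, ?_, ?_⟩,
    ⟨?_, ?_, h.3.3, ?_, ?_, ?_, ?_, ?_, h.3.9⟩⟩
  · intro k' hk'; rw [hcls]; exact h.1.1 k' hk'
  · intro k' hk'; rw [hown]; exact h.1.2 k' hk'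
  · intro k' hk' k'' hk''; rw [hown, hown]; exact h.1.4 k' hk' k'' hk''
  · intro k' hk'; rw [hown]; exact h.1.5 k' hk'
  · intro b hb
    refine (h.1.6 b hb).imp_right fun ⟨k', hk', h'⟩ => ⟨k', hk', ?_⟩
    rwa [hown]
  · intro k' hk' b' u' h'
    obtain ⟨e, h'⟩ := hsrk k' b' u' h'
    rw [hcls, hcomp _ e]
    exact h.1.7 k' hk' b' u' h'
  · intro k₁ hk₁ k₂ hk₂ b₁ u₁ b₂ u₂ h₁ h₂
    exact h.1.8 _ hk₁ _ hk₂ _ _ _ _ (hsrk _ _ _ h₁).2 (hsrk _ _ _ h₂).2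
  · intro k' hk'
    rw [hcls, hcount]
    intro hne hcm
    have e : k' ≠ k := by rintro rfl; exact hne hc
    rw [hcomp _ e] at hcm
    exact h.1.9 k' hk' hne hcm
  · intro k' hk'
    rw [hcls, hcount]
    intro hne hcm
    have e : k' ≠ k := by rintro rfl; exact hne hc
    rw [hcomp _ e] at hcm
    exact h.1.10 k' hk' hne hcm
  · intro c
    refine (Finset.card_le_card fun k' hk' => ?_).trans (h.1.11 c)
    simp only [incomplete, Finset.mem_filter, Finset.mem_range] at hk' ⊢
    have e : k' ≠ k := by
      rintro rfl
      rw [hgrp, if_pos rfl] at hk'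
      simp at hk'
    rw [hcls, hcomp _ e] at hk'
    exact hk'
  · intro a ha
    obtain ⟨k', hk', hi⟩ := h.2.2 a ha
    refine ⟨k', hk', hi.imp (fun hi => ?_) fun hi => ?_⟩
    · exact hi.congr (hcls _) (hbase _) (hcount _).ge rfl rfl rfl rfl rfl
    · exact hi.congr (hcls _) (hbase _) subset_rfl rfl rfl rfl hi.unitSize
  · intro k' hk' b' u' h'
    rw [hown]
    exact h.2.6 k' hk' b' u' (hsrk _ _ _ h').2
  · intro k' hk' b' u' h'
    rw [hown]
    exact h.2.7 k' hk' b' u' (hsrk _ _ _ h').2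
  · intro k' hk'; rw [hcls, hcount, hbase]; exact h.3.1 k' hk'
  · intro k' hk'; rw [hcls, hcount, hbase]; exact h.3.2 k' hk'
  · intro k' hk'; rw [hcls, hown]; exact h.3.4 k' hk'
  · intro k' hk' h1 h2
    rw [hcls] at h1
    rw [hown]
    by_cases e : k' = k
    · subst e; exact hroom
    · rw [hcomp _ e] at h2; exact h.3.5 k' hk' h1 h2
  · intro k' hk' b' u' h'
    exact h.3.6 k' hk' b' u' (hsrk _ _ _ h').2
  · intro k' hk' b' u' h'
    rw [hown]
    exact h.3.7 k' hk' b' u' (hsrk _ _ _ h').2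
  · intro k' hk' h1 h2 h3
    have e : k' ≠ k := by
      rintro rfl
      rw [hgrp, if_pos rfl] at h2
      simp at h2
    rw [hcls] at h1
    rw [hcomp _ e] at h2
    rw [hown]
    rw [hgrp, if_neg e] at h3
    exact h.3.8 k' hk' h1 h2 h3

end

section

variable {f : ℕ} {η : ℝ} {s : State}

/-! ### Placing items -/

/-- Levels and weights are both bin sums, so one computation serves for both. -/
lemma binSum_place (φ ψ : ℝ → ℝ) (x : ℝ) (b : ℕ) (S : Finset ℕ) (u : ℕ) (s : State) (c : ℕ) :
    (place x b S u s).binSum φ ψ c =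
      s.binSum φ ψ c + if c = b then φ x else if c ∈ S then ψ x else 0 := by
  have hn : (place x b S u s).n = s.n + 1 := rfl
  rw [Packing.binSum, Packing.binSum, hn, Finset.sum_range_succ]
  congr 1
  · refine Finset.sum_congr rfl fun a ha => ?_
    have hne := (Finset.mem_range.1 ha).ne
    simp only [place, Packing.holders, Function.update_of_ne hne]
    rfl
  · simp only [place, Packing.holders, Function.update_self]
    by_cases hc : c = b <;> simp [hc]

lemma level_place (η x : ℝ) (b : ℕ) (S : Finset ℕ) (u : ℕ) (s : State) (c : ℕ) :
    level η (place x b S u s) c =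
      level η s c + if c = b then x else if c ∈ S then x / η else 0 :=
  binSum_place (fun x => x) (fun x => x / η) x b S u s c

lemma weight_place (η x : ℝ) (b : ℕ) (S : Finset ℕ) (u : ℕ) (s : State) (c : ℕ) :
    weight η (place x b S u s) c = weight η s c +
      if c = b then primWeight η x else if c ∈ S then stbyWeight η (x / η) else 0 :=
  binSum_place _ _ x b S u s c

lemma unitSize_place (x : ℝ) (b : ℕ) (S : Finset ℕ) (u : ℕ) (s : State) (v : ℕ) :
    unitSize (place x b S u s) v = unitSize s v + if u = v then x else 0 := by
  have hn : (place x b S u s).n = s.n + 1 := rfl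
  rw [unitSize, unitSize, hn, Finset.sum_range_succ]
  congr 1
  · refine Finset.sum_congr rfl fun a ha => ?_
    have hne := (Finset.mem_range.1 ha).ne
    simp only [place, Function.update_of_ne hne]
  · simp only [place, Function.update_self]

lemma mem_sharing {β b : ℕ} : b ∈ sharing s β ↔ ∃ a < s.n, β ∈ s.stby a ∧ s.prim a = b := by
  simp only [sharing, Finset.mem_image, Finset.mem_filter, Finset.mem_range]
  constructor
  · rintro ⟨a, ⟨h1, h2⟩, h3⟩; exact ⟨a, h1, h2, h3⟩
  · rintro ⟨a, h1, h2, h3⟩; exact ⟨a, ⟨h1, h2⟩, h3⟩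

lemma place_old {x : ℝ} {b u : ℕ} {S : Finset ℕ} {a : ℕ} (ha : a < s.n) :
    (place x b S u s).size a = s.size a ∧ (place x b S u s).prim a = s.prim a ∧
      (place x b S u s).stby a = s.stby a ∧ (place x b S u s).unit a = s.unit a ∧
      (place x b S u s).cur a = s.cur a := by
  simp only [place, Function.update_of_ne ha.ne, and_self]

lemma place_new {x : ℝ} {b u : ℕ} {S : Finset ℕ} :
    (place x b S u s).size s.n = x ∧ (place x b S u s).prim s.n = b ∧
      (place x b S u s).stby s.n = S ∧ (place x b S u s).unit s.n = u ∧
      (place x b S u s).cur s.n = b := by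
  simp only [place, Function.update_self, and_self]

lemma sharing_place_subset (x : ℝ) (b : ℕ) (S : Finset ℕ) (u : ℕ) (s : State) (β : ℕ) :
    sharing (place x b S u s) β ⊆ insert b (sharing s β) := by
  intro c hc
  obtain ⟨a, ha, h1, h2⟩ := mem_sharing.1 hc
  rcases Nat.lt_succ_iff_lt_or_eq.1 ha with ha | rfl
  · obtain ⟨-, e1, e2, -⟩ := place_old (x := x) (b := b) (u := u) (S := S) ha
    rw [e1] at h2
    rw [e2] at h1
    exact Finset.mem_insert_of_mem (mem_sharing.2 ⟨a, ha, h1, h2⟩)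
  · rw [place_new.2.1] at h2
    exact h2 ▸ Finset.mem_insert_self _ _

lemma sharing_place_of_notMem (x : ℝ) (b : ℕ) {S : Finset ℕ} (u : ℕ) (s : State) {β : ℕ}
    (hβ : β ∉ S) : sharing (place x b S u s) β ⊆ sharing s β := by
  intro c hc
  obtain ⟨a, ha, h1, h2⟩ := mem_sharing.1 hc
  rcases Nat.lt_succ_iff_lt_or_eq.1 ha with ha | rfl
  · obtain ⟨-, e1, e2, -⟩ := place_old (x := x) (b := b) (u := u) (S := S) ha
    rw [e1] at h2
    rw [e2] at h1
    exact mem_sharing.2 ⟨a, ha, h1, h2⟩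
  · rw [place_new.2.2.1] at h1
    exact absurd h1 hβ

lemma unfilled_place_subset {x : ℝ} (hx : 0 < x) (hη : 1 < η) (b : ℕ) (S : Finset ℕ) (u : ℕ)
    (s : State) : unfilled η (place x b S u s) ⊆ unfilled η s := by
  intro c hc
  simp only [unfilled, Finset.mem_filter] at hc ⊢
  refine ⟨hc.1, le_trans ?_ hc.2⟩
  rw [level_place]
  apply le_add_of_nonneg_right
  split_ifs <;> positivity

/-- The reserved capacity in `sr_prim` and `sr_stby` absorbs the item, and every bin that receives a
replica gains weight equal to the density times the gain in level. The case u = s.n allowed by `hu`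
is that of a super-replica just opened by `Inv.commit`. -/
lemma Inv.join (hη : 1 < η) (h : Inv f η s) {k : ℕ} (hk : k < s.numGroups) {b u : ℕ}
    (hsr : (s.grp k).sr = some (b, u)) (hu : u ≤ s.n) {x : ℝ} (hx : 0 < x)
    (hxc : x ≤ cap η / 2) (hfit : unitSize s u + x ≤ cap η) :
    Inv f η (place x b ((s.grp k).own f η) u s) := by
  set s' := place x b ((s.grp k).own f η) u s with hs'
  obtain ⟨hc, hcpl, hbsp⟩ := h.1.7 k hk b u hsr
  have hη0 : 0 < η := by linarith
  have hlt : ∀ a, a < s'.n → a < s.n ∨ a = s.n := fun a ha => Nat.lt_succ_iff_lt_or_eq.1 ha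
  have hsz : ∀ a < s.n, s'.size a = s.size a := fun a ha => (place_old ha).1
  have hpr : ∀ a < s.n, s'.prim a = s.prim a := fun a ha => (place_old ha).2.1
  have hst : ∀ a < s.n, s'.stby a = s.stby a := fun a ha => (place_old ha).2.2.1
  have hun : ∀ a < s.n, s'.unit a = s.unit a := fun a ha => (place_old ha).2.2.2.1
  have hszn : s'.size s.n = x := place_new.1
  have hprn : s'.prim s.n = b := place_new.2.1
  have hstn : s'.stby s.n = (s.grp k).own f η := place_new.2.2.1
  have hunn : s'.unit s.n = u := place_new.2.2.2.1
  have hus := unitSize_place x b ((s.grp k).own f η) u s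
  have hlev := level_place η x b ((s.grp k).own f η) u s
  have hwt := weight_place η x b ((s.grp k).own f η) u s
  rw [← hs'] at hus hlev hwt
  -- bins that receive no replica
  have hlev' : ∀ c, c ≠ b → c ∉ (s.grp k).own f η → level η s' c = level η s c :=
    fun c h1 h2 => by rw [hlev, if_neg h1, if_neg h2, add_zero]
  have hwt' : ∀ c, c ≠ b → c ∉ (s.grp k).own f η → weight η s' c = weight η s c :=
    fun c h1 h2 => by rw [hwt, if_neg h1, if_neg h2, add_zero]
  have hown_ne : ∀ k' < s.numGroups, ∀ c ∈ (s.grp k').own f η, c ≠ b :=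
    fun k' hk' c hcm e => h.1.5 k' hk' c hcm (e ▸ hbsp)
  have hown_other : ∀ k' < s.numGroups, k' ≠ k → ∀ c ∈ (s.grp k').own f η,
      c ∉ (s.grp k).own f η := fun k' hk' e c hcm hcm' => e (h.1.4 k' hk' k hk c hcm hcm')
  have hsp_own : ∀ c ∈ s.smallPrim, c ∉ (s.grp k).own f η := fun c hcs hcm => h.1.5 k hk c hcm hcs
  have hw1 := primWeight_of_le_cap hη hxc
  have hw2 := stbyWeight_of_le_cap hη hxc
  have hxη : 0 < x / η := div_pos hx hη0
  refine ⟨⟨h.1.1, h.1.2, h.1.3, h.1.4, h.1.5, h.1.6, h.1.7, h.1.8, h.1.9, h.1.10, h.1.11⟩,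
    ⟨?_, ?_, ?_, ?_, ?_, ?_, ?_⟩, ⟨?_, ?_, ?_, ?_, ?_, ?_, ?_, ?_, ?_⟩⟩
  · intro a ha
    rcases hlt a ha with ha | rfl
    · rw [hsz a ha]; exact h.2.1 a ha
    · rw [hszn]
      have := cap_le_one hη
      exact ⟨hx, by linarith⟩
  · intro a ha
    rcases hlt a ha with ha | rfl
    · obtain ⟨k', hk', hi⟩ := h.2.2 a ha
      refine ⟨k', hk', hi.imp (fun hi => ?_) fun hi => ?_⟩
      · refine hi.congr rfl rfl le_rfl (hsz a ha) (hpr a ha) (hst a ha) (hun a ha) ?_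
        rw [hus, if_neg, add_zero]
        rintro rfl
        -- A regular item is not in the open unit, since its primary bin would be the committed bin
        -- for small items.
        have := (h.2.6 k hk b u hsr u ha hi.unit).1
        exact hown_ne k' hk' _ (hi.prim_mem h.1 hk') this
      · refine hi.congr rfl rfl subset_rfl (hpr a ha) (hst a ha) (hun a ha) ?_
        rw [hus]
        split_ifs with e
        · rw [← e]; exact hfit
        · rw [add_zero]; exact hi.unitSize
    · exact ⟨k, hk, Or.inr ⟨hc, hprn ▸ hbsp, hstn, by rw [hunn, hus, if_pos rfl]; exact hfit⟩⟩
  · intro a ha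
    rcases hlt a ha with ha | rfl
    · rw [hun a ha]; exact (h.2.3 a ha).trans (Nat.lt_succ_self _)
    · rw [hunn]; exact Nat.lt_succ_of_le hu
  · intro a ha c hc'
    rcases hlt a ha with ha | rfl <;> rcases hlt c hc' with hc' | rfl
    · rw [hun a ha, hun c hc', hpr a ha, hpr c hc', hst a ha, hst c hc']
      exact h.2.4 a ha c hc'
    · rw [hun a ha, hpr a ha, hst a ha, hunn, hprn, hstn]
      exact h.2.6 k hk b u hsr a ha
    · rw [hun c hc', hpr c hc', hst c hc', hunn, hprn, hstn]
      intro e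
      have := h.2.6 k hk b u hsr c hc' e.symm
      exact ⟨this.1.symm, this.2.symm⟩
    · exact fun _ => ⟨rfl, rfl⟩
  · intro a ha c hc' β
    rcases hlt a ha with ha | rfl <;> rcases hlt c hc' with hc' | rfl
    · rw [hun a ha, hun c hc', hpr a ha, hpr c hc', hst a ha, hst c hc']
      exact h.2.5 a ha c hc' β
    · rw [hun a ha, hpr a ha, hst a ha, hunn, hprn, hstn]
      exact fun h1 h2 h3 => h.2.7 k hk b u hsr a ha h3 β h2 h1
    · rw [hun c hc', hpr c hc', hst c hc', hunn, hprn, hstn]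
      exact fun h1 h2 h3 => (h.2.7 k hk b u hsr c hc' h3.symm β h1 h2).symm
    · exact fun _ _ _ => rfl
  · intro k' hk' b' u' h' a ha
    rcases hlt a ha with ha | rfl
    · rw [hun a ha, hpr a ha, hst a ha]
      exact h.2.6 k' hk' b' u' h' a ha
    · rw [hunn, hprn, hstn]
      rintro rfl
      have e := h.1.8 k hk k' hk' _ _ _ _ hsr h' (Or.inr rfl)
      subst e
      rw [show (s'.grp k).sr = (s.grp k).sr from rfl, hsr] at h'
      simp only [Option.some.injEq, Prod.mk.injEq, and_true] at h'
      exact ⟨h', rfl⟩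
  · intro k' hk' b' u' h' a ha
    rcases hlt a ha with ha | rfl
    · rw [hun a ha, hpr a ha, hst a ha]
      exact h.2.7 k' hk' b' u' h' a ha
    · rw [hunn, hprn, hstn]
      rintro rfl β - -
      have e := h.1.8 k hk k' hk' _ _ _ _ hsr h' (Or.inl rfl)
      subst e
      rw [show (s'.grp k).sr = (s.grp k).sr from rfl, hsr] at h'
      simpa using h'
  · intro k' hk' hne w hw
    have hm := Group.prim_mem_own (f := f) hne hw
    have e : k' ≠ k := by rintro rfl; exact hne hc
    rw [show s'.grp k' = s.grp k' from rfl] at *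
    rw [hlev' _ (hown_ne k' hk' _ hm) (hown_other k' hk' e _ hm),
      hwt' _ (hown_ne k' hk' _ hm) (hown_other k' hk' e _ hm)]
    exact h.3.1 k' hk' hne w hw
  · intro k' hk' hne m hmf z hz
    have hm := Group.stby_mem_own hne hmf hz
    have e : k' ≠ k := by rintro rfl; exact hne hc
    rw [show s'.grp k' = s.grp k' from rfl] at *
    rw [hlev' _ (hown_ne k' hk' _ hm) (hown_other k' hk' e _ hm),
      hwt' _ (hown_ne k' hk' _ hm) (hown_other k' hk' e _ hm)]
    exact h.3.2 k' hk' hne m hmf z hz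
  · intro c hcs
    obtain ⟨h1, h2⟩ := h.3.3 c hcs
    by_cases e : c = b
    · subst e
      rw [hlev, hwt, if_pos rfl, if_pos rfl, hw1]
      have := h.3.6 k hk c u hsr
      exact ⟨by linarith, by linarith⟩
    · rw [hlev' c e (hsp_own c hcs), hwt' c e (hsp_own c hcs)]
      exact ⟨h1, h2⟩
  · intro k' hk' hc' β hβ
    obtain ⟨h1, h2, h3⟩ := h.3.4 k' hk' hc' β hβ
    by_cases e : k' = k
    · subst e
      have hall : ∀ c ∈ (s.grp k').own f η, level η s' c = level η s c + x / η := fun c hcm => by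
        rw [hlev, if_neg (hown_ne k' hk' c hcm), if_pos hcm]
      rw [hall β hβ, hwt, if_neg (hown_ne k' hk' β hβ),
        if_pos (show β ∈ (s.grp k').own f η from hβ), hw2]
      refine ⟨?_, by linarith, fun β' hβ' => by rw [hall β' hβ', h3 β' hβ']⟩
      have h4 := (h.3.7 k' hk b u hsr β hβ).1
      have h5 : (unitSize s u + x) / η ≤ cap η / η := by gcongr
      rw [add_div] at h5
      linarith
    · have hall : ∀ c ∈ (s.grp k').own f η, level η s' c = level η s c := fun c hcm =>
        hlev' c (hown_ne k' hk' c hcm) (hown_other k' hk' e c hcm)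
      rw [hall β hβ, hwt' β (hown_ne k' hk' β hβ) (hown_other k' hk' e β hβ)]
      exact ⟨h1, h2, fun β' hβ' => by rw [hall β' hβ', h3 β' hβ']⟩
  · intro k' hk' hc' hcp β hβ
    refine (h.3.5 k' hk' hc' hcp β hβ).trans ?_
    rw [hlev]
    apply le_add_of_nonneg_right
    split_ifs <;> linarith
  · intro k' hk' b' u' h'
    have h1 := h.3.6 k' hk' b' u' h'
    by_cases e : k' = k
    · subst e
      rw [show (s'.grp k').sr = (s.grp k').sr from rfl, hsr] at h'
      simp only [Option.some.injEq, Prod.mk.injEq] at h'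
      obtain ⟨rfl, rfl⟩ := h'
      rw [hlev, hus, if_pos rfl, if_pos rfl]
      linarith
    · have hb' : b' ≠ b := fun e' => e (h.1.8 k' hk' k hk _ _ _ _ h' hsr (Or.inl e'))
      have hu' : u ≠ u' := fun e' => e (h.1.8 k' hk' k hk _ _ _ _ h' hsr (Or.inr e'.symm))
      rw [hlev' b' hb' (hsp_own _ (h.1.7 k' hk' b' u' h').2.2), hus, if_neg hu', add_zero]
      exact h1
  · intro k' hk' b' u' h' β hβ
    have h1 := h.3.7 k' hk' b' u' h' β hβ
    by_cases e : k' = k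
    · subst e
      rw [show (s'.grp k').sr = (s.grp k').sr from rfl, hsr] at h'
      simp only [Option.some.injEq, Prod.mk.injEq] at h'
      obtain ⟨rfl, rfl⟩ := h'
      -- The only bin that may newly share an item with β is the committed bin, which is not
      -- counted.
      have h2 : ((sharing s' β).erase b).card ≤ ((sharing s β).erase b).card := by
        apply Finset.card_le_card
        intro c hcm
        rw [Finset.mem_erase] at hcm ⊢
        have := sharing_place_subset x b ((s.grp k').own f η) u s β hcm.2
        exact ⟨hcm.1, (Finset.mem_insert.1 this).resolve_left hcm.1⟩
      have h3 : (((sharing s' β).erase b).card : ℝ) ≤ ((sharing s β).erase b).card := by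
        exact_mod_cast h2
      have h4 : 0 < cap η / η / 2 := by have := cap_pos hη; positivity
      have h5 := mul_le_mul_of_nonneg_right h3 h4.le
      have hβ2 : β ∈ (s.grp k').own f η := hβ
      rw [hlev, if_neg (hown_ne k' hk' β hβ), if_pos hβ2, hus, if_pos rfl, add_div]
      exact ⟨by linarith, by linarith⟩
    · have hu' : u ≠ u' := fun e' => e (h.1.8 k' hk' k hk _ _ _ _ h' hsr (Or.inr e'.symm))
      have hβ' := hown_other k' hk' e β hβ
      have h2 : ((sharing s' β).erase b').card ≤ ((sharing s β).erase b').card :=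
        Finset.card_le_card (Finset.erase_subset_erase _ (sharing_place_of_notMem x b u s hβ'))
      have h3 : (((sharing s' β).erase b').card : ℝ) ≤ ((sharing s β).erase b').card := by
        exact_mod_cast h2
      have h4 : 0 < cap η / η / 2 := by have := cap_pos hη; positivity
      have h5 := mul_le_mul_of_nonneg_right h3 h4.le
      rw [hlev' β (hown_ne k' hk' β hβ) hβ', hus, if_neg hu', add_zero]
      exact ⟨h1.1, by linarith [h1.2]⟩
  · intro k' hk' hc' hcp hno β hβ a ha
    have e : k' ≠ k := by
      rintro rfl
      rw [show (s'.grp k').sr = (s.grp k').sr from rfl, hsr] at hno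
      simp at hno
    rcases hlt a ha with ha | rfl
    · rw [hst a ha]; exact h.3.8 k' hk' hc' hcp hno β hβ a ha
    · rw [hstn]; exact hown_other k' hk' e β hβ
  · exact (Finset.card_le_card (unfilled_place_subset hx hη _ _ _ _)).trans h.3.9

end

/-! ### Placing a regular item. -/

section

variable {f : ℕ} {η : ℝ} {s : State}

/-- The standby bins of the item number `t` of a regular group. -/
def Group.stbyBins (f : ℕ) (g : Group) (t : ℕ) : Finset ℕ :=
  (Finset.range f).image fun m => g.base + g.cls.2 + m * g.cls.1 + t / g.cls.2

/-- The flag `cpl` treats an unfinished and a just completed group together. In the bins that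
receive the item, the relevant `Nat.count` grows by 1, the scaled level by at most 1 and the scaled
weight by exactly 1. `hsr` ensures that the new unit name `s.n` is not that of an open
super-replica. -/
lemma Inv.placeRegular (hη : 1 < η) (h : Inv f η s) {k : ℕ} (hk : k < s.numGroups)
    (hcpl : (s.grp k).complete = false)
    (hsr : ∀ k' < s.numGroups, ∀ b u, (s.grp k').sr = some (b, u) → u < s.n)
    {x : ℝ} (hx : 0 < x) (hx1 : x ≤ 1) (hreg : RegularSize η x (s.grp k).cls.1 (s.grp k).cls.2)
    {cpl : Bool} (hcpl' : (cpl = false ∧ (s.grp k).count + 1 < (s.grp k).cls.1 * (s.grp k).cls.2) ∨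
      (cpl = true ∧ (s.grp k).count + 1 = (s.grp k).cls.1 * (s.grp k).cls.2)) :
    Inv f η (setGroup k { s.grp k with count := (s.grp k).count + 1, complete := cpl }
      (place x ((s.grp k).base + (s.grp k).count % (s.grp k).cls.2)
        ((s.grp k).stbyBins f (s.grp k).count) s.n s)) := by
  set g := s.grp k with hg
  set S := g.stbyBins f g.count with hS
  set b := g.base + g.count % g.cls.2 with hb
  set s₁ := place x b S s.n s with hs₁
  set s' := setGroup k { g with count := g.count + 1, complete := cpl } s₁ with hs'
  have hc : g.cls ≠ small η := hreg.ne
  obtain ⟨hi1, -, hj1, -⟩ := h.1.bounds hk hc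
  rw [← hg] at hi1 hj1
  have hη0 : 0 < η := by linarith
  have hgrp : ∀ k', s'.grp k' =
      if k' = k then { g with count := g.count + 1, complete := cpl } else s.grp k' :=
    fun k' => by simp [hs', hs₁, place, setGroup, Function.update_apply]
  have hcls : ∀ k', (s'.grp k').cls = (s.grp k').cls := fun k' => by
    rw [hgrp]; split_ifs with e <;> simp [e, hg]
  have hbase : ∀ k', (s'.grp k').base = (s.grp k').base := fun k' => by
    rw [hgrp]; split_ifs with e <;> simp [e, hg]
  have hsr' : ∀ k', (s'.grp k').sr = (s.grp k').sr := fun k' => by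
    rw [hgrp]; split_ifs with e <;> simp [e, hg]
  have hcount : ∀ k', k' ≠ k → (s'.grp k').count = (s.grp k').count := fun k' e => by
    rw [hgrp, if_neg e]
  have hcomp : ∀ k', k' ≠ k → (s'.grp k').complete = (s.grp k').complete := fun k' e => by
    rw [hgrp, if_neg e]
  have hcountk : (s'.grp k).count = g.count + 1 := by rw [hgrp, if_pos rfl]
  have hcompk : (s'.grp k).complete = cpl := by rw [hgrp, if_pos rfl]
  have hown : ∀ k', (s'.grp k').own f η = (s.grp k').own f η := fun k' =>
    Group.own_congr (hcls k') (hbase k')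
  have hlt : ∀ a, a < s'.n → a < s.n ∨ a = s.n := fun a ha => Nat.lt_succ_iff_lt_or_eq.1 ha
  have hsz : ∀ a < s.n, s'.size a = s.size a := fun a ha => (place_old (x := x) (b := b) (S := S) (u := s.n) ha).1
  have hpr : ∀ a < s.n, s'.prim a = s.prim a := fun a ha => (place_old (x := x) (b := b) (S := S) (u := s.n) ha).2.1
  have hst : ∀ a < s.n, s'.stby a = s.stby a := fun a ha => (place_old (x := x) (b := b) (S := S) (u := s.n) ha).2.2.1
  have hun : ∀ a < s.n, s'.unit a = s.unit a := fun a ha => (place_old (x := x) (b := b) (S := S) (u := s.n) ha).2.2.2.1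
  have hszn : s'.size s.n = x := (place_new (x := x) (b := b) (S := S) (u := s.n)).1
  have hprn : s'.prim s.n = b := (place_new (x := x) (b := b) (S := S) (u := s.n)).2.1
  have hstn : s'.stby s.n = S := (place_new (x := x) (b := b) (S := S) (u := s.n)).2.2.1
  have hunn : s'.unit s.n = s.n := (place_new (x := x) (b := b) (S := S) (u := s.n)).2.2.2.1
  have hus : ∀ v, unitSize s' v = unitSize s v + if s.n = v then x else 0 :=
    unitSize_place x b S s.n s
  have hlev : ∀ c, level η s' c = level η s c + if c = b then x else if c ∈ S then x / η else 0 :=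
    level_place η x b S s.n s
  have hwt : ∀ c, weight η s' c = weight η s c +
      if c = b then primWeight η x else if c ∈ S then stbyWeight η (x / η) else 0 :=
    weight_place η x b S s.n s
  have hmod : g.count % g.cls.2 < g.cls.2 := Nat.mod_lt _ hj1
  have hdiv : g.count / g.cls.2 < g.cls.1 := by
    rw [Nat.div_lt_iff_lt_mul hj1]; omega
  have hbown : b ∈ g.own f η := Group.prim_mem_own hc hmod
  have hSown : S ⊆ g.own f η := by
    intro c hcS
    simp only [hS, Group.stbyBins, Finset.mem_image, Finset.mem_range] at hcS
    obtain ⟨m, hm, rfl⟩ := hcS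
    exact Group.stby_mem_own hc hm hdiv
  -- bins that receive no replica
  have hlev' : ∀ c, c ∉ g.own f η → level η s' c = level η s c :=
    fun c h1 => by
      rw [hlev, if_neg (fun e : c = b => h1 (e ▸ hbown)),
        if_neg fun e => h1 (hSown e), add_zero]
  have hwt' : ∀ c, c ∉ g.own f η → weight η s' c = weight η s c :=
    fun c h1 => by
      rw [hwt, if_neg (fun e : c = b => h1 (e ▸ hbown)),
        if_neg fun e => h1 (hSown e), add_zero]
  have hown_other : ∀ k' < s.numGroups, k' ≠ k → ∀ c ∈ (s.grp k').own f η,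
      c ∉ g.own f η := fun k' hk' e c hcm hcm' => e (h.1.4 k' hk' k hk c hcm hcm')
  have hsp_own : ∀ c ∈ s.smallPrim, c ∉ g.own f η := fun c hcs hcm => h.1.5 k hk c hcm hcs
  have hcsr : ∀ k', (s.grp k').cls = small η → k' ≠ k := by
    rintro k' hk' rfl; exact hc hk'
  -- no item of the group has the same primary bin and a common standby bin
  have hpos : ∀ a < s.n, ∀ β ∈ S, β ∈ s.stby a → s.prim a ≠ b := by
    intro a ha β hβ hβa hab
    obtain ⟨k', hk', hi⟩ := h.2.2 a ha
    have e := h.1.4 k' hk' k hk β (h.stby_subset hk' hi hβa) (hSown hβ)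
    subst e
    rcases hi with hi | hi
    · obtain ⟨t, ht, hp, hq⟩ := hi.pos
      rw [hq] at hβa
      simp only [hS, Group.stbyBins, Finset.mem_image, Finset.mem_range] at hβ hβa
      obtain ⟨m, -, rfl⟩ := hβ
      obtain ⟨m', -, hm⟩ := hβa
      have hz := stby_index_eq (div_lt_of_lt_count h.1 hk hc ht) hdiv hm
      rw [hp] at hab
      have hw : t % g.cls.2 = g.count % g.cls.2 := by
        rw [hb, hg] at hab
        exact Nat.add_left_cancel hab
      have e1 := Nat.div_add_mod t g.cls.2
      have e2 := Nat.div_add_mod g.count g.cls.2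
      rw [hw, hz, e2] at e1
      exact absurd e1.symm (ne_of_lt (show t < g.count from ht))
    · exact hc hi.cls
  refine ⟨⟨?_, ?_, h.1.3, ?_, ?_, ?_, ?_, ?_, ?_, ?_, ?_⟩,
    ⟨?_, ?_, ?_, ?_, ?_, ?_, ?_⟩, ⟨?_, ?_, ?_, ?_, ?_, ?_, ?_, ?_, ?_⟩⟩
  · intro k' hk'; rw [hcls]; exact h.1.1 k' hk'
  · intro k' hk'; rw [hown]; exact h.1.2 k' hk'
  · intro k' hk' k'' hk''; rw [hown, hown]; exact h.1.4 k' hk' k'' hk''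
  · intro k' hk'; rw [hown]; exact h.1.5 k' hk'
  · intro b hb
    refine (h.1.6 b hb).imp_right fun ⟨k', hk', h'⟩ => ⟨k', hk', ?_⟩
    rwa [hown]
  · intro k' hk' b' u'
    rw [hsr', hcls]
    intro h'
    have h1 := h.1.7 k' hk' b' u' h'
    rw [hcomp _ (hcsr k' h1.1)]
    exact h1
  · intro k₁ hk₁ k₂ hk₂; rw [hsr', hsr']; exact h.1.8 k₁ hk₁ k₂ hk₂
  · intro k' hk'
    rw [hcls]
    intro hne hcm
    by_cases e : k' = k
    · subst e
      rw [hcompk] at hcm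
      rw [hcountk]
      rcases hcpl' with hh | hh
      · exact hh.2
      · simp [hcm] at hh
    · rw [hcomp _ e] at hcm
      rw [hcount _ e]
      exact h.1.9 k' hk' hne hcm
  · intro k' hk'
    rw [hcls]
    intro hne hcm
    by_cases e : k' = k
    · subst e
      rw [hcompk] at hcm
      rw [hcountk]
      rcases hcpl' with hh | hh
      · simp [hcm] at hh
      · exact hh.2
    · rw [hcomp _ e] at hcm
      rw [hcount _ e]
      exact h.1.10 k' hk' hne hcm
  · intro c
    refine (Finset.card_le_card fun k' hk' => ?_).trans (h.1.11 c)
    simp only [incomplete, Finset.mem_filter, Finset.mem_range] at hk' ⊢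
    obtain ⟨h1, h2, h3⟩ := hk'
    rw [hcls] at h2
    refine ⟨h1, h2, ?_⟩
    by_cases e : k' = k
    · rw [e]; exact hcpl
    · rwa [hcomp _ e] at h3
  · intro a ha
    rcases hlt a ha with ha | rfl
    · rw [hsz a ha]; exact h.2.1 a ha
    · rw [hszn]; exact ⟨hx, hx1⟩
  · intro a ha
    rcases hlt a ha with ha | rfl
    · obtain ⟨k', hk', hi⟩ := h.2.2 a ha
      refine ⟨k', hk', hi.imp (fun hi => ?_) fun hi => ?_⟩
      · refine hi.congr (hcls _) (hbase _) ?_ (hsz a ha) (hpr a ha) (hst a ha) (hun a ha) ?_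
        · by_cases e : k' = k
          · rw [e, hcountk]; exact Nat.le_succ _
          · exact (hcount _ e).ge
        · rw [hus, if_neg ha.ne', add_zero]
      · refine hi.congr (hcls _) (hbase _) subset_rfl (hpr a ha) (hst a ha) (hun a ha) ?_
        rw [hus, if_neg (h.2.3 a ha).ne', add_zero]; exact hi.unitSize
    · refine ⟨k, hk, Or.inl ⟨by rwa [hcls], ?_, hunn, ?_, g.count, ?_, ?_, ?_⟩⟩
      · rw [hcls, hszn]; exact hreg.mul_div_le
      · rw [hus, if_pos rfl, hszn, unitSize_eq_zero fun a ha => (h.2.3 a ha).ne, zero_add]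
      · rw [hcountk]; exact Nat.lt_succ_self _
      · rw [hprn, hbase, hcls]
      · rw [hstn, hbase, hcls]; rfl
  · intro a ha
    rcases hlt a ha with ha | rfl
    · rw [hun a ha]; exact (h.2.3 a ha).trans (Nat.lt_succ_self _)
    · rw [hunn]; exact Nat.lt_succ_self _
  · intro a ha c hc'
    rcases hlt a ha with ha | rfl <;> rcases hlt c hc' with hc' | rfl
    · rw [hun a ha, hun c hc', hpr a ha, hpr c hc', hst a ha, hst c hc']
      exact h.2.4 a ha c hc'
    · rw [hun a ha, hunn]
      exact fun e => absurd e (h.2.3 a ha).ne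
    · rw [hun c hc', hunn]
      exact fun e => absurd e (h.2.3 c hc').ne'
    · exact fun _ => ⟨rfl, rfl⟩
  · intro a ha c hc' β
    rcases hlt a ha with ha | rfl <;> rcases hlt c hc' with hc' | rfl
    · rw [hun a ha, hun c hc', hpr a ha, hpr c hc', hst a ha, hst c hc']
      exact h.2.5 a ha c hc' β
    · rw [hpr a ha, hst a ha, hprn, hstn]
      exact fun h1 h2 h3 => absurd h3 (hpos a ha β h2 h1)
    · rw [hpr c hc', hst c hc', hprn, hstn]
      exact fun h1 h2 h3 => absurd h3.symm (hpos c hc' β h1 h2)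
    · exact fun _ _ _ => rfl
  · intro k' hk' b' u'
    rw [hsr', hown]
    intro h' a ha
    rcases hlt a ha with ha | rfl
    · rw [hun a ha, hpr a ha, hst a ha]
      exact h.2.6 k' hk' b' u' h' a ha
    · rw [hunn]
      exact fun e => absurd (hsr k' hk' b' u' h') (by rw [e]; exact lt_irrefl _)
  · intro k' hk' b' u'
    rw [hsr', hown]
    intro h' a ha
    rcases hlt a ha with ha | rfl
    · rw [hun a ha, hpr a ha, hst a ha]
      exact h.2.7 k' hk' b' u' h' a ha
    · rw [hprn]
      rintro rfl
      exact absurd hbown (hsp_own _ (h.1.7 k' hk' _ _ h').2.2)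
  · intro k' hk'
    rw [hcls, hbase]
    intro hne w hw
    have hm := Group.prim_mem_own (f := f) hne hw
    have h1 := h.3.1 k' hk' hne w hw
    by_cases e : k' = k
    · subst e
      rw [← hg] at h1 hw hm ⊢
      have hwS : g.base + w ∉ S := by
        simp only [hS, Group.stbyBins, Finset.mem_image, Finset.mem_range, not_exists, not_and]
        intro m _ e
        generalize m * g.cls.1 = p at e
        generalize g.count / g.cls.2 = q at e
        omega
      rw [hcountk, Nat.count_succ, hlev, hwt, if_neg hwS, if_neg hwS]
      by_cases hwb : g.count % g.cls.2 = w
      · have : g.base + w = b := by rw [hb, hwb]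
        rw [if_pos this, if_pos this, if_pos hwb, mul_add, mul_add, hreg.weight_prim]
        push_cast
        have := hreg.mul_le
        exact ⟨by linarith, by linarith⟩
      · have : g.base + w ≠ b := fun e => hwb (Nat.add_left_cancel (hb ▸ e)).symm
        rw [if_neg this, if_neg this, if_neg hwb]
        simpa using h1
    · rw [hcount _ e, hlev' _ (hown_other k' hk' e _ hm), hwt' _ (hown_other k' hk' e _ hm)]
      exact h1
  · intro k' hk'
    rw [hcls, hbase]
    intro hne m hmf z hz
    have hm := Group.stby_mem_own hne hmf hz
    have h1 := h.3.2 k' hk' hne m hmf z hz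
    by_cases e : k' = k
    · subst e
      rw [← hg] at h1 hz hm ⊢
      have hwb : g.base + g.cls.2 + m * g.cls.1 + z ≠ b := by
        intro e
        rw [hb] at e
        generalize m * g.cls.1 = p at e
        omega
      rw [hcountk, Nat.count_succ, hlev, hwt, if_neg hwb, if_neg hwb]
      by_cases hzb : g.count / g.cls.2 = z
      · have : g.base + g.cls.2 + m * g.cls.1 + z ∈ S := by
          simp only [hS, Group.stbyBins, Finset.mem_image, Finset.mem_range]
          exact ⟨m, hmf, by rw [hzb]⟩
        rw [if_pos this, if_pos this, if_pos hzb, mul_add, mul_add, hreg.weight_stby]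
        push_cast
        have := hreg.mul_div_le
        exact ⟨by linarith, by linarith⟩
      · have : g.base + g.cls.2 + m * g.cls.1 + z ∉ S := by
          simp only [hS, Group.stbyBins, Finset.mem_image, Finset.mem_range, not_exists, not_and]
          exact fun m' _ e => hzb (stby_index_eq hdiv hz e)
        rw [if_neg this, if_neg this, if_neg hzb]
        simpa using h1
    · rw [hcount _ e, hlev' _ (hown_other k' hk' e _ hm), hwt' _ (hown_other k' hk' e _ hm)]
      exact h1
  · intro c hcs
    rw [hlev' c (hsp_own c hcs), hwt' c (hsp_own c hcs)]
    exact h.3.3 c hcs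
  · intro k' hk'
    rw [hcls, hown]
    intro hc' β hβ
    have hall : ∀ c ∈ (s.grp k').own f η, level η s' c = level η s c := fun c hcm =>
      hlev' c (hown_other k' hk' (hcsr k' hc') c hcm)
    obtain ⟨h1, h2, h3⟩ := h.3.4 k' hk' hc' β hβ
    rw [hall β hβ, hwt' β (hown_other k' hk' (hcsr k' hc') β hβ)]
    exact ⟨h1, h2, fun β' hβ' => by rw [hall β' hβ', h3 β' hβ']⟩
  · intro k' hk'
    rw [hcls, hown]
    intro hc' hcp β hβ
    rw [hcomp _ (hcsr k' hc')] at hcp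
    rw [hlev' β (hown_other k' hk' (hcsr k' hc') β hβ)]
    exact h.3.5 k' hk' hc' hcp β hβ
  · intro k' hk' b' u'
    rw [hsr']
    intro h'
    rw [hlev' b' (hsp_own _ (h.1.7 k' hk' b' u' h').2.2), hus,
      if_neg (hsr k' hk' b' u' h').ne', add_zero]
    exact h.3.6 k' hk' b' u' h'
  · intro k' hk' b' u'
    rw [hsr', hown]
    intro h' β hβ
    have hβ' := hown_other k' hk' (hcsr k' (h.1.7 k' hk' b' u' h').1) β hβ
    have h1 := h.3.7 k' hk' b' u' h' β hβ
    have h2 : ((sharing s' β).erase b').card ≤ ((sharing s β).erase b').card :=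
      Finset.card_le_card (Finset.erase_subset_erase _
        (sharing_place_of_notMem x b s.n s fun e => hβ' (hSown e)))
    have h3 : (((sharing s' β).erase b').card : ℝ) ≤ ((sharing s β).erase b').card := by
      exact_mod_cast h2
    have h4 : 0 < cap η / η / 2 := by have := cap_pos hη; positivity
    have h5 := mul_le_mul_of_nonneg_right h3 h4.le
    rw [hlev' β hβ', hus, if_neg (hsr k' hk' b' u' h').ne', add_zero]
    exact ⟨h1.1, by linarith [h1.2]⟩
  · intro k' hk'
    rw [hcls, hsr', hown]
    intro hc' hcp hno β hβ a ha
    rw [hcomp _ (hcsr k' hc')] at hcp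
    rcases hlt a ha with ha | rfl
    · rw [hst a ha]; exact h.3.8 k' hk' hc' hcp hno β hβ a ha
    · rw [hstn]; exact fun e => hown_other k' hk' (hcsr k' hc') β hβ (hSown e)
  · exact (Finset.card_le_card (unfilled_place_subset hx hη b S s.n s)).trans h.3.9

end

section

variable {f : ℕ} {η : ℝ} {s s' : State}

/-! ### Active groups -/

/-- The invariant of the algorithm, except for the active groups. -/
structure Good (f : ℕ) (η : ℝ) (s : State) : Prop where
  inv : Inv f η s
  failed_lt : ∀ b ∈ s.failed, b < s.numBins
  card_failed : s.failed.card ≤ f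
  sr_lt : ∀ k < s.numGroups, ∀ b u, (s.grp k).sr = some (b, u) → u < s.n
  adjusted : WellAdjusted s.failed s s.cur

/-- The active group of class `c` is an incomplete group of this class. -/
structure Active (s : State) (c : ℕ × ℕ) : Prop where
  lt : s.active c < s.numGroups
  cls : (s.grp (s.active c)).cls = c
  incomplete : (s.grp (s.active c)).complete = false

/-- The active group of class `c` is available. -/
structure Ready (f : ℕ) (η : ℝ) (s : State) (c : ℕ × ℕ) : Prop extends Active s c where
  available : Available f η s (s.active c)

/-- The states `s` and `s'` agree on the items and the failures. -/
structure SameItems (s s' : State) : Prop where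
  packing : s'.toPacking = s.toPacking
  failed : s'.failed = s.failed
  numBins_le : s.numBins ≤ s'.numBins

lemma SameItems.refl (s : State) : SameItems s s := ⟨rfl, rfl, le_rfl⟩

lemma SameItems.trans {s₁ s₂ s₃ : State} (h : SameItems s₁ s₂) (h' : SameItems s₂ s₃) :
    SameItems s₁ s₃ :=
  ⟨h'.1.trans h.1, h'.2.trans h.2, h.3.trans h'.3⟩

lemma Layout.mem_groupBins (h : Layout f η s) {k : ℕ} (hk : k < s.numGroups) {b : ℕ} :
    b ∈ groupBins f η (s.grp k) ↔ b ∈ (s.grp k).own f η ∨ ∃ u, (s.grp k).sr = some (b, u) := by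
  by_cases hc : (s.grp k).cls = small η
  · rw [groupBins, if_pos hc, Group.own_small hc, Finset.mem_union, Option.mem_toFinset,
      Option.mem_map]
    simp
  · rw [groupBins, if_neg hc, Group.own_regular hc]
    refine (or_iff_left ?_).symm
    rintro ⟨u, hu⟩
    exact hc (h.sr k hk b u hu).1

lemma Layout.groupBins_disjoint (h : Layout f η s) {k k' : ℕ} (hk : k < s.numGroups)
    (hk' : k' < s.numGroups) {b : ℕ} (hb : b ∈ groupBins f η (s.grp k))
    (hb' : b ∈ groupBins f η (s.grp k')) : k = k' := by
  rw [h.mem_groupBins hk] at hb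
  rw [h.mem_groupBins hk'] at hb'
  rcases hb with hb | ⟨u, hb⟩ <;> rcases hb' with hb' | ⟨u', hb'⟩
  · exact h.own_disjoint k hk k' hk' b hb hb'
  · exact absurd (h.sr k' hk' b u' hb').2.2 (h.own_smallPrim k hk b hb)
  · exact absurd (h.sr k hk b u hb).2.2 (h.own_smallPrim k' hk' b hb')
  · exact h.sr_inj k hk k' hk' b u b u' hb hb' (Or.inl rfl)

/-- Without a candidate, every incomplete group of the class contains a failed bin. Groups,
including their committed bins, are disjoint, so there are no more of them than failed bins. -/
lemma Good.card_incomplete_le (h : Good f η s) {c : ℕ × ℕ} (hc : ¬ ∃ k, Candidate f η c s k) :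
    (incomplete s c).card ≤ f := by
  have : ∀ k ∈ incomplete s c, ∃ b ∈ s.failed, b ∈ groupBins f η (s.grp k) := by
    intro k hk
    simp only [incomplete, Finset.mem_filter, Finset.mem_range] at hk
    have : ¬ Available f η s k := fun ha => hc ⟨k, hk.1, hk.2.1, hk.2.2, ha⟩
    rw [Available, Finset.not_disjoint_iff] at this
    obtain ⟨b, h1, h2⟩ := this
    exact ⟨b, h2, h1⟩
  choose! r hr using this
  refine (Finset.card_le_card_of_injOn r (fun k hk => (hr k hk).1) ?_).trans h.card_failed
  intro k hk k' hk' e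
  have h1 := (hr k hk).2
  have h2 := (hr k' hk').2
  rw [← e] at h2
  simp only [incomplete, Finset.coe_filter, Finset.mem_range, Set.mem_ofPred_eq] at hk hk'
  exact h.inv.layout.groupBins_disjoint hk.1 hk'.1 h1 h2

lemma exists_selectActive (f : ℕ) (η : ℝ) (c : ℕ × ℕ) (s : State) :
    ∃ s', SelectActive f η c s s' := by
  by_cases h : ∃ k, Candidate f η c s k
  · obtain ⟨k, hk⟩ := h
    exact ⟨_, Or.inl ⟨k, hk, rfl⟩⟩
  · exact ⟨_, Or.inr ⟨h, rfl⟩⟩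

/-- What is preserved when the active group of class `c` is changed. -/
structure Selected (f : ℕ) (η : ℝ) (c : ℕ × ℕ) (s s' : State) : Prop where
  good : Good f η s'
  ready : Ready f η s' c
  active : ∀ c' ≠ c, Active s c' → Active s' c'
  ready_other : ∀ c' ≠ c, Ready f η s c' → Ready f η s' c'
  same : SameItems s s'

lemma Good.openFresh (hη : 1 < η) (h : Good f η s) {c : ℕ × ℕ} (hc : c ∈ classes η)
    (hcard : (incomplete s c).card ≤ f) : Selected f η c s (openFresh f η s c) := by
  set s' := HS.openFresh f η s c with hs'
  have hold : ∀ k < s.numGroups, s'.grp k = s.grp k :=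
    fun k hk => Function.update_of_ne hk.ne _ _
  have hnew : s'.grp s.numGroups = ⟨c, s.numBins, 0, none, false⟩ := Function.update_self ..
  have hact : s'.active c = s.numGroups := Function.update_self ..
  have hact' : ∀ c' ≠ c, s'.active c' = s.active c' := fun c' e => Function.update_of_ne e _ _
  have hinv : Inv f η s' := h.inv.openFresh hη hc hcard
  have hb : s.numBins ≤ s'.numBins := Nat.le_add_right _ _
  have hN : s'.numGroups = s.numGroups + 1 := rfl
  refine ⟨⟨hinv, fun b hb' => (h.failed_lt b hb').trans_le hb, h.card_failed, ?_,
    ⟨h.5.1, h.5.2, h.5.3⟩⟩, ⟨⟨?_, ?_, ?_⟩, ?_⟩, ?_, ?_, ⟨rfl, rfl, hb⟩⟩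
  · intro k hk b u
    rcases Nat.lt_succ_iff_lt_or_eq.1 hk with hk | rfl
    · rw [hold k hk]; exact h.sr_lt k hk b u
    · rw [hnew]; simp
  · rw [hact, hN]; exact Nat.lt_succ_self _
  · rw [hact, hnew]
  · rw [hact, hnew]
  · rw [hact, Available, Finset.disjoint_left]
    intro b hb1 hb2
    rw [hinv.layout.mem_groupBins (hN ▸ Nat.lt_succ_self _), hnew] at hb1
    rcases hb1 with hb1 | hb1
    · have := (Finset.mem_Ico.1 hb1).1
      exact absurd (h.failed_lt b hb2) this.not_gt
    · simp at hb1
  · intro c' e ha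
    refine ⟨?_, ?_, ?_⟩
    · rw [hact' c' e, hN]; exact ha.lt.trans (Nat.lt_succ_self _)
    · rw [hact' c' e, hold _ ha.lt]; exact ha.cls
    · rw [hact' c' e, hold _ ha.lt]; exact ha.incomplete
  · intro c' e ha
    refine ⟨⟨?_, ?_, ?_⟩, ?_⟩
    · rw [hact' c' e, hN]; exact ha.lt.trans (Nat.lt_succ_self _)
    · rw [hact' c' e, hold _ ha.lt]; exact ha.cls
    · rw [hact' c' e, hold _ ha.lt]; exact ha.incomplete
    · rw [hact' c' e, Available, hold _ ha.lt]; exact ha.available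

lemma Good.selectActive (hη : 1 < η) (h : Good f η s) {c : ℕ × ℕ} (hc : c ∈ classes η)
    (hs : SelectActive f η c s s') : Selected f η c s s' := by
  rcases hs with ⟨k, ⟨hk1, hk2, hk3, hk4⟩, rfl⟩ | ⟨hno, rfl⟩
  · have hact : Function.update s.active c k c = k := Function.update_self ..
    have hact' : ∀ c' ≠ c, Function.update s.active c k c' = s.active c' :=
      fun c' e => Function.update_of_ne e _ _
    refine ⟨⟨h.inv.update s.cur s.failed _, h.2, h.3, h.4, ⟨h.5.1, h.5.2, h.5.3⟩⟩, ?_, ?_, ?_,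
      ⟨rfl, rfl, le_rfl⟩⟩
    · refine ⟨⟨?_, ?_, ?_⟩, ?_⟩ <;> simp only [hact]
      · exact hk1
      · exact hk2
      · exact hk3
      · exact hk4
    · intro c' e ha
      refine ⟨?_, ?_, ?_⟩ <;> simp only [hact' c' e]
      · exact ha.1
      · exact ha.2
      · exact ha.3
    · intro c' e ha
      refine ⟨⟨?_, ?_, ?_⟩, ?_⟩ <;> simp only [hact' c' e]
      · exact ha.1.1
      · exact ha.1.2
      · exact ha.1.3
      · exact ha.2
  · exact h.openFresh hη hc (h.card_incomplete_le hno)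

lemma exists_refresh (f : ℕ) (η : ℝ) (cs : List (ℕ × ℕ)) (s : State) :
    ∃ s', Refresh f η cs s s' := by
  induction cs generalizing s with
  | nil => exact ⟨s, rfl⟩
  | cons c cs ih =>
    by_cases h : Available f η s (s.active c)
    · obtain ⟨s', hs'⟩ := ih s
      exact ⟨s', s, Or.inl ⟨h, rfl⟩, hs'⟩
    · obtain ⟨s₁, hs₁⟩ := exists_selectActive f η c s
      obtain ⟨s', hs'⟩ := ih s₁
      exact ⟨s', s₁, Or.inr ⟨h, hs₁⟩, hs'⟩

/-- `hr` is the loop invariant: classes no longer in the list are ready. They remain so because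
later selections change neither the failures nor the other active groups. Failures do not complete a
group, so every class stays `Active`. -/
lemma Good.refresh (hη : 1 < η) {cs : List (ℕ × ℕ)} (hcs : ∀ c ∈ cs, c ∈ classes η)
    (h : Good f η s) (ha : ∀ c ∈ classes η, Active s c)
    (hr : ∀ c ∈ classes η, c ∉ cs → Ready f η s c) (hs : Refresh f η cs s s') :
    Good f η s' ∧ (∀ c ∈ classes η, Ready f η s' c) ∧ SameItems s s' := by
  induction cs generalizing s with
  | nil =>
    obtain rfl : s' = s := hs
    exact ⟨h, fun c hc => hr c hc (by simp), SameItems.refl _⟩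
  | cons c cs ih =>
    obtain ⟨s₁, hs₁ | hs₁, hs⟩ := hs
    · obtain ⟨hav, rfl⟩ := hs₁
      refine ih (fun c' hc' => hcs c' (List.mem_cons_of_mem _ hc')) h ha (fun c' hc' hn => ?_) hs
      by_cases e : c' = c
      · subst e; exact ⟨ha c' hc', hav⟩
      · exact hr c' hc' (by simp [e, hn])
    · have hsel := h.selectActive hη (hcs c (by simp)) hs₁.2
      have ha' : ∀ c' ∈ classes η, Active s₁ c' := fun c' hc' => by
        by_cases e : c' = c
        · subst e; exact hsel.ready.toActive
        · exact hsel.active c' e (ha c' hc')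
      have hr' : ∀ c' ∈ classes η, c' ∉ cs → Ready f η s₁ c' := fun c' hc' hn => by
        by_cases e : c' = c
        · subst e; exact hsel.ready
        · exact hsel.ready_other c' e (hr c' hc' (by simp [e, hn]))
      obtain ⟨h1, h2, h3⟩ := ih (fun c' hc' => hcs c' (List.mem_cons_of_mem _ hc')) hsel.good
        ha' hr' hs
      exact ⟨h1, h2, hsel.same.trans h3⟩

/-- The initial state. -/
lemma good_emptyState : Good f η emptyState := by
  refine ⟨⟨⟨?_, ?_, ?_, ?_, ?_, ?_, ?_, ?_, ?_, ?_, ?_⟩, ⟨?_, ?_, ?_, ?_, ?_, ?_, ?_⟩,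
    ⟨?_, ?_, ?_, ?_, ?_, ?_, ?_, ?_,
      (Finset.card_le_card (Finset.filter_subset _ _)).trans (Nat.zero_le _)⟩⟩, ?_, ?_, ?_,
    ⟨?_, ?_, ?_⟩⟩
  all_goals simp [emptyState, incomplete]

/-- Since the classes are distinct and have no groups yet, each fresh group is the first of its
class, and the bound on incomplete groups is not an obstacle. -/
lemma Good.foldl_openFresh (hη : 1 < η) (cs : List (ℕ × ℕ)) (hnd : cs.Nodup)
    (hcs : ∀ c ∈ cs, c ∈ classes η) (h : Good f η s)
    (hno : ∀ c ∈ cs, ∀ k < s.numGroups, (s.grp k).cls ≠ c) :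
    Good f η (cs.foldl (HS.openFresh f η) s) ∧
      (∀ c, c ∈ cs ∨ Ready f η s c → Ready f η (cs.foldl (HS.openFresh f η) s) c) ∧
      SameItems s (cs.foldl (HS.openFresh f η) s) := by
  induction cs generalizing s with
  | nil => exact ⟨h, fun c hc => hc.resolve_left (by simp), SameItems.refl s⟩
  | cons c cs ih =>
    rw [List.nodup_cons] at hnd
    have hcard : (incomplete s c).card ≤ f := by
      have : incomplete s c = ∅ := by
        simp only [incomplete, Finset.filter_eq_empty_iff, Finset.mem_range, not_and]
        exact fun k hk e => absurd e (hno c (by simp) k hk)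
      simp [this]
    have hsel := h.openFresh hη (hcs c (by simp)) hcard
    have hno' : ∀ c' ∈ cs, ∀ k < (HS.openFresh f η s c).numGroups,
        ((HS.openFresh f η s c).grp k).cls ≠ c' := fun c' hc' k hk => by
      rcases Nat.lt_succ_iff_lt_or_eq.1 hk with hk | rfl
      · rw [show (HS.openFresh f η s c).grp k = s.grp k from Function.update_of_ne hk.ne _ _]
        exact hno c' (List.mem_cons_of_mem _ hc') k hk
      · rw [show (HS.openFresh f η s c).grp s.numGroups = ⟨c, s.numBins, 0, none, false⟩ from
          Function.update_self ..]
        rintro rfl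
        exact hnd.1 hc'
    obtain ⟨h1, h2, h3⟩ := ih hnd.2 (fun c' hc' => hcs c' (List.mem_cons_of_mem _ hc')) hsel.good
      hno'
    refine ⟨h1, fun c' hc' => h2 c' ?_, hsel.same.trans h3⟩
    by_cases e : c' = c
    · subst e; exact Or.inr hsel.ready
    · rcases hc' with hc' | hc'
      · exact Or.inl ((List.mem_cons.1 hc').resolve_left e)
      · exact Or.inr (hsel.ready_other c' e hc')

end

section

variable {f : ℕ} {η x : ℝ} {s s' : State}

/-! ### The packing strategy -/

/-- The state `s'` results from `s` by placing an item of size `x` into non-failed bins. -/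
structure Placed (x : ℝ) (s s' : State) : Prop where
  n_eq : s'.n = s.n + 1
  old : ∀ a < s.n, s'.size a = s.size a ∧ s'.prim a = s.prim a ∧ s'.stby a = s.stby a
  size_new : s'.size s.n = x
  disjoint : Disjoint (s'.holders s.n) s.failed
  failed : s'.failed = s.failed
  numBins_le : s.numBins ≤ s'.numBins

lemma Placed.trans_same {s₁ s₂ s₃ : State} (h : Placed x s₁ s₂) (h' : SameItems s₂ s₃) :
    Placed x s₁ s₃ := by
  have e := h'.packing
  refine ⟨?_, ?_, ?_, ?_, h'.failed.trans h.failed, h.numBins_le.trans h'.numBins_le⟩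
  · rw [e]; exact h.n_eq
  · rw [e]; exact h.old
  · rw [e]; exact h.size_new
  · rw [e]; exact h.disjoint

lemma SameItems.trans_placed {s₁ s₂ s₃ : State} (h : SameItems s₁ s₂) (h' : Placed x s₂ s₃) :
    Placed x s₁ s₃ := by
  have e := h.packing
  obtain ⟨h1, h2, h3, h4, h5, h6⟩ := h'
  rw [e] at h1 h2 h3 h4
  rw [h.failed] at h4
  exact ⟨h1, h2, h3, h4, h5.trans h.failed, h.numBins_le.trans h6⟩

lemma placed_place {b u : ℕ} {S : Finset ℕ} (hb : b ∉ s.failed) (hS : Disjoint S s.failed) :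
    Placed x s (place x b S u s) := by
  refine ⟨rfl, fun a ha => ⟨(place_old ha).1, (place_old ha).2.1, (place_old ha).2.2.1⟩,
    place_new.1, ?_, rfl, le_rfl⟩
  rw [Packing.holders, place_new.2.1, place_new.2.2.1, Finset.disjoint_insert_left]
  exact ⟨hb, hS⟩

/-- The new primary replica lies in a non-failed bin, so the conditions on mapped units do not
concern it, even if it joins an existing unit. -/
lemma WellAdjusted.place (h : WellAdjusted s.failed s s.cur) {b u : ℕ} {S : Finset ℕ}
    (hb : b ∉ s.failed) :
    WellAdjusted s.failed (place x b S u s) (place x b S u s).cur := by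
  have hlt : ∀ a, a < (HS.place x b S u s).n → a < s.n ∨ a = s.n :=
    fun a ha => Nat.lt_succ_iff_lt_or_eq.1 ha
  have hold : ∀ a < s.n, _ := fun a ha => place_old (s := s) (x := x) (b := b) (S := S) (u := u)
    (a := a) ha
  have hnew := place_new (s := s) (x := x) (b := b) (S := S) (u := u)
  refine ⟨fun a ha => ?_, fun a ha => ?_, fun a ha c hc => ?_⟩
  · rcases hlt a ha with ha | rfl
    · rw [(hold a ha).2.1, (hold a ha).2.2.2.2]; exact h.cur_eq a ha
    · rw [hnew.2.1, hnew.2.2.2.2]; exact fun _ => rfl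
  · rcases hlt a ha with ha | rfl
    · rw [(hold a ha).2.1, (hold a ha).2.2.2.2, (hold a ha).2.2.1]; exact h.cur_mem a ha
    · rw [hnew.2.1]; exact fun e => absurd e hb
  · rcases hlt a ha with ha | rfl
    · rcases hlt c hc with hc | rfl
      · rw [(hold a ha).2.1, (hold c hc).2.1, (hold a ha).2.2.2.2, (hold c hc).2.2.2.2,
          (hold a ha).2.2.2.1, (hold c hc).2.2.2.1]
        exact h.cur_iff a ha c hc
      · rw [hnew.2.1]; exact fun _ e => absurd e hb
    · rw [hnew.2.1]; exact fun e => absurd e hb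

lemma Good.placeRegular (hη : 1 < η) (h : Good f η s) {i j : ℕ}
    (ha : ∀ c ∈ classes η, Ready f η s c) (hx : 0 < x) (hx1 : x ≤ 1) (hreg : RegularSize η x i j)
    (hs : PlaceRegular f η i j x s s') :
    Good f η s' ∧ (∀ c ∈ classes η, Ready f η s' c) ∧ Placed x s s' := by
  have hr := ha _ hreg.mem
  set k := s.active (i, j) with hk
  have hcls : (s.grp k).cls = (i, j) := hr.cls
  have hi : (s.grp k).cls.1 = i := by rw [hcls]
  have hj : (s.grp k).cls.2 = j := by rw [hcls]
  have hc : (s.grp k).cls ≠ small η := hcls ▸ hreg.ne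
  have hlt : k < s.numGroups := hr.lt
  have hown : ∀ b ∈ (s.grp k).own f η, b ∉ s.failed := fun b hb =>
    Finset.disjoint_left.1 hr.available ((h.inv.layout.mem_groupBins hlt).2 (Or.inl hb))
  obtain ⟨hi1, -, hj1, -⟩ := h.inv.layout.bounds hlt hc
  have hcount := h.inv.layout.count_lt k hlt hc hr.incomplete
  set b := (s.grp k).base + (s.grp k).count % j with hb
  set S := (Finset.range f).image
    fun m => (s.grp k).base + j + m * i + (s.grp k).count / j with hS
  have hbf : b ∉ s.failed := hown _ (Group.prim_mem_own hc (by
    rw [hj] at hj1 ⊢; exact Nat.mod_lt _ hj1))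
  have hSf : Disjoint S s.failed := by
    rw [Finset.disjoint_left]
    intro c hcS
    simp only [hS, Finset.mem_image, Finset.mem_range] at hcS
    obtain ⟨m, hm, rfl⟩ := hcS
    rw [← hi, ← hj]
    refine hown _ (Group.stby_mem_own hc hm ?_)
    rwa [Nat.div_lt_iff_lt_mul hj1]
  have key : ∀ cpl : Bool, ((cpl = false ∧ (s.grp k).count + 1 < i * j) ∨
      (cpl = true ∧ (s.grp k).count + 1 = i * j)) →
      let s₂ := setGroup k { s.grp k with count := (s.grp k).count + 1, complete := cpl }
        (place x b S s.n s)
      Good f η s₂ ∧ (∀ c ∈ classes η, c ≠ (i, j) → Ready f η s₂ c) ∧ Placed x s s₂ ∧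
        (cpl = false → Ready f η s₂ (i, j)) := by
    intro cpl hcpl s₂
    have hinv := h.inv.placeRegular hη hlt hr.incomplete h.sr_lt hx hx1
      (by rw [hi, hj]; exact hreg) (cpl := cpl) (by rw [hi, hj]; exact hcpl)
    rw [Group.stbyBins, hi, hj] at hinv
    have hgrp : ∀ k' ≠ k, s₂.grp k' = s.grp k' := fun k' e => Function.update_of_ne e _ _
    have hgrpk : s₂.grp k = { s.grp k with count := (s.grp k).count + 1, complete := cpl } :=
      Function.update_self ..
    have hgb : ∀ k', groupBins f η (s₂.grp k') = groupBins f η (s.grp k') := fun k' => by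
      by_cases e : k' = k
      · rw [e, hgrpk]; rfl
      · rw [hgrp k' e]
    refine ⟨⟨hinv, h.failed_lt, h.card_failed, fun k' hk' b' u' => ?_, ?_⟩, fun c hcc e => ?_, ?_,
      fun hf => ?_⟩
    · by_cases e : k' = k
      · rw [e, hgrpk]
        exact fun h' => (h.sr_lt k hlt b' u' h').trans (Nat.lt_succ_self _)
      · rw [hgrp k' e]
        exact fun h' => (h.sr_lt k' hk' b' u' h').trans (Nat.lt_succ_self _)
    · have := h.adjusted.place (x := x) (S := S) (u := s.n) hbf
      exact ⟨this.1, this.2, this.3⟩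
    · have hrc := ha c hcc
      have hne : s.active c ≠ k := fun e' => e (by rw [← hrc.cls, e', hcls])
      have hact : s₂.active c = s.active c := rfl
      exact ⟨⟨hrc.lt, by rw [hact, hgrp _ hne]; exact hrc.cls,
        by rw [hact, hgrp _ hne]; exact hrc.incomplete⟩,
        by rw [Available, hgb]; exact hrc.available⟩
    · have := placed_place (x := x) (u := s.n) hbf hSf
      exact ⟨this.1, this.2, this.3, this.4, this.5, this.6⟩
    · have hact : s₂.active (i, j) = k := rfl
      exact ⟨⟨hlt, by rw [hact, hgrpk]; exact hcls, by rw [hact, hgrpk]; exact hf⟩,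
        by rw [Available, hgb]; exact hr.available⟩
  rcases hs with ⟨hlt', rfl⟩ | ⟨heq, hsel⟩
  · have hfc : (s.grp k).complete = false := hr.incomplete
    -- The unfinished branch of `PlaceRegular` leaves the flag `complete` untouched; rewriting
    -- `false` as its present value matches the two states.
    have := key false (Or.inl ⟨rfl, hlt'⟩)
    rw [← hfc] at this
    obtain ⟨h1, h2, h3, h4⟩ := this
    refine ⟨h1, fun c hcc => ?_, h3⟩
    by_cases e : c = (i, j)
    · rw [e]; exact h4 rfl
    · exact h2 c hcc e
  · obtain ⟨h1, h2, h3, -⟩ := key true (Or.inr ⟨rfl, heq⟩)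
    have hse := h1.selectActive hη hreg.mem hsel
    refine ⟨hse.good, fun c hcc => ?_, h3.trans_same hse.same⟩
    by_cases e : c = (i, j)
    · rw [e]; exact hse.ready
    · exact hse.ready_other c e (h2 c hcc e)

lemma exists_placeRegular (h : Good f η s) {i j : ℕ} (hr : Ready f η s (i, j))
    (hne : (i, j) ≠ small η) : ∃ s', PlaceRegular f η i j x s s' := by
  have hcount := h.inv.layout.count_lt _ hr.lt (by rw [hr.cls]; exact hne) hr.incomplete
  rw [hr.cls] at hcount
  rcases (Nat.succ_le_of_lt hcount).lt_or_eq with hlt | heq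
  · exact ⟨_, Or.inl ⟨hlt, rfl⟩⟩
  · obtain ⟨s', hs'⟩ := exists_selectActive f η (i, j) (setGroup (s.active (i, j))
      { s.grp (s.active (i, j)) with
        count := (s.grp (s.active (i, j))).count + 1, complete := true }
      (place x ((s.grp (s.active (i, j))).base + (s.grp (s.active (i, j))).count % j)
        ((Finset.range f).image fun m => (s.grp (s.active (i, j))).base + j + m * i +
          (s.grp (s.active (i, j))).count / j) s.n s))
    exact ⟨s', Or.inr ⟨heq, hs'⟩⟩

lemma Good.join (hη : 1 < η) (h : Good f η s) (ha : ∀ c ∈ classes η, Ready f η s c)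
    (hx : 0 < x) (hxc : x ≤ cap η / 2) {b u : ℕ}
    (hsr : (s.grp (s.active (small η))).sr = some (b, u)) (hfit : unitSize s u + x ≤ cap η) :
    let s' := place x b ((s.grp (s.active (small η))).own f η) u s
    Good f η s' ∧ (∀ c ∈ classes η, Ready f η s' c) ∧ Placed x s s' := by
  intro s'
  have hr := ha _ (mem_classes.2 (Or.inl rfl))
  have hav : ∀ c, (c ∈ (s.grp (s.active (small η))).own f η ∨
      ∃ u, (s.grp (s.active (small η))).sr = some (c, u)) → c ∉ s.failed := fun c hc =>
    Finset.disjoint_left.1 hr.available ((h.inv.layout.mem_groupBins hr.lt).2 hc)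
  have hbf : b ∉ s.failed := hav b (Or.inr ⟨u, hsr⟩)
  have hult := h.sr_lt _ hr.lt b u hsr
  refine ⟨⟨h.inv.join hη hr.lt hsr hult.le hx hxc hfit, h.failed_lt,
    h.card_failed, fun k hk b' u' h' => (h.sr_lt k hk b' u' h').trans (Nat.lt_succ_self _),
    h.adjusted.place hbf⟩, fun c hc => ⟨⟨(ha c hc).lt, (ha c hc).cls, (ha c hc).incomplete⟩,
      (ha c hc).available⟩,
    placed_place hbf (Finset.disjoint_left.2 fun c hc => hav c (Or.inl hc))⟩

/-- A new super-replica is opened in the active group for small items. -/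
lemma Good.openSuper (hη : 1 < η) (h : Good f η s) (ha : ∀ c ∈ classes η, Ready f η s c)
    (hx : 0 < x) (hxc : x ≤ cap η / 2) {k : ℕ} (hk : s.active (small η) = k)
    (hhalf : HalfFull η s (s.grp k))
    (hroom : ∀ β ∈ (s.grp k).own f η, level η s β ≤ 1 - cap η) {b : ℕ} (hb : b ∈ s.smallPrim)
    (hbf : b ∉ s.failed) (hbl : level η s b ≤ 1 - cap η)
    (hbc : ∀ k' < s.numGroups, k' ≠ k → ∀ u, (s.grp k').sr ≠ some (b, u))
    (hbs : ∀ β ∈ (s.grp k).own f η, ∀ a < s.n, s.prim a = b → β ∉ s.stby a) :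
    let s' := setGroup k { s.grp k with sr := some (b, s.n) }
      (place x b ((s.grp k).own f η) s.n s)
    Good f η s' ∧ (∀ c ∈ classes η, Ready f η s' c) ∧ Placed x s s' := by
  subst hk
  intro s'
  have hr := ha _ (mem_classes.2 (Or.inl rfl))
  set k := s.active (small η) with hk
  set s₁ := setGroup k { s.grp k with sr := some (b, s.n) } s with hs₁
  have hgrp : ∀ k' ≠ k, s'.grp k' = s.grp k' := fun k' e => Function.update_of_ne e _ _
  have hgrpk : s'.grp k = { s.grp k with sr := some (b, s.n) } := Function.update_self ..
  have hgrpk₁ : s₁.grp k = { s.grp k with sr := some (b, s.n) } := Function.update_self ..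
  have hown₁ : (s₁.grp k).own f η = (s.grp k).own f η := by rw [hgrpk₁]; rfl
  have hinv₁ : Inv f η s₁ := h.inv.commit hη hr.lt hr.cls hr.incomplete h.sr_lt hhalf hroom hb hbl
    hbc hbs
  have hu0 : unitSize s₁ s.n = 0 := unitSize_eq_zero fun a ha => (h.inv.items.unit_lt a ha).ne
  have hinv : Inv f η s' := by
    -- Changing the group record and placing the item commute, so the state arises by committing the
    -- bin to an empty super-replica and then letting the first item join.
    have := hinv₁.join hη (k := k) hr.lt (b := b) (u := s.n) (by rw [hgrpk₁]) le_rfl hx hxc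
      (by rw [hu0]; linarith [cap_pos hη])
    rw [hown₁] at this
    exact this
  have hav : ∀ c ∈ (s.grp k).own f η, c ∉ s.failed := fun c hc =>
    Finset.disjoint_left.1 hr.available ((h.inv.layout.mem_groupBins hr.lt).2 (Or.inl hc))
  refine ⟨⟨hinv, h.failed_lt, h.card_failed, fun k' hk' b' u' => ?_, ?_⟩, fun c hcc => ?_, ?_⟩
  · by_cases e : k' = k
    · rw [e, hgrpk]
      intro h'
      simp only [Option.some.injEq, Prod.mk.injEq] at h'
      rw [← h'.2]
      exact Nat.lt_succ_self _
    · rw [hgrp k' e]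
      exact fun h' => (h.sr_lt k' hk' b' u' h').trans (Nat.lt_succ_self _)
  · have := h.adjusted.place (x := x) (S := (s.grp k).own f η) (u := s.n) hbf
    exact ⟨this.1, this.2, this.3⟩
  · have hrc := ha c hcc
    have hact : s'.active c = s.active c := rfl
    by_cases e : s.active c = k
    · refine ⟨⟨hrc.lt, ?_, ?_⟩, ?_⟩
      · rw [hact, e, hgrpk, ← hrc.cls, e]
      · rw [hact, e, hgrpk, ← hrc.incomplete, e]
      · rw [hact, e, Available, Finset.disjoint_left]
        intro c' hc'
        rw [hinv.layout.mem_groupBins hr.lt, hgrpk] at hc'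
        rcases hc' with hc' | ⟨u, hc'⟩
        · exact hav c' hc'
        · simp only [Option.some.injEq, Prod.mk.injEq] at hc'
          rw [← hc'.1]; exact hbf
    · exact ⟨⟨hrc.lt, by rw [hact, hgrp _ e]; exact hrc.cls,
        by rw [hact, hgrp _ e]; exact hrc.incomplete⟩,
        by rw [hact, Available, hgrp _ e]; exact hrc.available⟩
  · have := placed_place (x := x) (u := s.n) hbf (Finset.disjoint_left.2 hav)
    exact ⟨this.1, this.2, this.3, this.4, this.5, this.6⟩

end

/-! ### Small items: room, eligible bins and termination; then the events and the count of bins. -/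

section

variable {f : ℕ} {η x : ℝ} {s s' : State}

lemma hasRoom_iff {g : Group} (hc : g.cls = small η) :
    HasRoom f η s g ↔ ∀ β ∈ g.own f η, level η s β ≤ 1 - cap η := by
  rw [HasRoom, Group.own_small hc]
  refine forall₂_congr fun b _ => ?_
  rw [← cap]
  constructor <;> intro h <;> linarith

lemma fitsOpen_iff (hη : 1 < η) {g : Group} {b u : ℕ} (h : g.sr = some (b, u)) :
    FitsOpen η s g x ↔ unitSize s u + x ≤ cap η := by
  rw [FitsOpen]
  constructor
  · rintro ⟨b', u', h', h1, -⟩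
    rw [h] at h'
    simp only [Option.some.injEq, Prod.mk.injEq] at h'
    rw [h'.2, ← two_div_eq_cap hη]; exact h1
  · intro h1
    refine ⟨b, u, h, by rw [two_div_eq_cap hη]; exact h1, ?_⟩
    rw [two_div_eq_cap_div hη]
    gcongr

/-- Small items have size at most cap/2, so an open super-replica is abandoned only when it is more
than half full. -/
lemma halfFull_of_not_fitsOpen (hη : 1 < η) {g : Group} (hxc : x ≤ cap η / 2)
    (h : ¬ FitsOpen η s g x) : HalfFull η s g := by
  intro b u hsr
  rw [fitsOpen_iff hη hsr, not_le] at h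
  linarith

/-- Each sharing bin, except the committed one, accounts for cap/(2η) = 1/(7η - 1) of a level that
is at most 1. So there are at most 7η - 1 of them, plus the committed bin. -/
lemma Inv.card_sharing_le (hη : 1 < η) (h : Inv f η s) {k : ℕ} (hk : k < s.numGroups)
    (hc : (s.grp k).cls = small η) (hcpl : (s.grp k).complete = false) {β : ℕ}
    (hβ : β ∈ (s.grp k).own f η) : (sharing s β).card ≤ ⌊7 * η⌋₊ := by
  have hη0 : 0 < η := by linarith
  cases hsr : (s.grp k).sr with
  | none => simp [sharing_eq_empty (h.loads.sr_none k hk hc hcpl hsr β hβ)]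
  | some p =>
    obtain ⟨b, u⟩ := p
    have h1 := (h.loads.sr_stby k hk b u hsr β hβ).2
    have h2 := (h.loads.smallStby k hk hc β hβ).1
    have h3 : 0 ≤ unitSize s u / η := by
      apply div_nonneg _ hη0.le
      refine Finset.sum_nonneg fun a ha => ?_
      have := (h.items.size a (Finset.mem_range.1 ha)).1
      split_ifs <;> linarith
    have h4 : cap η / η ≤ cap η := div_le_self (cap_pos hη).le hη.le
    have h5 : cap η / η / 2 = 1 / (7 * η - 1) := by rw [one_div_eq_cap_div hη]; ring
    rw [h5, mul_one_div] at h1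
    have h6 : ((sharing s β).erase b).card ≤ 7 * η - 1 := by
      have : (((sharing s β).erase b).card : ℝ) / (7 * η - 1) ≤ 1 := by linarith
      rwa [div_le_one (by linarith)] at this
    have h7 := Finset.pred_card_le_card_erase (s := sharing s β) (a := b)
    have h8 : ((sharing s β).card : ℝ) ≤ ((sharing s β).erase b).card + 1 := by
      exact_mod_cast (by omega : (sharing s β).card ≤ ((sharing s β).erase b).card + 1)
    exact Nat.le_floor (by linarith)

/-- An ineligible bin with room is failed (at most f bins), committed to an incomplete group (at
most f + 1), or shares an item with one of the f standby bins (at most ⌊7η⌋ for each). The last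
summand 1 of `maxUnfilled` is for the bin about to be opened. -/
lemma Good.card_unfilled_lt (hη : 1 < η) (h : Good f η s) {k : ℕ} (hk : k < s.numGroups)
    (hc : (s.grp k).cls = small η) (hcpl : (s.grp k).complete = false)
    (hno : ¬ ∃ b, Eligible f η s k b) : (unfilled η s).card + 1 ≤ maxUnfilled f η := by
  -- The default 0 for groups without a committed bin can only enlarge the covering set; the
  -- cardinality of the image is bounded anyway.
  have hsub : unfilled η s ⊆ (s.failed ∪ (incomplete s (small η)).image
      fun k' => ((s.grp k').sr.map Prod.fst).getD 0) ∪ ((s.grp k).own f η).biUnion (sharing s) := by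
    intro b hb
    simp only [unfilled, Finset.mem_filter] at hb
    by_contra hb'
    simp only [Finset.mem_union, Finset.mem_image, Finset.mem_biUnion, not_or, not_exists,
      not_and] at hb'
    obtain ⟨⟨h1, h2⟩, h3⟩ := hb'
    refine hno ⟨b, hb.1, h1, fun k' hk' _ u hsr => ?_, ?_, fun β hβ a ha => ?_⟩
    · obtain ⟨e1, e2, -⟩ := h.inv.layout.sr k' hk' b u hsr
      refine h2 k' ?_ (by rw [hsr]; rfl)
      simp only [incomplete, Finset.mem_filter, Finset.mem_range]
      exact ⟨hk', e1, e2⟩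
    · rw [two_div_eq_cap hη]; linarith [hb.2]
    · rintro ⟨hba, hβa⟩
      rw [← Group.own_small hc] at hβ
      have e1 : s.prim a = b := by
        rcases Finset.mem_insert.1 hba with e | e
        · exact e.symm
        · exact absurd e (h.inv.notMem_stby_of_smallPrim ha hb.1)
      have e2 : β ∈ s.stby a := by
        rcases Finset.mem_insert.1 hβa with e | e
        · exact absurd hb.1 (e1 ▸ e ▸ h.inv.layout.own_smallPrim k hk β hβ)
        · exact e
      exact h3 β hβ (mem_sharing.2 ⟨a, ha, e2, e1⟩)
  have h1 := Finset.card_le_card hsub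
  have h2 := Finset.card_union_le (s.failed ∪ (incomplete s (small η)).image
      fun k' => ((s.grp k').sr.map Prod.fst).getD 0) (((s.grp k).own f η).biUnion (sharing s))
  have h3 := Finset.card_union_le s.failed ((incomplete s (small η)).image
      fun k' => ((s.grp k').sr.map Prod.fst).getD 0)
  have h4 := (Finset.card_image_le (s := incomplete s (small η))
    (f := fun k' => ((s.grp k').sr.map Prod.fst).getD 0)).trans
      (h.inv.layout.card_incomplete (small η))
  have h5 := Finset.card_biUnion_le_card_mul ((s.grp k).own f η) (sharing s) ⌊7 * η⌋₊
    fun β hβ => h.inv.card_sharing_le hη hk hc hcpl hβ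
  rw [Group.own_small hc, Nat.card_Ico, Nat.add_sub_cancel_left, ← Group.own_small hc] at h5
  have h6 := h.card_failed
  rw [maxUnfilled]
  omega

/-- Failure of `HasRoom` gives a single standby bin of level above 1 - cap; the mirrored bins have
the same level, so all of them are filled. -/
lemma Good.completeSmall (h : Good f η s) (ha : ∀ c ∈ classes η, Ready f η s c) {k : ℕ}
    (hk : s.active (small η) = k) (hroom : ¬ HasRoom f η s (s.grp k)) :
    let s' := setGroup k { s.grp k with sr := none, complete := true } s
    Good f η s' ∧ (∀ c ∈ classes η, c ≠ small η → Ready f η s' c) := by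
  subst hk
  intro s'
  have hr := ha _ (mem_classes.2 (Or.inl rfl))
  set k := s.active (small η) with hk
  have hgrp : ∀ k' ≠ k, s'.grp k' = s.grp k' := fun k' e => Function.update_of_ne e _ _
  have hgrpk : s'.grp k = { s.grp k with sr := none, complete := true } :=
    Function.update_self ..
  rw [hasRoom_iff hr.cls] at hroom
  push Not at hroom
  obtain ⟨β₀, hβ₀, hl⟩ := hroom
  refine ⟨⟨h.inv.completeSmall hr.lt hr.cls fun β hβ => ?_, h.failed_lt, h.card_failed,
    fun k' hk' b u => ?_, ⟨h.5.1, h.5.2, h.5.3⟩⟩, fun c hc e => ?_⟩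
  · rw [← (h.inv.loads.smallStby k hr.lt hr.cls β₀ hβ₀).2.2 β hβ]; exact hl.le
  · by_cases e : k' = k
    · rw [e, hgrpk]; simp
    · rw [hgrp k' e]; exact h.sr_lt k' hk' b u
  · have hrc := ha c hc
    have hne : s.active c ≠ k := fun e' => e (by rw [← hrc.cls, e', hr.cls])
    have hact : s'.active c = s.active c := rfl
    exact ⟨⟨hrc.lt, by rw [hact, hgrp _ hne]; exact hrc.cls,
      by rw [hact, hgrp _ hne]; exact hrc.incomplete⟩,
      by rw [hact, Available, hgrp _ hne]; exact hrc.available⟩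

lemma Good.placeSmall (hη : 1 < η) (hx : 0 < x) (hxc : x ≤ cap η / 2)
    (hs : PlaceSmall f η x s s') (h : Good f η s) (ha : ∀ c ∈ classes η, Ready f η s c) :
    Good f η s' ∧ (∀ c ∈ classes η, Ready f η s' c) ∧ Placed x s s' := by
  have hsm : small η ∈ classes η := mem_classes.2 (Or.inl rfl)
  induction hs with
  | join s b u hfit hsr =>
    have hr := ha _ hsm
    rw [← Group.own_small hr.cls]
    exact h.join hη ha hx hxc hsr ((fitsOpen_iff hη hsr).1 hfit)
  | oldBin s b hfit hroom hel =>
    have hr := ha _ hsm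
    obtain ⟨h1, h2, h3, h4, h5⟩ := hel
    rw [← Group.own_small hr.cls] at h5 ⊢
    rw [two_div_eq_cap hη] at h4
    exact h.openSuper hη ha hx hxc rfl (halfFull_of_not_fitsOpen hη hxc hfit)
      ((hasRoom_iff hr.cls).1 hroom) h1 h2 (by linarith) h3 fun β hβ a ha' e hβa =>
        h5 β hβ a ha' ⟨by simp [Packing.holders, e], by simp [Packing.holders, hβa]⟩
  | newBin s hfit hroom hel =>
    have hr := ha _ hsm
    rw [← Group.own_small hr.cls]
    have hinv := h.inv.addSmallBin (h.card_unfilled_lt hη hr.lt hr.cls hr.incomplete hel)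
    have hzero : ∀ a < s.n, s.numBins ∉ s.holders a := fun a ha hba =>
      absurd (h.inv.holders_lt ha _ hba) (lt_irrefl _)
    have hl0 : level η (addSmallBin s) s.numBins = 0 := level_eq_zero hzero
    have hg : Good f η (addSmallBin s) :=
      ⟨hinv, fun b hb => (h.failed_lt b hb).trans (Nat.lt_succ_self _), h.card_failed, h.sr_lt,
        ⟨h.5.1, h.5.2, h.5.3⟩⟩
    have := hg.openSuper hη (fun c hc => ⟨⟨(ha c hc).lt, (ha c hc).cls, (ha c hc).incomplete⟩,
      (ha c hc).available⟩) hx hxc (k := s.active (small η)) rfl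
      (halfFull_of_not_fitsOpen hη hxc hfit) ((hasRoom_iff hr.cls).1 hroom)
      (b := s.numBins) (Finset.mem_insert_self _ _)
      (fun hb => lt_irrefl _ (h.failed_lt _ hb)) (by rw [hl0]; linarith [cap_le_one hη])
      (fun k' hk' _ u e => lt_irrefl _ (h.inv.layout.smallPrim_lt _
        (h.inv.layout.sr k' hk' _ u e).2.2))
      (fun β _ a ha' e _ => hzero a ha' (e ▸ Finset.mem_insert_self _ _))
    obtain ⟨h1, h2, h3⟩ := this
    exact ⟨h1, h2, ⟨h3.1, h3.2, h3.3, h3.4, h3.5, (Nat.le_succ _).trans h3.6⟩⟩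
  | nextGroup s s₁ s' hfit hroom hsel _ ih =>
    obtain ⟨h1, h2⟩ := h.completeSmall ha rfl hroom
    have hse := h1.selectActive hη hsm hsel
    obtain ⟨h3, h4, h5⟩ := ih hse.good fun c hc => by
      by_cases e : c = small η
      · rw [e]; exact hse.ready
      · exact hse.ready_other c e (h2 c hc e)
    have hsame : SameItems s s₁ := ⟨hse.same.1, hse.same.2, hse.same.3⟩
    exact ⟨h3, h4, hsame.trans_placed h5⟩

/-- The groups with an open super-replica. -/
def openGroups (s : State) : Finset ℕ :=
  (Finset.range s.numGroups).filter fun k => (s.grp k).sr.isSome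

lemma SelectActive.openGroups_subset {c : ℕ × ℕ} (h : SelectActive f η c s s') :
    openGroups s' ⊆ openGroups s := by
  rcases h with ⟨k, -, rfl⟩ | ⟨-, rfl⟩
  · exact subset_rfl
  · intro k hk
    simp only [openGroups, Finset.mem_filter, Finset.mem_range] at hk ⊢
    obtain ⟨hk, hk'⟩ := hk
    rcases Nat.lt_succ_iff_lt_or_eq.1 hk with hk | rfl
    · rw [show (openFresh f η s c).grp k = s.grp k from Function.update_of_ne hk.ne _ _] at hk'
      exact ⟨hk, hk'⟩
    · rw [show (openFresh f η s c).grp s.numGroups = ⟨c, s.numBins, 0, none, false⟩ from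
        Function.update_self ..] at hk'
      simp at hk'

/-- Several groups in succession may turn out to be full, so termination needs a measure: the number
of groups with an open super-replica. An active group without one has empty standby bins and
therefore room; so each group that is closed had one, and a fresh group adds none. -/
lemma exists_placeSmall (hη : 1 < η) (h : Good f η s) (ha : ∀ c ∈ classes η, Ready f η s c)
    (x : ℝ) : ∃ s', PlaceSmall f η x s s' := by
  have hsm : small η ∈ classes η := mem_classes.2 (Or.inl rfl)
  generalize hm : (openGroups s).card = m
  induction m using Nat.strong_induction_on generalizing s with
  | _ m ih =>
    have hr := ha _ hsm
    by_cases hfit : FitsOpen η s (s.grp (s.active (small η))) x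
    · obtain ⟨b, u, hsr, -⟩ := id hfit
      exact ⟨_, .join s b u hfit hsr⟩
    by_cases hroom : HasRoom f η s (s.grp (s.active (small η)))
    · by_cases hel : ∃ b, Eligible f η s (s.active (small η)) b
      · obtain ⟨b, hb⟩ := hel
        exact ⟨_, .oldBin s b hfit hroom hb⟩
      · exact ⟨_, .newBin s hfit hroom hel⟩
    · obtain ⟨h1, h2⟩ := h.completeSmall ha rfl hroom
      obtain ⟨s₁, hsel⟩ := exists_selectActive f η (small η)
        (setGroup (s.active (small η))
          { s.grp (s.active (small η)) with sr := none, complete := true } s)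
      have hse := h1.selectActive hη hsm hsel
      have hr₁ : ∀ c ∈ classes η, Ready f η s₁ c := fun c hc => by
        by_cases e : c = small η
        · rw [e]; exact hse.ready
        · exact hse.ready_other c e (h2 c hc e)
      have hlt : (openGroups s₁).card < m := by
        rw [← hm]
        refine (Finset.card_le_card hsel.openGroups_subset).trans_lt (Finset.card_lt_card ?_)
        rw [Finset.ssubset_iff_of_subset]
        · refine ⟨s.active (small η), ?_, ?_⟩
          · simp only [openGroups, Finset.mem_filter, Finset.mem_range]
            refine ⟨hr.lt, ?_⟩
            rw [Option.isSome_iff_ne_none]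
            intro hno
            refine hroom ((hasRoom_iff hr.cls).2 fun β hβ => ?_)
            have hst := h.inv.loads.sr_none _ hr.lt hr.cls hr.incomplete hno β hβ
            rw [level_eq_zero fun a ha' hβa => ?_]
            · linarith [cap_le_one hη]
            · rcases Finset.mem_insert.1 hβa with e | e
              · obtain ⟨k, hk, hi | hi⟩ := h.inv.items.item a ha'
                · have e' := h.inv.layout.own_disjoint k hk _ hr.lt β
                    (e ▸ hi.prim_mem h.inv.layout hk) hβ
                  exact hi.cls (e' ▸ hr.cls)
                · exact h.inv.layout.own_smallPrim _ hr.lt β hβ (e ▸ hi.prim)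
              · exact hst a ha' e
          · intro hmem
            have h' := (Finset.mem_filter.1 hmem).2
            simp [setGroup] at h'
        · intro k hk
          simp only [openGroups, Finset.mem_filter, Finset.mem_range, setGroup,
            Function.update_apply] at hk ⊢
          obtain ⟨hk, hk'⟩ := hk
          split_ifs at hk' with e
          · simp at hk'
          · exact ⟨hk, hk'⟩
      obtain ⟨s', hs'⟩ := ih _ hlt hse.good hr₁ rfl
      exact ⟨s', .nextGroup s s₁ s' hfit hroom hsel hs'⟩

/-! ### The events -/

lemma Good.arrive (hη : 1 < η) (h : Good f η s) (ha : ∀ c ∈ classes η, Ready f η s c)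
    (hx : 0 < x) (hx1 : x ≤ 1) (hs : Arrive f η x s s') :
    Good f η s' ∧ (∀ c ∈ classes η, Ready f η s' c) ∧ Placed x s s' := by
  obtain ⟨i, j, hi, hj, ⟨hc, hs⟩ | ⟨hc, hs⟩⟩ := hs
  · exact Good.placeSmall hη hx (le_cap_of_class hη hi hc) hs h ha
  · exact h.placeRegular hη ha hx hx1 (regularSize_of_class hη hi hj hc) hs

lemma exists_arrive (hη : 1 < η) (h : Good f η s) (ha : ∀ c ∈ classes η, Ready f η s c)
    (hx : 0 < x) (hx1 : x ≤ 1) : ∃ s', Arrive f η x s s' := by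
  have hη0 : 0 < η := by linarith
  obtain ⟨i, hi⟩ := exists_primaryClass hη hx hx1
  obtain ⟨j, hj⟩ := exists_standbyClass hη (div_pos hx hη0)
    (by rw [mul_div_cancel₀ _ hη0.ne']; exact hx1)
  by_cases hc : (i, j) = small η
  · obtain ⟨s', hs'⟩ := exists_placeSmall hη h ha x
    exact ⟨s', i, j, hi, hj, Or.inl ⟨hc, hs'⟩⟩
  · obtain ⟨s', hs'⟩ := exists_placeRegular (x := x) h
      (ha _ (regularSize_of_class hη hi hj hc).mem) hc
    exact ⟨s', i, j, hi, hj, Or.inr ⟨hc, hs'⟩⟩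

lemma exists_changeFailed (h : Good f η s) {F : Finset ℕ} (hF : F.card ≤ f) :
    ∃ s', ChangeFailed f η F s s' := by
  obtain ⟨cur, hcur⟩ := exists_adjusted h.inv.separated h.adjusted hF
  obtain ⟨s', hs'⟩ := exists_refresh f η (classes η) { s with cur := cur, failed := F }
  exact ⟨s', cur, hcur, hs'⟩

lemma Good.changeFailed (hη : 1 < η) (h : Good f η s) (ha : ∀ c ∈ classes η, Ready f η s c)
    {F : Finset ℕ} (hFs : F ⊆ Finset.range s.numBins) (hF : F.card ≤ f)
    (hs : ChangeFailed f η F s s') :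
    Good f η s' ∧ (∀ c ∈ classes η, Ready f η s' c) ∧ s'.toPacking = s.toPacking ∧
      s'.failed = F ∧ s.numBins ≤ s'.numBins := by
  obtain ⟨cur, hcur, hs⟩ := hs
  have hw := hcur.wellAdjusted
  have hg : Good f η { s with cur := cur, failed := F } :=
    ⟨h.inv.update cur F s.active, fun b hb => Finset.mem_range.1 (hFs hb), hF, h.sr_lt,
      ⟨hw.1, hw.2, hw.3⟩⟩
  obtain ⟨h1, h2, h3⟩ := hg.refresh hη (fun c hc => hc)
    (fun c hc => ⟨(ha c hc).lt, (ha c hc).cls, (ha c hc).incomplete⟩)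
    (fun c hc hn => absurd hc hn) hs
  exact ⟨h1, h2, h3.packing, h3.failed, h3.numBins_le⟩

lemma good_of_init (hη : 1 < η) (hs : Init f η s) :
    Good f η s ∧ (∀ c ∈ classes η, Ready f η s c) ∧ SameItems emptyState s := by
  obtain ⟨h1, h2, h3⟩ := (good_emptyState (f := f) (η := η)).foldl_openFresh hη (classes η)
    (nodup_classes η) (fun c hc => hc) (fun c _ k hk => absurd hk (Nat.not_lt_zero _))
  rw [Init] at hs
  rw [hs]
  exact ⟨h1, fun c hc => h2 c (Or.inl hc), h3⟩

/-! ### The number of opened bins -/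

lemma Inv.weight_nonneg (hη : 1 < η) (h : Inv f η s) (b : ℕ) : 0 ≤ weight η s b := by
  rw [weight, Packing.binSum]
  refine Finset.sum_nonneg fun a ha => ?_
  have hpos := (h.items.size a (Finset.mem_range.1 ha)).1
  split_ifs
  · exact primWeight_nonneg hη hpos
  · exact stbyWeight_nonneg hη (div_pos hpos (by linarith))
  · exact le_rfl

lemma one_le_of_density (hη : 1 < η) {l w : ℝ} (hl : 1 - cap η ≤ l)
    (hw : smallDensity η * l ≤ w) : 1 ≤ w := by
  have h1 := mul_le_mul_of_nonneg_left hl (smallDensity_nonneg hη)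
  rw [smallDensity_mul_cap hη] at h1
  linarith

/-- In a complete regular group the counts are exactly i per primary bin and j per standby bin. In a
complete small group the level is at least 1 - cap. -/
lemma Inv.one_le_weight_own (hη : 1 < η) (h : Inv f η s) {k : ℕ} (hk : k < s.numGroups)
    (hcpl : (s.grp k).complete = true) {b : ℕ} (hb : b ∈ (s.grp k).own f η) :
    1 ≤ weight η s b := by
  by_cases hc : (s.grp k).cls = small η
  · exact one_le_of_density hη (h.loads.complete k hk hc hcpl b hb)
      (h.loads.smallStby k hk hc b hb).2.1
  · obtain ⟨hi, -, hj, -⟩ := h.layout.bounds hk hc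
    have hcount := h.layout.count_eq k hk hc hcpl
    have hi' : (0 : ℝ) < (s.grp k).cls.1 := by exact_mod_cast hi
    have hj' : (0 : ℝ) < (s.grp k).cls.2 := by exact_mod_cast hj
    rcases Group.mem_own_cases hc hi hb with ⟨w, hw, rfl⟩ | ⟨m, hm, z, hz, rfl⟩
    · have := (h.loads.prim k hk hc w hw).2
      rw [hcount, count_mod hw] at this
      exact le_of_mul_le_mul_left (by linarith) hi'
    · have := (h.loads.stby k hk hc m hm z hz).2
      rw [hcount, count_div hj hz] at this
      exact le_of_mul_le_mul_left (by linarith) hj'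

/-- A bound on the number of opened bins of weight less than `1`. -/
noncomputable def maxLight (f : ℕ) (η : ℝ) : ℕ :=
  (classes η).toFinset.card * ((f + 1) * (f + (⌊6 * η⌋₊ + f * 6))) + maxUnfilled f η

/-- Light bins belong to incomplete groups or are unfilled primary bins for small items, and both
kinds are bounded in number. All other bins have weight at least 1, and the weights of all bins add
up to the weight of the items. -/
lemma Inv.numBins_le (hη : 1 < η) (h : Inv f η s) :
    (s.numBins : ℝ) ≤ ∑ a ∈ Finset.range s.n,
      (primWeight η (s.size a) + f * stbyWeight η (s.size a / η)) + maxLight f η := by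
  set B := (classes η).toFinset.biUnion
    (fun c => (incomplete s c).biUnion fun k => (s.grp k).own f η) ∪ unfilled η s with hB
  have hBcard : B.card ≤ maxLight f η := by
    refine (Finset.card_union_le _ _).trans (Nat.add_le_add ?_ h.loads.unfilled)
    refine Finset.card_biUnion_le_card_mul _ _ _ fun c _ => ?_
    -- A group for small items has f own bins and a regular one at most ⌊6η⌋ + 6f; the sum bounds
    -- both.
    refine (Finset.card_biUnion_le_card_mul _ _ (f + (⌊6 * η⌋₊ + f * 6)) fun k hk => ?_).trans
      (Nat.mul_le_mul_right _ (h.layout.card_incomplete c))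
    simp only [incomplete, Finset.mem_filter, Finset.mem_range] at hk
    rw [Group.own, Nat.card_Ico, Nat.add_sub_cancel_left, Group.len]
    split_ifs with hc
    · exact Nat.le_add_right _ _
    · obtain ⟨-, hi, -, hj⟩ := h.layout.bounds hk.1 hc
      have := Nat.mul_le_mul_left f hi
      omega
  have hheavy : ∀ b ∈ Finset.range s.numBins \ B, 1 ≤ weight η s b := by
    intro b hb
    rw [Finset.mem_sdiff, Finset.mem_range] at hb
    obtain ⟨hb, hbB⟩ := hb
    rw [hB, Finset.mem_union, not_or] at hbB
    rcases h.layout.cover b hb with hsp | ⟨k, hk, hbk⟩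
    · have : ¬ level η s b ≤ 1 - cap η := fun hl =>
        hbB.2 (by simp only [HS.unfilled, Finset.mem_filter]; exact ⟨hsp, hl⟩)
      exact one_le_of_density hη (not_le.1 this).le (h.loads.smallPrim b hsp).2
    · refine h.one_le_weight_own hη hk ?_ hbk
      by_contra hcpl
      refine hbB.1 (Finset.mem_biUnion.2 ⟨(s.grp k).cls,
        List.mem_toFinset.2 (h.layout.mem_classes k hk), Finset.mem_biUnion.2 ⟨k, ?_, hbk⟩⟩)
      simp only [incomplete, Finset.mem_filter, Finset.mem_range]
      exact ⟨hk, trivial, by simpa using hcpl⟩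
  have hsum := s.sum_binSum (primWeight η) (fun x => stbyWeight η (x / η))
    (Finset.range s.numBins) f
    (fun a ha => ⟨h.separated.prim_notMem a ha a ha, h.separated.card_stby a ha⟩)
    (fun a ha b hb => Finset.mem_range.2 (h.holders_lt ha b hb))
  rw [← hsum]
  have h1 : ((Finset.range s.numBins \ B).card : ℝ) ≤
      ∑ b ∈ Finset.range s.numBins, weight η s b := by
    calc ((Finset.range s.numBins \ B).card : ℝ)
        = ∑ b ∈ Finset.range s.numBins \ B, (1 : ℝ) := by simp
      _ ≤ ∑ b ∈ Finset.range s.numBins \ B, weight η s b := Finset.sum_le_sum hheavy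
      _ ≤ _ := Finset.sum_le_sum_of_subset_of_nonneg Finset.sdiff_subset
        fun b _ _ => h.weight_nonneg hη b
  have h2 : s.numBins ≤ (Finset.range s.numBins \ B).card + B.card := by
    have := Finset.le_card_sdiff B (Finset.range s.numBins)
    rw [Finset.card_range] at this
    omega
  have h3 : (s.numBins : ℝ) ≤ (Finset.range s.numBins \ B).card + maxLight f η := by
    exact_mod_cast h2.trans (Nat.add_le_add_left hBcard _)
  exact h3.trans (add_le_add h1 le_rfl)

end

end HS

/-! ### Runs -/

/-- An invariant of all runs of an algorithm. -/
lemma Run.invariant {f : ℕ} {A : OnlineAlgorithm} (p : List ℝ → A.State → Prop)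
    (h0 : ∀ s, A.init s → p [] s)
    (h1 : ∀ σ s s' x, p σ s → 0 < x → x ≤ 1 → A.arrive x s s' → p (σ ++ [x]) s')
    (h2 : ∀ σ s s' F, p σ s → F ⊆ (A.config s).opened → F.card ≤ f → A.changeFailed F s s' →
      p σ s') {σ : List ℝ} {s : A.State} (hr : Run f A σ s) : p σ s := by
  induction hr with
  | init hs => exact h0 _ hs
  | arrive _ hx hx1 hs ih => exact h1 _ _ _ _ ih hx hx1 hs
  | changeFailed _ hFs hF hs ih => exact h2 _ _ _ _ ih hFs hF hs

lemma good_of_run {f : ℕ} {η : ℝ} (hη : 1 < η) {σ : List ℝ} {s : HS.State}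
    (hr : Run f (harmonicStretch f η) σ s) :
    HS.Good f η s ∧ (∀ c ∈ HS.classes η, HS.Ready f η s c) ∧ s.sizes = σ := by
  refine Run.invariant (A := harmonicStretch f η) (fun σ (s : HS.State) =>
    HS.Good f η s ∧ (∀ c ∈ HS.classes η, HS.Ready f η s c) ∧ s.sizes = σ) ?_ ?_ ?_ hr
  · intro s hs
    obtain ⟨h1, h2, h3⟩ := HS.good_of_init hη hs
    exact ⟨h1, h2, by rw [h3.packing]; rfl⟩
  · intro σ s s' x ih hx hx1 hs
    obtain ⟨h1, h2, h3⟩ := ih.1.arrive hη ih.2.1 hx hx1 hs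
    refine ⟨h1, h2, ?_⟩
    rw [← ih.2.2, Packing.sizes, Packing.sizes, h3.n_eq, List.range_succ, List.map_append]
    congr 1
    · exact List.map_congr_left fun a ha => (h3.old a (List.mem_range.1 ha)).1
    · simp [h3.size_new]
  · intro σ s s' F ih hFs hF hs
    obtain ⟨h1, h2, h3, -⟩ := ih.1.changeFailed hη ih.2.1 hFs hF hs
    exact ⟨h1, h2, by rw [h3]; exact ih.2.2⟩

theorem harmonicStretch_solves (f : ℕ) (η : ℝ) (hη : 1 < η) :
    (harmonicStretch f η).Solves f η where
  exists_init := ⟨_, rfl⟩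
  exists_arrive σ s hr x hx hx1 :=
    HS.exists_arrive hη (good_of_run hη hr).1 (good_of_run hη hr).2.1 hx hx1
  exists_changeFailed σ s hr F _ hF := HS.exists_changeFailed (good_of_run hη hr).1 hF
  init_failed s hs := (HS.good_of_init hη hs).2.2.failed
  arrive_spec σ s hr x s' hx hx1 hs := by
    obtain ⟨-, -, h⟩ :=
      (good_of_run hη hr).1.arrive hη (good_of_run hη hr).2.1 hx hx1 hs
    exact ⟨⟨Finset.range_subset_range.2 h.numBins_le, h.n_eq ▸ Nat.le_succ _, h.old⟩, h.failed,
      h.disjoint⟩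
  changeFailed_spec σ s hr F s' hFs hF hs := by
    obtain ⟨-, -, h1, h2, h3⟩ :=
      (good_of_run hη hr).1.changeFailed hη (good_of_run hη hr).2.1 hFs hF hs
    refine ⟨⟨Finset.range_subset_range.2 h3, ?_, ?_⟩, h2⟩
    · exact (congrArg Packing.n h1).ge
    · exact fun a _ => ⟨congrFun (congrArg Packing.size h1) a,
        congrFun (congrArg Packing.prim h1) a, congrFun (congrArg Packing.stby h1) a⟩
  packs σ s hr := (good_of_run hη hr).2.2
  bins_opened σ s hr := Finset.biUnion_subset.2 fun a ha b hb =>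
    Finset.mem_range.2 ((good_of_run hη hr).1.inv.holders_lt (Finset.mem_range.1 ha) b hb)
  valid σ s hr := (good_of_run hη hr).1.inv.valid hη (good_of_run hη hr).1.adjusted
  served σ s hr := (good_of_run hη hr).1.inv.served hη (good_of_run hη hr).1.adjusted

/-- The total weight links both sides: the opened bins exceed it by at most `maxLight`, and it is at
most 7/4 times the optimum. The packing of the algorithm is itself valid, so the optimum is taken
over a nonempty set. -/
theorem harmonicStretch_hasCompetitiveRatio (f : ℕ) (η : ℝ) (hη : 1 < η) :
    (harmonicStretch f η).HasCompetitiveRatio f η (7 / 4) := by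
  refine ⟨HS.maxLight f η, fun σ s hr => ?_⟩
  obtain ⟨hg, -, hσ⟩ := good_of_run hη hr
  have hopt := weight_le_opt (hg.inv.valid hη hg.adjusted) hη hg.inv.items.size
  rw [hσ] at hopt
  have hcard : ((harmonicStretch f η).config s).opened.card = s.numBins := Finset.card_range _
  rw [hcard]
  exact (hg.inv.numBins_le hη).trans (add_le_add hopt le_rfl)

end FaultTolerant
theorem theorem2 (f : ℕ) (η : ℝ) (hη : 1 < η) :
    (FaultTolerant.harmonicStretch f η).Solves f η ∧
      (FaultTolerant.harmonicStretch f η).HasCompetitiveRatio f η (7 / 4) :=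
  ⟨FaultTolerant.harmonicStretch_solves f η hη,
    FaultTolerant.harmonicStretch_hasCompetitiveRatio f η hη⟩
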